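/- **Setting.** Let $\lambda_n\in\mathbb C\setminus\{0\}$ and $0<a_n<b_n$ for $n\ge 1$. Put $E_\lambda(z)=\lambda e^z$, $\Delta_n=\log\frac{b_n}{a_n}$, and $$I=\{z\in\mathbb C:\ a_n\le |E_{\lambda_n}\circ\cdots\circ E_{\lambda_1}(z)|\le b_n\ \text{for all sufficiently large } n\}.$$ Let $\dim_H$ and $\dim_P$ denote the Hausdorff and the packing dimension, and $\log^+=\max(\log,0)$. **Statement.** For all $0<q<1$ and $\Delta>0$ there is a constant $a$, depending only on $q$ and $\Delta$, such that the following holds for all sequences $(\lambda_n)$, $(a_n)$, $(b_n)$ as above that satisfy * (a) $a_{n+1}\le|\lambda_{n+1}|e^{qa_n}$ and $b_{n+1}\ge|\lambda_{n+1}|e^{-qa_n}$ for all sufficiently large $n$; * (b) $(a_1\cdots a_n)^{1/n}\to\infty$ as $n\to\infty$; * (c) $\Delta_n>\Delta$ for all $n\ge 1$; * (d) $\liminf_{n\to\infty}a_n>a$. We have $$1\le\dim_H I\le 1+\liminf_{n\to\infty}\frac{\log(\Delta_1\cdots\Delta_n)}{\log(a_1\cdots a_{n-1})+\log^+(a_n/\Delta_{n+1})},$$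 $$1\le\dim_P I\le 1+\limsup_{n\to\infty}\frac{\log(\Delta_1\cdots\Delta_{n+1})}{\log(a_1\cdots a_n)}.$$ If, additionally, $\sup_{n\ge1}\frac{\Delta_{n+1}}{a_n}<\infty$, then $$\dim_H I=1,\qquad \dim_P I\ge 1+\limsup_{n\to\infty}\frac{\log(\Delta_1\cdots\Delta_{n+1})}{\log(b_1\cdots b_n)}.$$ (The upper and lower limits are taken in $[-\infty,\infty]$.) -/

import Mathlib

open Filter Topology MeasureTheory
open scoped NNReal ENNReal

noncomputable section

namespace ExpIter

/-! ## Packing measures and packing dimension -/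

/-- A finite `δ`-packing of `E`: finitely many (centre, radius) pairs, with centres in `E`, radii in
`(0, δ]` and pairwise disjoint closed balls. -/
def IsPacking {X : Type*} [MetricSpace X] (E : Set X) (δ : ℝ) (P : Finset (X × ℝ)) : Prop :=
  (∀ p ∈ P, p.1 ∈ E ∧ 0 < p.2 ∧ p.2 ≤ δ) ∧
    (P : Set (X × ℝ)).PairwiseDisjoint (fun p => Metric.closedBall p.1 p.2)

/-- The supremum of `∑ (2 r_i) ^ s` over the `δ`-packings of `E` by balls of radii `r_i`
(in the plane, `2 r_i` is the diameter of the ball). The supremum over countable packings is the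
same, as the sums have nonnegative terms. -/
def packingSup {X : Type*} [MetricSpace X] (s δ : ℝ) (E : Set X) : ℝ≥0∞ :=
  ⨆ (P : Finset (X × ℝ)) (_ : IsPacking E δ P), ∑ p ∈ P, ENNReal.ofReal (2 * p.2) ^ s

/-- The `s`-dimensional packing premeasure: the limit of `packingSup s δ E` as `δ` decreases
to `0`, which is an infimum by monotonicity in `δ`. -/
def packingPremeasure {X : Type*} [MetricSpace X] (s : ℝ) (E : Set X) : ℝ≥0∞ :=
  ⨅ (δ : ℝ) (_ : 0 < δ), packingSup s δ E

/-- The `s`-dimensional packing (outer) measure. -/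
def packingMeasure {X : Type*} [MetricSpace X] (s : ℝ) (E : Set X) : ℝ≥0∞ :=
  ⨅ (F : ℕ → Set X) (_ : E ⊆ ⋃ i, F i), ∑' i, packingPremeasure s (F i)

/-- The packing dimension `sup {s ≥ 0 : P^s(E) = ∞}`; same pattern as Mathlib's `dimH`. -/
def dimP {X : Type*} [MetricSpace X] (E : Set X) : ℝ≥0∞ :=
  ⨆ (s : ℝ≥0) (_ : packingMeasure (s : ℝ) E = ∞), (s : ℝ≥0∞)

/-! ## Non-autonomous exponential iteration

All sequences are indexed by `n ≥ 1`; their value at `0` is irrelevant. -/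

/-- `iter lam n = E_{lam n} ∘ ⋯ ∘ E_{lam 1}`, where `E_c z = c * exp z`. -/
def iter (lam : ℕ → ℂ) : ℕ → ℂ → ℂ
  | 0, z => z
  | n + 1, z => lam (n + 1) * Complex.exp (iter lam n z)

/-- The set of points with `a n ≤ |E_{lam n} ∘ ⋯ ∘ E_{lam 1} (z)| ≤ b n` for all large `n`. -/
def rateSet (lam : ℕ → ℂ) (a b : ℕ → ℝ) : Set ℂ :=
  {z | ∀ᶠ n in atTop, a n ≤ ‖iter lam n z‖ ∧ ‖iter lam n z‖ ≤ b n}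

/-- The modulus `Δ_n = log (b_n / a_n)` of the `n`-th annulus. -/
def modulus (a b : ℕ → ℝ) (n : ℕ) : ℝ := Real.log (b n / a n)

/-- Admissibility of the sequences `a`, `b` with constant `q`. -/
def Admissible (q : ℝ) (lam : ℕ → ℂ) (a b : ℕ → ℝ) : Prop :=
  ∀ᶠ n in atTop, a (n + 1) ≤ ‖lam (n + 1)‖ * Real.exp (q * a n) ∧
    ‖lam (n + 1)‖ * Real.exp (-(q * a n)) ≤ b (n + 1)

/-- The standing setting (`lam_n ≠ 0`, `0 < a_n < b_n`) together with the general assumptions on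
the sequences, for given constants `q`, `Δ` and `A`. -/
structure Assumptions (q Δ A : ℝ) (lam : ℕ → ℂ) (a b : ℕ → ℝ) : Prop where
  lam_ne_zero : ∀ n, 1 ≤ n → lam n ≠ 0
  a_pos : ∀ n, 1 ≤ n → 0 < a n
  a_lt_b : ∀ n, 1 ≤ n → a n < b n
  admissible : Admissible q lam a b
  geom_mean : Tendsto (fun n : ℕ => (∏ i ∈ Finset.Icc 1 n, a i) ^ (1 / (n : ℝ))) atTop atTop
  modulus_gt : ∀ n, 1 ≤ n → Δ < modulus a b n
  liminf_gt : (A : EReal) < liminf (fun n => (a n : EReal)) atTop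

end ExpIter

end

/-
The iterate `iter lam n` has a derivative of modulus `∏ k ≤ n, |iter lam k z|` at `z`, so on the
rate set it is at least a constant times `a 1 * ⋯ * a n`, which outgrows every `C ^ n` by (b).
Constants lost at every step of an induction over `n` are therefore harmless.

*Upper bounds.* A point of a rate set is located up to bounded distortion by the logarithmic height
and the imaginary part of its iterates. If the `n`-th iterate lives at distance `x` from the origin,
about `x` cells of imaginary parts are needed, while the heights `log (r / a (n + 1))` of the next
radii `r` contribute the geometric sum `∑ r ^ (-t) ≲ a (n + 1) ^ (-t)`. Hence each level costs a
factor `a n ^ (-t)` in dimension `1 + t`, whatever the modulus is, and the modulus is only felt at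
the last level. There one covers either by squares of side `1` or by squares whose side is the
modulus, and the two choices give the two regimes of the bound for the Hausdorff dimension. For the
packing dimension, the balls of a packing are sorted by the level at which their images become
large, and area and length comparison replace the two coverings.

*Lower bounds.* By (a) and (d) the rate set contains the points whose iterates follow suitable
vertical strips, whose widths are comparable to the moduli if these are at most a multiple of `a n`.
The strips carry a tree of boxes, each of which is mapped by the exponential function over a number
of boxes proportional to width times radius. The uniform mass on this tree gives to a set of
diameter `r` at most `C ^ m * r / (w 1 * ⋯ * w m)`, where `m` is the level at which the set becomes
large. As the widths are bounded below, this is at most `r ^ (1 - ε)`; at scales comparable to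
`1 / (b 1 * ⋯ * b n)` the product of the widths improves the exponent, and the packing dimension
only needs such scales along a subsequence.
-/

namespace ExpIter

section Packing

variable {X : Type*} [MetricSpace X]

theorem packingSup_mono_radius {s δ δ' : ℝ} (h : δ ≤ δ') (E : Set X) :
    packingSup s δ E ≤ packingSup s δ' E :=
  iSup₂_le fun P hP => le_iSup₂_of_le P
    ⟨fun p hp => ⟨(hP.1 p hp).1, (hP.1 p hp).2.1, (hP.1 p hp).2.2.trans h⟩, hP.2⟩ le_rfl

theorem packingSup_le_rpow_mul_packingSup {s s' δ : ℝ} (h : s' ≤ s) (E : Set X) :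
    packingSup s δ E ≤ ENNReal.ofReal (2 * δ) ^ (s - s') * packingSup s' δ E := by
  refine iSup₂_le fun P hP => ?_
  have hterm : ∀ p ∈ P, ENNReal.ofReal (2 * p.2) ^ s ≤
      ENNReal.ofReal (2 * δ) ^ (s - s') * ENNReal.ofReal (2 * p.2) ^ s' := by
    intro p hp
    obtain ⟨-, hr, hrδ⟩ := hP.1 p hp
    calc ENNReal.ofReal (2 * p.2) ^ s
        = ENNReal.ofReal (2 * p.2) ^ (s - s') * ENNReal.ofReal (2 * p.2) ^ s' := by
          rw [← ENNReal.rpow_add _ _ (by simpa using hr) ENNReal.ofReal_ne_top, sub_add_cancel]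
      _ ≤ _ := by gcongr
  calc ∑ p ∈ P, ENNReal.ofReal (2 * p.2) ^ s
      ≤ ENNReal.ofReal (2 * δ) ^ (s - s') * ∑ p ∈ P, ENNReal.ofReal (2 * p.2) ^ s' := by
        rw [Finset.mul_sum]; exact Finset.sum_le_sum hterm
    _ ≤ _ := by gcongr; exact le_iSup₂_of_le P hP le_rfl

theorem packingPremeasure_eq_zero_of_lt {s s' : ℝ} (h : s' < s) {E : Set X}
    (hE : packingPremeasure s' E ≠ ∞) : packingPremeasure s E = 0 := by
  obtain ⟨δ₀, hδ₀, hfin⟩ : ∃ δ₀ > 0, packingSup s' δ₀ E < ∞ := by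
    simpa only [packingPremeasure, iInf_lt_iff, exists_prop] using lt_top_iff_ne_top.2 hE
  have hle : ∀ᶠ δ in 𝓝[>] (0 : ℝ), packingPremeasure s E ≤
      ENNReal.ofReal (2 * δ) ^ (s - s') * packingSup s' δ₀ E := by
    filter_upwards [Ioo_mem_nhdsGT hδ₀] with δ hδ
    calc packingPremeasure s E ≤ packingSup s δ E := iInf₂_le δ hδ.1
      _ ≤ ENNReal.ofReal (2 * δ) ^ (s - s') * packingSup s' δ E :=
        packingSup_le_rpow_mul_packingSup h.le E
      _ ≤ _ := by gcongr; exact packingSup_mono_radius hδ.2.le E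
  have hrpow : Tendsto (fun δ : ℝ => ENNReal.ofReal (2 * δ) ^ (s - s')) (𝓝[>] 0) (𝓝 0) := by
    have hcont : Continuous fun δ : ℝ => ENNReal.ofReal (2 * δ) ^ (s - s') :=
      ENNReal.continuous_rpow_const.comp (ENNReal.continuous_ofReal.comp (continuous_const_mul 2))
    simpa [ENNReal.zero_rpow_of_pos (sub_pos.2 h)] using
      (hcont.tendsto 0).mono_left nhdsWithin_le_nhds
  have hlim := ENNReal.Tendsto.mul_const (b := packingSup s' δ₀ E) hrpow (Or.inr hfin.ne)
  rw [zero_mul] at hlim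
  exact le_antisymm (ge_of_tendsto hlim hle) zero_le

theorem packingMeasure_eq_zero_of_lt {s s' : ℝ} (h : s' < s) {E : Set X}
    (hE : packingMeasure s' E ≠ ∞) : packingMeasure s E = 0 := by
  obtain ⟨F, hEF, hfin⟩ :
      ∃ F : ℕ → Set X, E ⊆ ⋃ i, F i ∧ ∑' i, packingPremeasure s' (F i) < ∞ := by
    simpa only [packingMeasure, iInf_lt_iff, exists_prop] using lt_top_iff_ne_top.2 hE
  have hzero : ∀ i, packingPremeasure s (F i) = 0 := fun i =>
    packingPremeasure_eq_zero_of_lt h (ENNReal.ne_top_of_tsum_ne_top hfin.ne i)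
  exact le_antisymm (iInf₂_le_of_le F hEF (by simp [hzero])) zero_le

theorem packingMeasure_mono {s : ℝ} {E F : Set X} (h : E ⊆ F) :
    packingMeasure s E ≤ packingMeasure s F :=
  le_iInf₂ fun G hG => iInf₂_le G (h.trans hG)

theorem dimP_mono {E F : Set X} (h : E ⊆ F) : dimP E ≤ dimP F :=
  iSup₂_le fun s hs => le_iSup₂_of_le s (top_le_iff.1 (hs ▸ packingMeasure_mono h)) le_rfl

theorem le_dimP_of_packingMeasure_ne_zero {s : ℝ} {E : Set X}
    (hE : packingMeasure s E ≠ 0) : ENNReal.ofReal s ≤ dimP E := by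
  refine le_of_forall_lt fun c hc => ?_
  obtain ⟨c', hcc', hc's⟩ := exists_between hc
  lift c' to ℝ≥0 using hc's.ne_top
  have hlt : (c' : ℝ) < s := by
    simpa using (ENNReal.lt_ofReal_iff_toReal_lt ENNReal.coe_ne_top).1 hc's
  have htop : packingMeasure (c' : ℝ) E = ∞ := by
    by_contra h
    exact hE (packingMeasure_eq_zero_of_lt hlt h)
  exact hcc'.trans_le (le_iSup₂_of_le c' htop le_rfl)

theorem dimP_le_of_packingPremeasure_ne_top {ι : Type*} [Countable ι] [Nonempty ι] {s : ℝ}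
    {E : Set X} {F : ι → Set X} (hEF : E ⊆ ⋃ i, F i)
    (hF : ∀ i, packingPremeasure s (F i) ≠ ∞) : dimP E ≤ ENNReal.ofReal s := by
  refine iSup₂_le fun c hc => ?_
  by_contra! hlt
  have hsc : s < c := by
    by_contra! hcs
    exact hlt.not_ge (by simpa using ENNReal.ofReal_le_ofReal hcs)
  obtain ⟨f, hf⟩ := exists_surjective_nat ι
  have hzero : packingMeasure (c : ℝ) E ≤ 0 :=
    iInf₂_le_of_le (fun n => F (f n)) (by rwa [hf.iUnion_comp F])
      (by simp [fun n => packingPremeasure_eq_zero_of_lt hsc (hF (f n))])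
  simp [hc] at hzero

theorem exists_isSeparated_card_eq {ε : ℝ≥0} {E : Set X} {n : ℕ}
    (h : (n : ℕ∞) ≤ Metric.packingNumber ε E) :
    ∃ P : Finset X, (P : Set X) ⊆ E ∧ Metric.IsSeparated ε (P : Set X) ∧ P.card = n := by
  obtain ⟨C, hCE, hC, hn⟩ : ∃ C ⊆ E, Metric.IsSeparated ε C ∧ (n : ℕ∞) ≤ C.encard := by
    by_contra! hcon
    rcases n with _ | n
    · exact absurd (hcon ∅ (Set.empty_subset E) .empty) (by simp)
    · have hle : Metric.packingNumber ε E ≤ n := iSup₂_le fun C hCE => iSup_le fun hC =>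
        Order.le_of_lt_add_one (by exact_mod_cast hcon C hCE hC)
      exact absurd (h.trans hle) (by norm_cast; omega)
  obtain ⟨t, htC, htn⟩ := Set.exists_subset_encard_eq hn
  have hfin : t.Finite := Set.finite_of_encard_eq_coe htn
  lift t to Finset X using hfin
  exact ⟨t, htC.trans hCE, hC.subset htC, by simpa [Set.encard_coe_eq_coe_finsetCard] using htn⟩

theorem card_mul_le_packingSup {s δ : ℝ} {r : ℝ≥0} (hr : 0 < r) (hrδ : r ≤ δ) {E : Set X}
    {P : Finset X} (hPE : (P : Set X) ⊆ E)
    (hP : Metric.IsSeparated ((2 * r : ℝ≥0) : ℝ≥0∞) (P : Set X)) :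
    P.card * ENNReal.ofReal (2 * r) ^ s ≤ packingSup s δ E := by
  classical
  have hinj : Set.InjOn (fun x : X => (x, (r : ℝ))) P := fun x _ y _ hxy => (Prod.mk.inj hxy).1
  refine le_iSup₂_of_le (P.image fun x => (x, (r : ℝ))) ⟨?_, ?_⟩ ?_
  · simp only [Finset.forall_mem_image]
    exact fun x hx => ⟨hPE hx, hr, hrδ⟩
  · rw [Finset.coe_image, hinj.pairwiseDisjoint_image]
    intro x hx y hy hxy
    have hdist : ((2 * r : ℝ≥0) : ℝ) < dist x y := by
      have : ((2 * r : ℝ≥0) : ℝ≥0∞) < edist x y := hP hx hy hxy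
      rw [edist_nndist, ENNReal.coe_lt_coe] at this
      exact_mod_cast this
    refine Metric.closedBall_disjoint_closedBall ?_
    push_cast at hdist
    linarith
  · rw [Finset.sum_image hinj]
    simp

theorem packingNumber_mul_le_packingSup {s δ : ℝ} {r : ℝ≥0} (hr : 0 < r) (hrδ : r ≤ δ)
    (E : Set X) :
    (Metric.packingNumber (2 * r) E : ℝ≥0∞) * ENNReal.ofReal (2 * r) ^ s ≤ packingSup s δ E := by
  have hcard : ∀ n : ℕ, (n : ℕ∞) ≤ Metric.packingNumber (2 * r) E →
      n * ENNReal.ofReal (2 * r) ^ s ≤ packingSup s δ E := by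
    intro n hn
    obtain ⟨P, hPE, hP, rfl⟩ := exists_isSeparated_card_eq hn
    exact card_mul_le_packingSup hr hrδ hPE hP
  rcases h : Metric.packingNumber (2 * r) E with _ | n
  · have hpos : ENNReal.ofReal (2 * r) ^ s ≠ 0 :=
      (ENNReal.rpow_pos (by simpa using hr) ENNReal.ofReal_ne_top).ne'
    have htop : packingSup s δ E = ∞ := ENNReal.eq_top_of_forall_nnreal_le fun c => by
      obtain ⟨n, hn⟩ := ENNReal.exists_nat_mul_gt hpos (ENNReal.coe_ne_top (r := c))
      exact hn.le.trans (hcard n (h ▸ le_top))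
    exact htop ▸ le_top
  · exact hcard n (h ▸ le_rfl)

theorem outerMeasure_le_coveringNumber_mul (ν : OuterMeasure X) {ε : ℝ≥0} {c : ℝ≥0∞} (hc : c ≠ 0)
    (h : ∀ B : Set X, (∀ x ∈ B, ∀ y ∈ B, dist x y ≤ 2 * ε) → ν B ≤ c) (E : Set X) :
    ν E ≤ Metric.coveringNumber ε E * c := by
  by_cases htop : Metric.coveringNumber ε E = ⊤
  · simp [htop, ENNReal.top_mul hc]
  obtain ⟨C, -, hfin, hcov, hcard⟩ := Metric.exists_set_encard_eq_coveringNumber htop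
  rw [Metric.isCover_iff_subset_iUnion_closedBall] at hcov
  lift C to Finset X using hfin
  calc ν E ≤ ν (⋃ x ∈ C, Metric.closedBall x ε) := ν.mono (by exact_mod_cast hcov)
    _ ≤ ∑ x ∈ C, ν (Metric.closedBall x ε) := measure_biUnion_finset_le _ _
    _ ≤ ∑ _x ∈ C, c := Finset.sum_le_sum fun x _ => h _ fun y hy z hz => by
        rw [Metric.mem_closedBall] at hy hz
        linarith [dist_triangle_right y z x]
    _ = Metric.coveringNumber ε E * c := by
        rw [← hcard, Set.encard_coe_eq_coe_finsetCard, Finset.sum_const, nsmul_eq_mul]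
        simp

/-- A mass distribution principle for packing measures: in contrast to the one for Hausdorff
measures, it only needs the mass bound along a sequence of scales tending to `0`. -/
theorem outerMeasure_le_mul_packingMeasure {s K : ℝ} (hK : 0 < K) (ν : OuterMeasure X)
    (h : ∀ δ > 0, ∃ r, 0 < r ∧ r ≤ δ ∧ ∀ B : Set X, (∀ x ∈ B, ∀ y ∈ B, dist x y ≤ 4 * r) →
      ν B ≤ ENNReal.ofReal K * ENNReal.ofReal (2 * r) ^ s) (E : Set X) :
    ν E ≤ ENNReal.ofReal K * packingMeasure s E := by
  have hK0 : ENNReal.ofReal K ≠ 0 := by simpa using hK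
  have hpre : ∀ F : Set X, ν F ≤ ENNReal.ofReal K * packingPremeasure s F := by
    intro F
    simp only [packingPremeasure, ENNReal.mul_iInf_of_ne hK0 ENNReal.ofReal_ne_top]
    refine le_iInf₂ fun δ hδ => ?_
    obtain ⟨r, hr, hrδ, hB⟩ := h δ hδ
    lift r to ℝ≥0 using hr.le
    have hc : ENNReal.ofReal K * ENNReal.ofReal (2 * r) ^ s ≠ 0 :=
      mul_ne_zero hK0 (ENNReal.rpow_pos (by simpa using hr) ENNReal.ofReal_ne_top).ne'
    calc ν F
        ≤ Metric.coveringNumber (2 * r) F * (ENNReal.ofReal K * ENNReal.ofReal (2 * r) ^ s) :=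
          outerMeasure_le_coveringNumber_mul ν hc (fun B hd => hB B fun x hx y hy =>
            (hd x hx y hy).trans_eq (by push_cast; ring)) F
      _ ≤ Metric.packingNumber (2 * r) F * (ENNReal.ofReal K * ENNReal.ofReal (2 * r) ^ s) := by
          gcongr; exact Metric.coveringNumber_le_packingNumber _ F
      _ = ENNReal.ofReal K *
          (Metric.packingNumber (2 * r) F * ENNReal.ofReal (2 * r) ^ s) := mul_left_comm _ _ _
      _ ≤ _ := by gcongr; exact packingNumber_mul_le_packingSup (by exact_mod_cast hr) hrδ F
  simp only [packingMeasure, ENNReal.mul_iInf_of_ne hK0 ENNReal.ofReal_ne_top]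
  refine le_iInf₂ fun F hF => ?_
  calc ν E ≤ ν (⋃ i, F i) := ν.mono hF
    _ ≤ ∑' i, ν (F i) := measure_iUnion_le F
    _ ≤ ∑' i, ENNReal.ofReal K * packingPremeasure s (F i) := ENNReal.tsum_le_tsum fun i => hpre _
    _ = _ := ENNReal.tsum_mul_left

end Packing

section Growth

/-- The modulus of the derivative of `iter lam n` at `z`. -/
noncomputable def derivNorm (lam : ℕ → ℂ) (n : ℕ) (z : ℂ) : ℝ :=
  ∏ k ∈ Finset.range n, ‖iter lam (k + 1) z‖

variable {lam : ℕ → ℂ}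

@[simp] theorem derivNorm_zero (z : ℂ) : derivNorm lam 0 z = 1 := by simp [derivNorm]

theorem derivNorm_succ (n : ℕ) (z : ℂ) :
    derivNorm lam (n + 1) z = derivNorm lam n z * ‖iter lam (n + 1) z‖ := by
  simp [derivNorm, Finset.prod_range_succ]

theorem derivNorm_nonneg (n : ℕ) (z : ℂ) : 0 ≤ derivNorm lam n z :=
  Finset.prod_nonneg fun _ _ => norm_nonneg _

theorem norm_iter_succ (n : ℕ) (z : ℂ) :
    ‖iter lam (n + 1) z‖ = ‖lam (n + 1)‖ * Real.exp (iter lam n z).re := by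
  simp [iter, Complex.norm_exp]

theorem norm_iter_succ_pos {n : ℕ} (hlam : lam (n + 1) ≠ 0) (z : ℂ) :
    0 < ‖iter lam (n + 1) z‖ := by
  rw [norm_iter_succ]
  positivity

theorem re_iter_eq {n : ℕ} (hlam : lam (n + 1) ≠ 0) (z : ℂ) :
    (iter lam n z).re = Real.log ‖iter lam (n + 1) z‖ - Real.log ‖lam (n + 1)‖ := by
  rw [norm_iter_succ, Real.log_mul (norm_ne_zero_iff.2 hlam) (Real.exp_ne_zero _), Real.log_exp]
  ring

theorem norm_exp_sub_exp (u v : ℂ) :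
    ‖Complex.exp u - Complex.exp v‖ = ‖Complex.exp v‖ * ‖Complex.exp (u - v) - 1‖ := by
  rw [← norm_mul, mul_sub, ← Complex.exp_add]
  simp

theorem norm_iter_succ_sub (n : ℕ) (z w : ℂ) :
    ‖iter lam (n + 1) z - iter lam (n + 1) w‖ =
      ‖iter lam (n + 1) w‖ * ‖Complex.exp (iter lam n z - iter lam n w) - 1‖ := by
  simp only [iter]
  rw [← mul_sub, norm_mul, norm_exp_sub_exp, norm_mul, mul_assoc]

theorem half_norm_le_norm_exp_sub_one {h : ℂ} (hh : ‖h‖ ≤ 1 / 2) :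
    ‖h‖ / 2 ≤ ‖Complex.exp h - 1‖ := by
  have remainder := Complex.norm_exp_sub_one_sub_id_le (x := h) (by linarith)
  have triangle : ‖h‖ ≤ ‖Complex.exp h - 1‖ + ‖Complex.exp h - 1 - h‖ := by
    simpa using norm_sub_le (Complex.exp h - 1) (Complex.exp h - 1 - h)
  nlinarith [norm_nonneg h]

theorem derivNorm_mul_norm_sub_le {n : ℕ} {z w : ℂ}
    (h : ∀ k < n, ‖iter lam k z - iter lam k w‖ ≤ 1 / 2) :
    derivNorm lam n w * ‖z - w‖ ≤ 2 ^ n * ‖iter lam n z - iter lam n w‖ := by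
  induction n with
  | zero => simp [iter]
  | succ n ih =>
    have ih' := ih fun k hk => h k (by omega)
    have expand := half_norm_le_norm_exp_sub_one (h n (by omega))
    rw [derivNorm_succ, norm_iter_succ_sub]
    calc derivNorm lam n w * ‖iter lam (n + 1) w‖ * ‖z - w‖
        = ‖iter lam (n + 1) w‖ * (derivNorm lam n w * ‖z - w‖) := by ring
      _ ≤ ‖iter lam (n + 1) w‖ * (2 ^ n * ‖iter lam n z - iter lam n w‖) := by gcongr
      _ ≤ ‖iter lam (n + 1) w‖ *
          (2 ^ n * (2 * ‖Complex.exp (iter lam n z - iter lam n w) - 1‖)) := by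
          gcongr; linarith
      _ = _ := by ring

theorem norm_iter_succ_sub_le {n : ℕ} {z w : ℂ} (h : ‖iter lam n z - iter lam n w‖ ≤ 1) :
    ‖iter lam (n + 1) z - iter lam (n + 1) w‖ ≤
      2 * ‖iter lam (n + 1) w‖ * ‖iter lam n z - iter lam n w‖ := by
  rw [norm_iter_succ_sub]
  have := Complex.norm_exp_sub_one_le h
  calc _ ≤ ‖iter lam (n + 1) w‖ * (2 * ‖iter lam n z - iter lam n w‖) := by gcongr
    _ = _ := by ring

theorem norm_iter_sub_le {n : ℕ} {z w : ℂ}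
    (h : ∀ k < n, ‖iter lam k z - iter lam k w‖ ≤ 1) :
    ‖iter lam n z - iter lam n w‖ ≤ 2 ^ n * derivNorm lam n w * ‖z - w‖ := by
  induction n with
  | zero => simp [iter]
  | succ n ih =>
    refine (norm_iter_succ_sub_le (h n (by omega))).trans ?_
    have := ih fun k hk => h k (by omega)
    calc _ ≤ 2 * ‖iter lam (n + 1) w‖ * (2 ^ n * derivNorm lam n w * ‖z - w‖) := by gcongr
      _ = _ := by rw [derivNorm_succ]; ring

end Growth

section OuterMeasure

variable {X : Type*} (Φ : OuterMeasure X) {s : Set X} {f : X → ℝ} {y : ℝ}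

theorem outerMeasure_le_sum_of_cover {ι : Type*} (I : Finset ι) (Y : ι → Set X)
    (h : ∀ x ∈ s, ∃ i ∈ I, x ∈ Y i) : Φ s ≤ ∑ i ∈ I, Φ (s ∩ Y i) := by
  refine le_trans (Φ.mono fun x hx => ?_) (measure_biUnion_finset_le I fun i => s ∩ Y i)
  obtain ⟨i, hi, hxi⟩ := h x hx
  exact Set.mem_biUnion hi ⟨hx, hxi⟩

theorem outerMeasure_le_sum_natFloor (hf : ∀ x ∈ s, f x ≤ y) :
    Φ s ≤ ∑ i ∈ Finset.range (⌊y⌋₊ + 1), Φ (s ∩ {x | ⌊f x⌋₊ = i}) :=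
  outerMeasure_le_sum_of_cover Φ _ (fun i => {x | ⌊f x⌋₊ = i}) fun x hx =>
    ⟨⌊f x⌋₊, Finset.mem_range.2 (Nat.lt_succ_of_le (Nat.floor_le_floor (hf x hx))), rfl⟩

theorem outerMeasure_le_mul_of_floor_fibers (hy : 0 ≤ y) (hf : ∀ x ∈ s, |f x| ≤ y) {c : ℝ≥0∞}
    (h : ∀ j : ℤ, Φ (s ∩ {x | ⌊f x⌋ = j}) ≤ c) : Φ s ≤ ENNReal.ofReal (2 * y + 3) * c := by
  set N : ℕ := ⌊y⌋₊ + 1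
  have hyN : y < N := by exact_mod_cast Nat.lt_floor_add_one y
  have cover : ∀ x ∈ s, ∃ j ∈ Finset.Icc (-(N : ℤ)) N, x ∈ {x | ⌊f x⌋ = j} := fun x hx => by
    obtain ⟨hlow, hhigh⟩ := abs_le.1 (hf x hx)
    refine ⟨⌊f x⌋, Finset.mem_Icc.2 ⟨Int.le_floor.2 ?_, Int.floor_le_iff.2 ?_⟩, rfl⟩ <;>
      push_cast <;> linarith
  have card : ((Finset.Icc (-(N : ℤ)) N).card : ℝ) ≤ 2 * y + 3 := by
    have h1 : (Finset.Icc (-(N : ℤ)) N).card = 2 * N + 1 := by rw [Int.card_Icc]; omega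
    have h2 := Nat.floor_le hy
    rw [h1]
    simp only [N]
    push_cast
    linarith
  calc Φ s ≤ ∑ j ∈ Finset.Icc (-(N : ℤ)) N, Φ (s ∩ {x | ⌊f x⌋ = j}) :=
        outerMeasure_le_sum_of_cover Φ _ _ cover
    _ ≤ ∑ _j ∈ Finset.Icc (-(N : ℤ)) N, c := Finset.sum_le_sum fun j _ => h j
    _ = ENNReal.ofReal ((Finset.Icc (-(N : ℤ)) N).card : ℝ) * c := by
        rw [Finset.sum_const, nsmul_eq_mul, ENNReal.ofReal_natCast]
    _ ≤ _ := by gcongr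

end OuterMeasure

section RealFacts

theorem abs_sub_le_of_floor_eq {c u v : ℝ} (hc : 0 < c) (h : ⌊c * u⌋ = ⌊c * v⌋) :
    |u - v| ≤ 1 / c := by
  have := Int.abs_sub_lt_one_of_floor_eq_floor h
  rw [← mul_sub, abs_mul, abs_of_pos hc] at this
  rw [le_div_iff₀ hc]
  linarith

theorem exp_quarter_le_two : Real.exp (1 / 4) ≤ 2 := by
  rw [← Real.le_log_iff_exp_le two_pos]
  linarith [Real.log_two_gt_d9]

theorem rpow_neg_eq_mul_rpow_neg_one_add {x : ℝ} (hx : 0 < x) (t : ℝ) :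
    x ^ (-t) = x * x ^ (-(1 + t)) := by
  rw [show -t = 1 + -(1 + t) by ring, Real.rpow_add hx, Real.rpow_one]

theorem sum_mul_exp_rpow_le {x γ : ℝ} (hγ : 0 < γ) (hx : 0 < x) (m : ℕ) :
    ∑ i ∈ Finset.range m, (x * Real.exp (i / 4)) ^ (-γ) ≤
      x ^ (-γ) * (1 - Real.exp (-γ / 4))⁻¹ := by
  have term : ∀ i : ℕ, (x * Real.exp (i / 4)) ^ (-γ) = x ^ (-γ) * Real.exp (-γ / 4) ^ i := by
    intro i
    rw [Real.mul_rpow hx.le (Real.exp_pos _).le, ← Real.exp_mul, ← Real.exp_nat_mul]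
    congr 2
    ring
  have ratio_lt_one : Real.exp (-γ / 4) < 1 := Real.exp_lt_one_iff.2 (by linarith)
  simp_rw [term]
  rw [← Finset.mul_sum, ← tsum_geometric_of_lt_one (Real.exp_pos _).le ratio_lt_one]
  gcongr
  exact (summable_geometric_of_lt_one (Real.exp_pos _).le ratio_lt_one).sum_le_tsum _
    fun _ _ => by positivity

end RealFacts

section RateSets

/-- The points of the disc of radius `M` whose iterates of all orders `n ≥ 1` have modulus
between `α n` and `β n`. -/
def boundedRateSet (lam : ℕ → ℂ) (α β : ℕ → ℝ) (M : ℝ) : Set ℂ :=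
  {z | ‖z‖ ≤ M ∧ ∀ n, α (n + 1) ≤ ‖iter lam (n + 1) z‖ ∧ ‖iter lam (n + 1) z‖ ≤ β (n + 1)}

/-- The height `log (‖iter lam n z‖ / α n)` of the `n`-th iterate above the inner circle of the
`n`-th annulus. It lies in `[0, modulus α β n]` for the points of the rate set, and it is the real
part of the previous iterate up to a constant. -/
noncomputable def logHeight (lam : ℕ → ℂ) (α : ℕ → ℝ) (n : ℕ) (z : ℂ) : ℝ :=
  Real.log (‖iter lam n z‖ / α n)

variable {lam : ℕ → ℂ} {α β : ℕ → ℝ} {M : ℝ} {n : ℕ} {z w : ℂ}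

theorem modulus_nonneg (hα : 0 < α n) (hαβ : α n ≤ β n) : 0 ≤ modulus α β n :=
  Real.log_nonneg ((one_le_div hα).2 hαβ)

theorem modulus_pos (hα : 0 < α n) (hαβ : α n < β n) : 0 < modulus α β n :=
  Real.log_pos ((one_lt_div hα).2 hαβ)

theorem norm_iter_eq_mul_exp_logHeight (hα : 0 < α n) (hz : 0 < ‖iter lam n z‖) :
    ‖iter lam n z‖ = α n * Real.exp (logHeight lam α n z) := by
  rw [logHeight, Real.exp_log (div_pos hz hα)]
  field_simp

theorem logHeight_nonneg (hα : 0 < α (n + 1)) (hz : z ∈ boundedRateSet lam α β M) :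
    0 ≤ logHeight lam α (n + 1) z :=
  Real.log_nonneg ((one_le_div hα).2 (hz.2 n).1)

theorem logHeight_le_modulus (hα : 0 < α (n + 1)) (hz : z ∈ boundedRateSet lam α β M) :
    logHeight lam α (n + 1) z ≤ modulus α β (n + 1) :=
  Real.log_le_log (div_pos (hα.trans_le (hz.2 n).1) hα) (by gcongr; exact (hz.2 n).2)

theorem re_iter_sub_eq_logHeight_sub (hlam : lam (n + 1) ≠ 0) (hα : 0 < α (n + 1)) :
    (iter lam n z - iter lam n w).re =
      logHeight lam α (n + 1) z - logHeight lam α (n + 1) w := by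
  rw [Complex.sub_re, re_iter_eq hlam, re_iter_eq hlam, logHeight, logHeight,
    Real.log_div (norm_iter_succ_pos hlam z).ne' hα.ne',
    Real.log_div (norm_iter_succ_pos hlam w).ne' hα.ne']
  ring

theorem abs_re_iter_sub_le_modulus (hlam : lam (n + 1) ≠ 0) (hα : 0 < α (n + 1))
    (hz : z ∈ boundedRateSet lam α β M) (hw : w ∈ boundedRateSet lam α β M) :
    |(iter lam n z - iter lam n w).re| ≤ modulus α β (n + 1) := by
  rw [re_iter_sub_eq_logHeight_sub hlam hα, abs_sub_le_iff]
  have hz0 := logHeight_nonneg hα hz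
  have hw0 := logHeight_nonneg hα hw
  have hz1 := logHeight_le_modulus hα hz
  have hw1 := logHeight_le_modulus hα hw
  constructor <;> linarith

theorem prod_le_derivNorm (hα : ∀ n, 0 ≤ α (n + 1)) (hz : z ∈ boundedRateSet lam α β M) (n : ℕ) :
    ∏ k ∈ Finset.range n, α (k + 1) ≤ derivNorm lam n z :=
  Finset.prod_le_prod (fun k _ => hα k) fun k _ => (hz.2 k).1

end RateSets

section Cells

/-- A subset of `K` on which the iterates up to order `n` stay close to each other, the derivative
of order `n` is at least `d` and the next iterate has modulus in `[x, 2 * x]`. -/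
structure IsCell (lam : ℕ → ℂ) (K : Set ℂ) (n : ℕ) (d x : ℝ) (X : Set ℂ) : Prop where
  subset : X ⊆ K
  le_derivNorm : ∀ z ∈ X, d ≤ derivNorm lam n z
  le_norm : ∀ z ∈ X, x ≤ ‖iter lam (n + 1) z‖
  norm_le : ∀ z ∈ X, ‖iter lam (n + 1) z‖ ≤ 2 * x
  norm_sub_le : ∀ z ∈ X, ∀ w ∈ X, ∀ k ≤ n, ‖iter lam k z - iter lam k w‖ ≤ 1 / 2

/-- The outer measure `Φ` of every cell of level `n` is at most `G * d ^ (-s) * x ^ (-γ)`. Such a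
bound is propagated from a level `n` down to level `0`, hence to the whole set `K`, by subdividing
cells. -/
def CellBound (lam : ℕ → ℂ) (K : Set ℂ) (η s : ℝ) (Φ : OuterMeasure ℂ) (n : ℕ) (γ G : ℝ) : Prop :=
  ∀ (d x : ℝ) (X : Set ℂ), 0 < d → η ≤ x → IsCell lam K n d x X →
    Φ X ≤ ENNReal.ofReal (G * d ^ (-s) * x ^ (-γ))

/-- The sum of `r ^ (-γ)` over the radii `r = α n * exp (i / 4)` needed to cover the `n`-th
annulus by the annuli `r ≤ |z| ≤ 2 * r`. -/
noncomputable def annulusSum (γ : ℝ) (α β : ℕ → ℝ) (n : ℕ) : ℝ :=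
  ∑ i ∈ Finset.range (⌊4 * modulus α β n⌋₊ + 1), (α n * Real.exp (i / 4)) ^ (-γ)

variable {lam : ℕ → ℂ} {α β : ℕ → ℝ} {M η s t γ G G' : ℝ} {Φ : OuterMeasure ℂ} {n : ℕ} {K : Set ℂ}

theorem annulusSum_nonneg (hα : 0 ≤ α n) : 0 ≤ annulusSum γ α β n :=
  Finset.sum_nonneg fun _ _ => Real.rpow_nonneg (mul_nonneg hα (Real.exp_pos _).le) _

theorem annulusSum_zero_le (hα : 0 < α n) (hαβ : α n ≤ β n) :
    annulusSum 0 α β n ≤ 4 * (modulus α β n + 1) := by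
  have := Nat.floor_le (a := 4 * modulus α β n) (by linarith [modulus_nonneg hα hαβ])
  simp only [annulusSum, neg_zero, Real.rpow_zero, Finset.sum_const, Finset.card_range,
    nsmul_eq_mul, mul_one, Nat.cast_add, Nat.cast_one]
  linarith

theorem annulusSum_le (ht : 0 < t) (hα : 0 < α n) :
    annulusSum t α β n ≤ α n ^ (-t) * (1 - Real.exp (-t / 4))⁻¹ :=
  sum_mul_exp_rpow_le ht hα _

theorem isCell_inter_floor (hlam : lam (n + 1) ≠ 0) (hα : 0 < α (n + 1)) {X : Set ℂ}
    (hX : X ⊆ boundedRateSet lam α β M) {d : ℝ} (hd : ∀ z ∈ X, d ≤ derivNorm lam n z)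
    (hclose : ∀ z ∈ X, ∀ w ∈ X, ∀ k < n, ‖iter lam k z - iter lam k w‖ ≤ 1 / 2) (i : ℕ) (j : ℤ) :
    IsCell lam (boundedRateSet lam α β M) n d (α (n + 1) * Real.exp (i / 4))
      (X ∩ {z | ⌊4 * logHeight lam α (n + 1) z⌋₊ = i} ∩ {z | ⌊4 * (iter lam n z).im⌋ = j}) := by
  set g := logHeight lam α (n + 1)
  have hg : ∀ z ∈ X, 0 ≤ 4 * g z := fun z hz => by linarith [logHeight_nonneg hα (hX hz)]
  have norm_eq : ∀ z, ‖iter lam (n + 1) z‖ = α (n + 1) * Real.exp (g z) := fun z =>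
    norm_iter_eq_mul_exp_logHeight hα (norm_iter_succ_pos hlam z)
  refine ⟨fun z hz => hX hz.1.1, fun z hz => hd z hz.1.1, ?_, ?_, ?_⟩
  · rintro z ⟨⟨hz, rfl⟩, -⟩
    rw [norm_eq]
    gcongr
    linarith [Nat.floor_le (hg z hz)]
  · rintro z ⟨⟨-, rfl⟩, -⟩
    rw [norm_eq]
    calc α (n + 1) * Real.exp (g z)
        ≤ α (n + 1) * Real.exp (⌊4 * g z⌋₊ / 4 + 1 / 4) := by
          gcongr
          linarith [Nat.lt_floor_add_one (4 * g z)]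
      _ ≤ α (n + 1) * (Real.exp (⌊4 * g z⌋₊ / 4) * 2) := by
          rw [Real.exp_add]
          gcongr
          exact exp_quarter_le_two
      _ = _ := by ring
  · intro z hz w hw k hk
    rcases hk.lt_or_eq with hk | rfl
    · exact hclose z hz.1.1 w hw.1.1 k hk
    · have hre : |(iter lam k z - iter lam k w).re| ≤ 1 / 4 := by
        rw [re_iter_sub_eq_logHeight_sub hlam hα]
        refine abs_sub_le_of_floor_eq (by norm_num) ?_
        rw [← Int.natCast_floor_eq_floor (hg z hz.1.1), ← Int.natCast_floor_eq_floor (hg w hw.1.1),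
          hz.1.2, hw.1.2]
      have him : |(iter lam k z - iter lam k w).im| ≤ 1 / 4 :=
        abs_sub_le_of_floor_eq (by norm_num) (hz.2.trans hw.2.symm)
      linarith [Complex.norm_le_abs_re_add_abs_im (iter lam k z - iter lam k w)]

theorem outerMeasure_le_of_cellBound (hlam : lam (n + 1) ≠ 0) (hη : 0 < η) (hα : η ≤ α (n + 1))
    (hG : 0 ≤ G) (hΦ : CellBound lam (boundedRateSet lam α β M) η s Φ n γ G) {X : Set ℂ}
    (hX : X ⊆ boundedRateSet lam α β M) {d y : ℝ} (hd : 0 < d) (hy : 0 ≤ y)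
    (hdX : ∀ z ∈ X, d ≤ derivNorm lam n z) (hyX : ∀ z ∈ X, ‖iter lam n z‖ ≤ y)
    (hclose : ∀ z ∈ X, ∀ w ∈ X, ∀ k < n, ‖iter lam k z - iter lam k w‖ ≤ 1 / 2) :
    Φ X ≤ ENNReal.ofReal ((8 * y + 3) * G * d ^ (-s) * annulusSum γ α β (n + 1)) := by
  have hα0 : 0 < α (n + 1) := hη.trans_le hα
  have height_le : ∀ z ∈ X, 4 * logHeight lam α (n + 1) z ≤ 4 * modulus α β (n + 1) :=
    fun z hz => by linarith [logHeight_le_modulus hα0 (hX hz)]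
  have im_le : ∀ z ∈ X, |4 * (iter lam n z).im| ≤ 4 * y := fun z hz => by
    rw [abs_mul, abs_of_pos four_pos]
    linarith [(Complex.abs_im_le_norm (iter lam n z)).trans (hyX z hz)]
  have piece_le : ∀ i : ℕ, Φ (X ∩ {z | ⌊4 * logHeight lam α (n + 1) z⌋₊ = i}) ≤
      ENNReal.ofReal ((8 * y + 3) * (G * d ^ (-s) * (α (n + 1) * Real.exp (i / 4)) ^ (-γ))) := by
    intro i
    have := outerMeasure_le_mul_of_floor_fibers Φ (by positivity : 0 ≤ 4 * y)
      (fun z hz => im_le z hz.1) fun j => hΦ d _ _ hd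
        (hα.trans (le_mul_of_one_le_right hα0.le (Real.one_le_exp (by positivity))))
        (isCell_inter_floor hlam hα0 hX hdX hclose i j)
    rwa [← ENNReal.ofReal_mul (by positivity), show 2 * (4 * y) + 3 = 8 * y + 3 by ring] at this
  refine (outerMeasure_le_sum_natFloor Φ height_le).trans
    ((Finset.sum_le_sum fun i _ => piece_le i).trans ?_)
  rw [← ENNReal.ofReal_sum_of_nonneg fun i _ => by positivity, ← Finset.mul_sum, ← Finset.mul_sum]
  exact ENNReal.ofReal_le_ofReal (le_of_eq (by rw [annulusSum]; ring))

theorem cellBound_mono (hη : 0 < η) (h : G ≤ G') (hΦ : CellBound lam K η s Φ n γ G) :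
    CellBound lam K η s Φ n γ G' := by
  intro d x X hd hx hX
  have : 0 < x := hη.trans_le hx
  exact (hΦ d x X hd hx hX).trans (by gcongr)

theorem cellBound_of_succ (hlam : lam (n + 2) ≠ 0) (hη : 0 < η) (hα : η ≤ α (n + 2)) (hG : 0 ≤ G)
    (hΦ : CellBound lam (boundedRateSet lam α β M) η (1 + t) Φ (n + 1) γ G) :
    CellBound lam (boundedRateSet lam α β M) η (1 + t) Φ n t
      ((16 + 3 / η) * G * annulusSum γ α β (n + 2)) := by
  intro d x X hd hx hX
  have hx0 : 0 < x := hη.trans_le hx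
  have derivNorm_ge : ∀ z ∈ X, d * x ≤ derivNorm lam (n + 1) z := fun z hz => by
    rw [derivNorm_succ]
    exact mul_le_mul (hX.le_derivNorm z hz) (hX.le_norm z hz) hx0.le (derivNorm_nonneg _ _)
  refine (outerMeasure_le_of_cellBound hlam hη hα hG hΦ hX.subset (mul_pos hd hx0)
    (by positivity : 0 ≤ 2 * x) derivNorm_ge hX.norm_le fun z hz w hw k hk =>
      hX.norm_sub_le z hz w hw k (Nat.le_of_lt_succ hk)).trans (ENNReal.ofReal_le_ofReal ?_)
  have hS : 0 ≤ annulusSum γ α β (n + 2) := annulusSum_nonneg (hη.le.trans hα)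
  have count_le : 8 * (2 * x) + 3 ≤ (16 + 3 / η) * x := by
    have : 3 ≤ 3 / η * x := by
      rw [div_mul_eq_mul_div, le_div_iff₀ hη]
      linarith
    linarith
  calc (8 * (2 * x) + 3) * G * (d * x) ^ (-(1 + t)) * annulusSum γ α β (n + 2)
      ≤ ((16 + 3 / η) * x) * G * (d * x) ^ (-(1 + t)) * annulusSum γ α β (n + 2) := by gcongr
    _ = _ := by
        rw [Real.mul_rpow hd.le hx0.le, rpow_neg_eq_mul_rpow_neg_one_add hx0 t]
        ring

theorem cellBound_of_succ_zero (hlam : lam (n + 2) ≠ 0) (hη : 0 < η) (hα : η ≤ α (n + 2))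
    (hαβ : α (n + 2) ≤ β (n + 2)) (hG : 0 ≤ G)
    (hΦ : CellBound lam (boundedRateSet lam α β M) η (1 + t) Φ (n + 1) 0 G) :
    CellBound lam (boundedRateSet lam α β M) η (1 + t) Φ n t
      ((64 + 12 / η) * G * (modulus α β (n + 2) + 1)) := by
  refine cellBound_mono hη ?_ (cellBound_of_succ hlam hη hα hG hΦ)
  calc (16 + 3 / η) * G * annulusSum 0 α β (n + 2)
      ≤ (16 + 3 / η) * G * (4 * (modulus α β (n + 2) + 1)) := by
        gcongr
        exact annulusSum_zero_le (hη.trans_le hα) hαβ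
    _ = _ := by ring

/-- The factor lost in each step of the descent from a cell bound of level `n` to the outer measure
of the whole set. -/
noncomputable def descentConst (η M t : ℝ) : ℝ :=
  (16 + 3 / η + 8 * M) * (1 - Real.exp (-t / 4))⁻¹

theorem le_descentConst {c : ℝ} (h : c ≤ 16 + 3 / η + 8 * M) (ht : 0 < t) :
    c * (1 - Real.exp (-t / 4))⁻¹ ≤ descentConst η M t := by
  have : 0 < 1 - Real.exp (-t / 4) := sub_pos.2 (Real.exp_lt_one_iff.2 (by linarith))
  rw [descentConst]
  gcongr

theorem descentConst_nonneg (hη : 0 < η) (hM : 0 ≤ M) (ht : 0 < t) : 0 ≤ descentConst η M t := by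
  simpa using le_descentConst (c := 0) (by positivity) ht

theorem outerMeasure_boundedRateSet_le (hlam : ∀ n, lam (n + 1) ≠ 0) (hη : 0 < η)
    (hα : ∀ n, η ≤ α (n + 1)) (hM : 0 ≤ M) (ht : 0 < t) (hG : 0 ≤ G)
    (hΦ : CellBound lam (boundedRateSet lam α β M) η (1 + t) Φ n t G) :
    Φ (boundedRateSet lam α β M) ≤ ENNReal.ofReal
      (G * descentConst η M t ^ (n + 1) * ∏ k ∈ Finset.range (n + 1), α (k + 1) ^ (-t)) := by
  have hα0 : ∀ n, 0 < α (n + 1) := fun n => hη.trans_le (hα n)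
  have hC := descentConst_nonneg hη hM ht
  have hη3 : 0 ≤ 3 / η := by positivity
  have step : ∀ c n, 0 ≤ c → c ≤ 16 + 3 / η + 8 * M → ∀ G, 0 ≤ G →
      c * G * annulusSum t α β (n + 1) ≤ G * descentConst η M t * α (n + 1) ^ (-t) := by
    intro c n hc hcle G hG
    have := hα0 n
    calc c * G * annulusSum t α β (n + 1)
        ≤ c * G * (α (n + 1) ^ (-t) * (1 - Real.exp (-t / 4))⁻¹) := by
          gcongr
          exact annulusSum_le ht (hα0 n)
      _ = G * (c * (1 - Real.exp (-t / 4))⁻¹) * α (n + 1) ^ (-t) := by ring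
      _ ≤ _ := by
          gcongr
          exact le_descentConst hcle ht
  induction n generalizing G with
  | zero =>
    refine (outerMeasure_le_of_cellBound (hlam 0) hη (hα 0) hG hΦ subset_rfl one_pos hM
      (by simp) (fun z hz => hz.1) (by simp)).trans (ENNReal.ofReal_le_ofReal ?_)
    simpa using step (8 * M + 3) 0 (by positivity) (by linarith) G hG
  | succ n ih =>
    have hn := cellBound_mono hη (step (16 + 3 / η) (n + 1) (by positivity) (by linarith) G hG)
      (cellBound_of_succ (hlam (n + 1)) hη (hα (n + 1)) hG hΦ)
    have := hα0 (n + 1)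
    refine (ih (by positivity) hn).trans (ENNReal.ofReal_le_ofReal (le_of_eq ?_))
    rw [Finset.prod_range_succ _ (n + 1), pow_succ _ (n + 1)]
    ring

end Cells

section Content

/-- The `s`-dimensional Hausdorff content of scale `r`. -/
noncomputable def hausdorffContent {X : Type*} [EMetricSpace X] (s : ℝ) (r : ℝ≥0∞) :
    OuterMeasure X :=
  OuterMeasure.mkMetric'.pre (fun A => Metric.ediam A ^ s) r

theorem hausdorffContent_le {X : Type*} [EMetricSpace X] {s : ℝ} (hs : 0 ≤ s) {ρ r : ℝ≥0∞}
    {Y : Set X} (hρ : Metric.ediam Y ≤ ρ) (hr : Metric.ediam Y ≤ r) :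
    hausdorffContent s r Y ≤ ρ ^ s := by
  refine (OuterMeasure.mkMetric'.pre_le hr).trans ?_
  gcongr

theorem hausdorffMeasure_eq_zero_of_content {X : Type*} [EMetricSpace X] [MeasurableSpace X]
    [BorelSpace X] {s : ℝ} {K : Set X} (h : ∀ r > 0, hausdorffContent s r K = 0) :
    μH[s] K = 0 := by
  rw [Measure.hausdorffMeasure, ← OuterMeasure.coe_mkMetric, OuterMeasure.mkMetric,
    OuterMeasure.mkMetric']
  simp only [OuterMeasure.iSup_apply, ENNReal.iSup_eq_zero]
  exact h

theorem ediam_le_of_mul_norm_sub_le {E : Type*} [SeminormedAddCommGroup E] {Y : Set E} {P ρ : ℝ}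
    (hP : 0 < P) (h : ∀ z ∈ Y, ∀ w ∈ Y, P * ‖z - w‖ ≤ ρ) :
    Metric.ediam Y ≤ ENNReal.ofReal (ρ / P) :=
  Metric.ediam_le_of_forall_dist_le fun z hz w hw => by
    rw [dist_eq_norm, le_div_iff₀ hP, mul_comm]
    exact h z hz w hw

variable {lam : ℕ → ℂ} {α β : ℕ → ℝ} {M η s t : ℝ} {r : ℝ≥0∞} {n : ℕ}

theorem hausdorffContent_le_of_derivNorm_mul_le (hs : 0 ≤ s) (hα : ∀ n, 0 < α (n + 1))
    {Y : Set ℂ} (hY : Y ⊆ boundedRateSet lam α β M) {d ρ : ℝ} (hd : 0 < d) (hρ : 0 ≤ ρ)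
    (hdY : ∀ z ∈ Y, d ≤ derivNorm lam n z)
    (h : ∀ z ∈ Y, ∀ w ∈ Y, derivNorm lam n w * ‖z - w‖ ≤ ρ)
    (hr : ENNReal.ofReal (ρ / ∏ k ∈ Finset.range n, α (k + 1)) ≤ r) :
    hausdorffContent s r Y ≤ ENNReal.ofReal (ρ ^ s * d ^ (-s)) := by
  have ediam_le : ∀ P, 0 < P → (∀ w ∈ Y, P ≤ derivNorm lam n w) →
      Metric.ediam Y ≤ ENNReal.ofReal (ρ / P) := fun P hP hPY =>
    ediam_le_of_mul_norm_sub_le hP fun z hz w hw =>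
      (mul_le_mul_of_nonneg_right (hPY w hw) (norm_nonneg _)).trans (h z hz w hw)
  have small : Metric.ediam Y ≤ r :=
    (ediam_le _ (Finset.prod_pos fun k _ => hα k) fun w hw =>
      prod_le_derivNorm (fun k => (hα k).le) (hY hw) n).trans hr
  refine (hausdorffContent_le hs (ediam_le d hd hdY) small).trans (le_of_eq ?_)
  rw [ENNReal.ofReal_rpow_of_nonneg (by positivity) hs, Real.div_rpow hρ hd.le,
    Real.rpow_neg hd.le, div_eq_mul_inv]

theorem cellBound_hausdorffContent (hα : ∀ n, 0 < α (n + 1)) (hs : 0 ≤ s)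
    (hr : ENNReal.ofReal (2 ^ n / ∏ k ∈ Finset.range n, α (k + 1)) ≤ r) :
    CellBound lam (boundedRateSet lam α β M) η s (hausdorffContent s r) n 0 ((2 ^ n) ^ s) := by
  intro d x X hd _ hX
  have close : ∀ z ∈ X, ∀ w ∈ X, derivNorm lam n w * ‖z - w‖ ≤ 2 ^ n := fun z hz w hw =>
    calc derivNorm lam n w * ‖z - w‖ ≤ 2 ^ n * ‖iter lam n z - iter lam n w‖ :=
          derivNorm_mul_norm_sub_le fun k hk => hX.norm_sub_le z hz w hw k hk.le
      _ ≤ 2 ^ n * 1 := by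
          gcongr
          linarith [hX.norm_sub_le z hz w hw n le_rfl]
      _ = 2 ^ n := mul_one _
  simpa using hausdorffContent_le_of_derivNorm_mul_le hs hα hX.subset hd (by positivity)
    hX.le_derivNorm close hr

theorem hausdorffContent_inter_floor_im_le (hlam : lam (n + 2) ≠ 0) (hα : ∀ n, 0 < α (n + 1))
    (hs : 0 ≤ s) (hΔ : 0 < modulus α β (n + 2))
    (hr : ENNReal.ofReal (2 ^ (n + 2) * modulus α β (n + 2) /
      ∏ k ∈ Finset.range (n + 1), α (k + 1)) ≤ r)
    {d x : ℝ} {X : Set ℂ} (hd : 0 < d) (hx : 0 < x)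
    (hX : IsCell lam (boundedRateSet lam α β M) n d x X) (j : ℤ) :
    hausdorffContent s r
        (X ∩ {z | ⌊(modulus α β (n + 2))⁻¹ * (iter lam (n + 1) z).im⌋ = j}) ≤
      ENNReal.ofReal ((2 ^ (n + 2) * modulus α β (n + 2)) ^ s * (d * x) ^ (-s)) := by
  set Λ := modulus α β (n + 2)
  refine hausdorffContent_le_of_derivNorm_mul_le (n := n + 1) hs hα
    (Set.inter_subset_left.trans hX.subset) (mul_pos hd hx) (by positivity) ?_ ?_ hr
  · intro z hz
    rw [derivNorm_succ]
    exact mul_le_mul (hX.le_derivNorm z hz.1) (hX.le_norm z hz.1) hx.le (derivNorm_nonneg _ _)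
  · intro z hz w hw
    have hre : |(iter lam (n + 1) z - iter lam (n + 1) w).re| ≤ Λ :=
      abs_re_iter_sub_le_modulus hlam (hα _) (hX.subset hz.1) (hX.subset hw.1)
    have him : |(iter lam (n + 1) z - iter lam (n + 1) w).im| ≤ Λ := by
      simpa using abs_sub_le_of_floor_eq (inv_pos.2 hΔ) (hz.2.trans hw.2.symm)
    calc derivNorm lam (n + 1) w * ‖z - w‖
        ≤ 2 ^ (n + 1) * ‖iter lam (n + 1) z - iter lam (n + 1) w‖ :=
          derivNorm_mul_norm_sub_le fun k hk =>
            hX.norm_sub_le z hz.1 w hw.1 k (Nat.le_of_lt_succ hk)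
      _ ≤ 2 ^ (n + 1) * (2 * Λ) := by
          gcongr
          linarith [Complex.norm_le_abs_re_add_abs_im (iter lam (n + 1) z - iter lam (n + 1) w)]
      _ = _ := by ring

theorem cellBound_hausdorffContent_of_modulus_le (hlam : lam (n + 2) ≠ 0) (hη : 0 < η)
    (hα : ∀ n, η ≤ α (n + 1)) (ht : 0 ≤ t) {D : ℝ} (hΔ : 0 < modulus α β (n + 2))
    (hΔD : modulus α β (n + 2) ≤ D * α (n + 1))
    (hr : ENNReal.ofReal (2 ^ (n + 2) * modulus α β (n + 2) /
      ∏ k ∈ Finset.range (n + 1), α (k + 1)) ≤ r) :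
    CellBound lam (boundedRateSet lam α β M) η (1 + t) (hausdorffContent (1 + t) r) n t
      ((4 + 6 * D) * (2 ^ (n + 2)) ^ (1 + t) * modulus α β (n + 2) ^ t) := by
  intro d x X hd hx hX
  have hα0 : ∀ n, 0 < α (n + 1) := fun n => hη.trans_le (hα n)
  have hx0 : 0 < x := hη.trans_le hx
  have pieces := hausdorffContent_inter_floor_im_le (s := 1 + t) hlam hα0 (by linarith) hΔ hr hd
    hx0 hX
  set Λ := modulus α β (n + 2)
  have hD : 0 < D := pos_of_mul_pos_left (hΔ.trans_le hΔD) (hα0 n).le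
  rcases X.eq_empty_or_nonempty with rfl | ⟨z₀, hz₀⟩
  · simp
  have hΔx : Λ ≤ 2 * D * x := calc
    Λ ≤ D * α (n + 1) := hΔD
    _ ≤ D * (2 * x) := by
      gcongr
      exact ((hX.subset hz₀).2 n).1.trans (hX.norm_le z₀ hz₀)
    _ = _ := by ring
  have im_le : ∀ z ∈ X, |Λ⁻¹ * (iter lam (n + 1) z).im| ≤ 2 * x / Λ := fun z hz => by
    rw [abs_mul, abs_of_pos (inv_pos.2 hΔ), inv_mul_eq_div]
    gcongr
    exact (Complex.abs_im_le_norm _).trans (hX.norm_le z hz)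
  have count_le : 2 * (2 * x / Λ) + 3 ≤ (4 + 6 * D) * x / Λ := by
    have : 3 ≤ 6 * D * x / Λ := by
      rw [le_div_iff₀ hΔ]
      linarith
    calc 2 * (2 * x / Λ) + 3 ≤ 2 * (2 * x / Λ) + 6 * D * x / Λ := by gcongr
      _ = _ := by ring
  refine (outerMeasure_le_mul_of_floor_fibers _ (by positivity) im_le pieces).trans ?_
  rw [← ENNReal.ofReal_mul (by positivity)]
  refine ENNReal.ofReal_le_ofReal ?_
  calc (2 * (2 * x / Λ) + 3) * ((2 ^ (n + 2) * Λ) ^ (1 + t) * (d * x) ^ (-(1 + t)))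
      ≤ ((4 + 6 * D) * x / Λ) * ((2 ^ (n + 2) * Λ) ^ (1 + t) * (d * x) ^ (-(1 + t))) := by gcongr
    _ = _ := by
        rw [Real.mul_rpow (by positivity) hΔ.le, Real.mul_rpow hd.le hx0.le,
          rpow_neg_eq_mul_rpow_neg_one_add hx0 t, Real.rpow_add hΔ 1 t, Real.rpow_one]
        field_simp

end Content

section Asymptotics

/-- The logarithm of `α 1 * ⋯ * α n`. -/
noncomputable def logProd (α : ℕ → ℝ) (n : ℕ) : ℝ :=
  ∑ k ∈ Finset.range n, Real.log (α (k + 1))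

theorem logProd_succ (α : ℕ → ℝ) (n : ℕ) :
    logProd α (n + 1) = logProd α n + Real.log (α (n + 1)) := Finset.sum_range_succ _ _

variable {α : ℕ → ℝ}

theorem exp_logProd (hα : ∀ n, 0 < α (n + 1)) (n : ℕ) :
    Real.exp (logProd α n) = ∏ k ∈ Finset.range n, α (k + 1) := by
  rw [logProd, Real.exp_sum]
  exact Finset.prod_congr rfl fun k _ => Real.exp_log (hα k)

theorem prod_rpow_neg (hα : ∀ n, 0 < α (n + 1)) (t : ℝ) (n : ℕ) :
    ∏ k ∈ Finset.range n, α (k + 1) ^ (-t) = Real.exp (-t * logProd α n) := by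
  rw [logProd, Finset.mul_sum, Real.exp_sum]
  refine Finset.prod_congr rfl fun k _ => ?_
  rw [Real.rpow_def_of_pos (hα k), mul_comm]

theorem eventually_pow_mul_exp_le {L : ℕ → ℝ} (hL : Tendsto (fun n => L n / n) atTop atTop)
    {τ : ℝ} (hτ : 0 < τ) (C : ℝ) :
    ∀ᶠ n in atTop, C ^ n * Real.exp (-τ * L n) ≤ (1 / 2) ^ n := by
  filter_upwards [hL.eventually_ge_atTop (Real.log (2 * (|C| + 1)) / τ), eventually_gt_atTop 0]
    with n hn hn0
  rw [div_le_div_iff₀ hτ (by exact_mod_cast hn0)] at hn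
  have pow_le : (2 * (|C| + 1)) ^ n ≤ Real.exp (τ * L n) := by
    rw [← Real.exp_log (show 0 < 2 * (|C| + 1) by positivity), ← Real.exp_nat_mul]
    exact Real.exp_le_exp.2 (by linarith)
  rw [neg_mul, Real.exp_neg, ← div_eq_mul_inv, div_le_iff₀ (Real.exp_pos _)]
  calc C ^ n ≤ |C| ^ n := by rw [← abs_pow]; exact le_abs_self _
    _ ≤ (|C| + 1) ^ n := by gcongr; linarith
    _ = (1 / 2) ^ n * (2 * (|C| + 1)) ^ n := by rw [← mul_pow]; congr 1; ring
    _ ≤ _ := by gcongr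

theorem tendsto_pow_mul_exp {L : ℕ → ℝ} (hL : Tendsto (fun n => L n / n) atTop atTop)
    {τ : ℝ} (hτ : 0 < τ) {C : ℝ} (hC : 0 ≤ C) :
    Tendsto (fun n => C ^ n * Real.exp (-τ * L n)) atTop (𝓝 0) :=
  squeeze_zero' (Eventually.of_forall fun n => by positivity) (eventually_pow_mul_exp_le hL hτ C)
    (tendsto_pow_atTop_nhds_zero_of_lt_one (by norm_num) (by norm_num))

theorem pow_rpow_comm {x : ℝ} (hx : 0 ≤ x) (n : ℕ) (s : ℝ) : (x ^ n) ^ s = (x ^ s) ^ n := by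
  rw [← Real.rpow_natCast, ← Real.rpow_natCast, ← Real.rpow_mul hx, ← Real.rpow_mul hx, mul_comm]

end Asymptotics

section HausdorffUpper

variable {lam : ℕ → ℂ} {α β : ℕ → ℝ} {M η t : ℝ} {r : ℝ≥0∞} {n : ℕ}

theorem hausdorffContent_boundedRateSet_le_of_modulus_le (hlam : ∀ n, lam (n + 1) ≠ 0)
    (hη : 0 < η) (hα : ∀ n, η ≤ α (n + 1)) (hM : 0 ≤ M) (ht : 0 < t) {D : ℝ}
    (hΔ : 0 < modulus α β (n + 2)) (hΔD : modulus α β (n + 2) ≤ D * α (n + 1))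
    (hr : ENNReal.ofReal (4 * D * (2 ^ n * Real.exp (-1 * logProd α n))) ≤ r) :
    hausdorffContent (1 + t) r (boundedRateSet lam α β M) ≤
      ENNReal.ofReal ((4 + 6 * D) * (2 ^ (1 + t)) ^ 2 * D ^ t * descentConst η M t *
        ((2 ^ (1 + t) * descentConst η M t) ^ n * Real.exp (-t * logProd α n))) := by
  have hα0 : ∀ n, 0 < α (n + 1) := fun n => hη.trans_le (hα n)
  have hαn := hα0 n
  have hD : 0 < D := pos_of_mul_pos_left (hΔ.trans_le hΔD) hαn.le
  have hC := descentConst_nonneg hη hM ht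
  have scale_le : 2 ^ (n + 2) * modulus α β (n + 2) / ∏ k ∈ Finset.range (n + 1), α (k + 1) ≤
      4 * D * (2 ^ n * Real.exp (-1 * logProd α n)) := by
    rw [Finset.prod_range_succ, ← exp_logProd hα0, neg_one_mul, Real.exp_neg,
      div_le_iff₀ (by positivity)]
    calc 2 ^ (n + 2) * modulus α β (n + 2) ≤ 2 ^ (n + 2) * (D * α (n + 1)) := by gcongr
      _ = _ := by field_simp; ring
  have modulus_rpow_le : modulus α β (n + 2) ^ t * α (n + 1) ^ (-t) ≤ D ^ t :=
    calc modulus α β (n + 2) ^ t * α (n + 1) ^ (-t)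
        ≤ (D * α (n + 1)) ^ t * α (n + 1) ^ (-t) := by gcongr
      _ = D ^ t := by
          rw [Real.mul_rpow hD.le hαn.le, mul_assoc, ← Real.rpow_add hαn]
          simp
  have hcell := cellBound_hausdorffContent_of_modulus_le (M := M) (hlam (n + 1)) hη hα ht.le hΔ hΔD
    ((ENNReal.ofReal_le_ofReal scale_le).trans hr)
  refine (outerMeasure_boundedRateSet_le hlam hη hα hM ht (by positivity) hcell).trans
    (ENNReal.ofReal_le_ofReal ?_)
  set C := descentConst η M t
  set T : ℝ := 2 ^ (1 + t) with hT
  rw [Finset.prod_range_succ, prod_rpow_neg hα0, pow_rpow_comm zero_le_two, ← hT]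
  calc (4 + 6 * D) * T ^ (n + 2) * modulus α β (n + 2) ^ t * C ^ (n + 1) *
        (Real.exp (-t * logProd α n) * α (n + 1) ^ (-t))
      = (4 + 6 * D) * T ^ 2 * C * ((T * C) ^ n * Real.exp (-t * logProd α n)) *
          (modulus α β (n + 2) ^ t * α (n + 1) ^ (-t)) := by ring
    _ ≤ (4 + 6 * D) * T ^ 2 * C * ((T * C) ^ n * Real.exp (-t * logProd α n)) * D ^ t := by gcongr
    _ = _ := by ring

theorem hausdorffContent_boundedRateSet_le_of_modulus_succ_le (hlam : ∀ n, lam (n + 1) ≠ 0)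
    (hη : 0 < η) (hα : ∀ n, η ≤ α (n + 1)) (hM : 0 ≤ M) (ht : 0 < t)
    (hαβ : α (n + 2) ≤ β (n + 2)) {b : ℝ} (hb : modulus α β (n + 2) + 1 ≤ b)
    (hr : ENNReal.ofReal (2 ^ (n + 1) * Real.exp (-1 * logProd α (n + 1))) ≤ r) :
    hausdorffContent (1 + t) r (boundedRateSet lam α β M) ≤
      ENNReal.ofReal ((64 + 12 / η) * b * ((2 ^ (1 + t) * descentConst η M t) ^ (n + 1) *
        Real.exp (-t * logProd α (n + 1)))) := by
  have hα0 : ∀ n, 0 < α (n + 1) := fun n => hη.trans_le (hα n)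
  have hC := descentConst_nonneg hη hM ht
  have hΔ : 0 ≤ modulus α β (n + 2) := modulus_nonneg (hα0 _) hαβ
  have scale_eq : 2 ^ (n + 1) / ∏ k ∈ Finset.range (n + 1), α (k + 1) =
      2 ^ (n + 1) * Real.exp (-1 * logProd α (n + 1)) := by
    rw [← exp_logProd hα0, neg_one_mul, Real.exp_neg, ← div_eq_mul_inv]
  have hcell := cellBound_of_succ_zero (hlam (n + 1)) hη (hα (n + 1)) hαβ (by positivity)
    (cellBound_hausdorffContent (M := M) (n := n + 1) (s := 1 + t) (r := r) hα0 (by linarith)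
      (by rwa [scale_eq]))
  refine (outerMeasure_boundedRateSet_le hlam hη hα hM ht (by positivity) hcell).trans
    (ENNReal.ofReal_le_ofReal ?_)
  rw [prod_rpow_neg hα0, pow_rpow_comm zero_le_two]
  calc _ = (64 + 12 / η) * (modulus α β (n + 2) + 1) *
        ((2 ^ (1 + t) * descentConst η M t) ^ (n + 1) * Real.exp (-t * logProd α (n + 1))) := by
        ring
    _ ≤ _ := by gcongr

theorem eq_zero_of_frequently_le_of_tendsto_zero {c : ℝ≥0∞} {u v : ℕ → ℝ}
    (hu : Tendsto u atTop (𝓝 0)) (hv : Tendsto v atTop (𝓝 0))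
    (h : ∃ᶠ n in atTop, c ≤ ENNReal.ofReal (u n) ∨ c ≤ ENNReal.ofReal (v n)) : c = 0 := by
  have tendsto_max :
      Tendsto (fun n => ENNReal.ofReal (u n) ⊔ ENNReal.ofReal (v n)) atTop (𝓝 0) := by
    simpa using (ENNReal.tendsto_ofReal hu).max (ENNReal.tendsto_ofReal hv)
  exact le_antisymm (ge_of_tendsto_of_frequently tendsto_max (h.mono fun n hn => le_sup_iff.2 hn))
    zero_le

theorem dimH_boundedRateSet_le (hlam : ∀ n, lam (n + 1) ≠ 0) (hη : 0 < η)
    (hα : ∀ n, η ≤ α (n + 1)) (hαβ : ∀ n, α (n + 1) < β (n + 1)) (hM : 0 ≤ M) (ht : 0 < t)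
    (hL : Tendsto (fun n : ℕ => logProd α n / n) atTop atTop) {D B τ : ℝ} (hD : 1 ≤ D)
    (hB : 0 ≤ B) (hτ : τ < t)
    (h : ∃ᶠ n in atTop, modulus α β (n + 2) ≤ D * α (n + 1) ∨
      modulus α β (n + 1) + 1 ≤ B ^ n * Real.exp (τ * logProd α n)) :
    dimH (boundedRateSet lam α β M) ≤ ENNReal.ofReal (1 + t) := by
  have hα0 : ∀ n, 0 < α (n + 1) := fun n => hη.trans_le (hα n)
  have hC := descentConst_nonneg hη hM ht
  set T : ℝ := 2 ^ (1 + t)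
  set C := descentConst η M t
  have scale_tendsto : Tendsto (fun n : ℕ => ENNReal.ofReal
      (4 * D * (2 ^ n * Real.exp (-1 * logProd α n)))) atTop (𝓝 0) := by
    simpa using ENNReal.tendsto_ofReal
      ((tendsto_pow_mul_exp hL one_pos (C := 2) (by norm_num)).const_mul (4 * D))
  have first_tendsto : Tendsto (fun n : ℕ => (4 + 6 * D) * T ^ 2 * D ^ t * C *
      ((T * C) ^ n * Real.exp (-t * logProd α n))) atTop (𝓝 0) := by
    simpa only [mul_zero] using
      (tendsto_pow_mul_exp hL ht (C := T * C) (by positivity)).const_mul _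
  have second_tendsto : Tendsto (fun n : ℕ => (64 + 12 / η) *
      ((B * (T * C)) ^ n * Real.exp (-(t - τ) * logProd α n))) atTop (𝓝 0) := by
    simpa only [mul_zero] using
      (tendsto_pow_mul_exp hL (sub_pos.2 hτ) (C := B * (T * C)) (by positivity)).const_mul _
  have content_eq_zero : ∀ r > 0, hausdorffContent (1 + t) r (boundedRateSet lam α β M) = 0 := by
    intro r hr
    refine eq_zero_of_frequently_le_of_tendsto_zero first_tendsto second_tendsto ?_
    refine (h.and_eventually ((scale_tendsto.eventually_le_const hr).and
      (eventually_gt_atTop 0))).mono ?_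
    rintro n ⟨hn | hn, hsmall, hn0⟩
    · exact Or.inl (hausdorffContent_boundedRateSet_le_of_modulus_le hlam hη hα hM ht
        (modulus_pos (hα0 _) (hαβ _)) hn hsmall)
    · obtain ⟨m, rfl⟩ := Nat.exists_eq_add_of_lt hn0
      rw [zero_add] at *
      refine Or.inr ((hausdorffContent_boundedRateSet_le_of_modulus_succ_le hlam hη hα hM ht
        (hαβ _).le hn (le_trans (ENNReal.ofReal_le_ofReal ?_) hsmall)).trans_eq ?_)
      · exact le_mul_of_one_le_left (by positivity) (by linarith)
      · rw [show -(t - τ) * logProd α (m + 1) = τ * logProd α (m + 1) +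
          -t * logProd α (m + 1) by ring, Real.exp_add]
        simp only [T, C]
        ring_nf
  refine dimH_le_of_hausdorffMeasure_ne_top (d := (1 + t).toNNReal) ?_
  rw [Real.coe_toNNReal _ (by linarith), hausdorffMeasure_eq_zero_of_content content_eq_zero]
  exact ENNReal.zero_ne_top

end HausdorffUpper

section Separated

variable {ι : Type*}

theorem sum_volume_le_of_pairwiseDisjoint {E : Type*} [MeasureSpace E] (Q : Finset ι)
    (A : ι → Set E) {S : Set E} (hA : ∀ i ∈ Q, MeasurableSet (A i))
    (hd : (Q : Set ι).PairwiseDisjoint A) (hS : ∀ i ∈ Q, A i ⊆ S) :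
    ∑ i ∈ Q, volume (A i) ≤ volume S := by
  rw [← measure_biUnion_finset hd hA]
  exact measure_mono (Set.iUnion₂_subset hS)

theorem disjoint_Ioo_of_add_le_abs_sub {u v r r' : ℝ} (h : r + r' ≤ |u - v|) :
    Disjoint (Set.Ioo (u - r) (u + r)) (Set.Ioo (v - r') (v + r')) := by
  rw [Set.disjoint_left]
  rintro x ⟨h1, h2⟩ ⟨h3, h4⟩
  rcases le_abs.1 h with h | h <;> linarith

theorem Ioo_subset_Ioo_of_abs_sub_le {u v r r' : ℝ} (h : |u - v| ≤ r' - r) :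
    Set.Ioo (u - r) (u + r) ⊆ Set.Ioo (v - r') (v + r') := by
  obtain ⟨h1, h2⟩ := abs_le.1 h
  exact Set.Ioo_subset_Ioo (by linarith) (by linarith)

theorem half_add_half_le_abs_re_add_abs_im {z w : ℂ} {r r' : ℝ} (h : r ≤ ‖z - w‖)
    (h' : r' ≤ ‖w - z‖) : r / 2 + r' / 2 ≤ |z.re - w.re| + |z.im - w.im| := by
  have := Complex.norm_le_abs_re_add_abs_im (z - w)
  rw [norm_sub_rev] at h'
  rw [Complex.sub_re, Complex.sub_im] at this
  linarith

variable {Q : Finset ι} {w : ι → ℂ} {R : ι → ℝ} {Λ x : ℝ}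

theorem sum_sq_le_of_separated (hx : 0 ≤ x) (hΛ : 0 ≤ Λ) (hR : ∀ i ∈ Q, 0 ≤ R i)
    (hRx : ∀ i ∈ Q, R i ≤ x) (hRΛ : ∀ i ∈ Q, R i ≤ 2 * Λ)
    (hre : ∀ i ∈ Q, ∀ j ∈ Q, |(w i - w j).re| ≤ Λ) (him : ∀ i ∈ Q, |(w i).im| ≤ 2 * x)
    (hsep : ∀ i ∈ Q, ∀ j ∈ Q, i ≠ j → R i ≤ ‖w i - w j‖) :
    ∑ i ∈ Q, R i ^ 2 ≤ 72 * (x * Λ) := by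
  rcases Q.eq_empty_or_nonempty with rfl | ⟨i₀, hi₀⟩
  · rw [Finset.sum_empty]
    positivity
  let A : ι → Set (ℝ × ℝ) := fun i =>
    Set.Ioo ((w i).re - R i / 4) ((w i).re + R i / 4) ×ˢ
      Set.Ioo ((w i).im - R i / 4) ((w i).im + R i / 4)
  let S : Set (ℝ × ℝ) :=
    Set.Ioo ((w i₀).re - 3 / 2 * Λ) ((w i₀).re + 3 / 2 * Λ) ×ˢ Set.Ioo (0 - 3 * x) (0 + 3 * x)
  have disjoint : (Q : Set ι).PairwiseDisjoint A := by
    intro i hi j hj hij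
    have halves :=
      half_add_half_le_abs_re_add_abs_im (hsep i hi j hj hij) (hsep j hj i hi hij.symm)
    rw [Function.onFun, Set.disjoint_prod]
    by_cases hc : R i / 4 + R j / 4 ≤ |(w i).re - (w j).re|
    · exact Or.inl (disjoint_Ioo_of_add_le_abs_sub hc)
    · exact Or.inr (disjoint_Ioo_of_add_le_abs_sub (by linarith))
  have subset : ∀ i ∈ Q, A i ⊆ S := fun i hi =>
    Set.prod_mono
      (Ioo_subset_Ioo_of_abs_sub_le ((hre i hi i₀ hi₀).trans (by linarith [hRΛ i hi])))
      (Ioo_subset_Ioo_of_abs_sub_le (by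
        rw [sub_zero]
        exact (him i hi).trans (by linarith [hRx i hi])))
  have volume_eq : ∀ i ∈ Q, volume (A i) = ENNReal.ofReal (R i ^ 2 / 4) := by
    intro i hi
    simp only [A]
    rw [Measure.volume_eq_prod, Measure.prod_prod, Real.volume_Ioo, Real.volume_Ioo,
      ← ENNReal.ofReal_mul (by linarith [hR i hi])]
    congr 1
    ring
  have volume_le := sum_volume_le_of_pairwiseDisjoint Q A
    (fun i _ => measurableSet_Ioo.prod measurableSet_Ioo) disjoint subset
  rw [Finset.sum_congr rfl volume_eq, ← ENNReal.ofReal_sum_of_nonneg fun i _ => by positivity,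
    Measure.volume_eq_prod, Measure.prod_prod, Real.volume_Ioo, Real.volume_Ioo,
    ← ENNReal.ofReal_mul (by linarith), ENNReal.ofReal_le_ofReal_iff
    (mul_nonneg (by linarith) (by linarith)), ← Finset.sum_div] at volume_le
  linarith

theorem sum_le_of_separated (hx : 0 ≤ x) (hR : ∀ i ∈ Q, 0 ≤ R i) (hRx : ∀ i ∈ Q, R i ≤ x)
    (hRΛ : ∀ i ∈ Q, 2 * Λ ≤ R i) (hre : ∀ i ∈ Q, ∀ j ∈ Q, |(w i - w j).re| ≤ Λ)
    (him : ∀ i ∈ Q, |(w i).im| ≤ 2 * x) (hsep : ∀ i ∈ Q, ∀ j ∈ Q, i ≠ j → R i ≤ ‖w i - w j‖) :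
    ∑ i ∈ Q, R i ≤ 12 * x := by
  let A : ι → Set ℝ := fun i => Set.Ioo ((w i).im - R i / 4) ((w i).im + R i / 4)
  have disjoint : (Q : Set ι).PairwiseDisjoint A := by
    intro i hi j hj hij
    have halves :=
      half_add_half_le_abs_re_add_abs_im (hsep i hi j hj hij) (hsep j hj i hi hij.symm)
    have := hre i hi j hj
    rw [Complex.sub_re] at this
    exact disjoint_Ioo_of_add_le_abs_sub (by linarith [hRΛ i hi, hRΛ j hj])
  have subset : ∀ i ∈ Q, A i ⊆ Set.Ioo (0 - 3 * x) (0 + 3 * x) := fun i hi =>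
    Ioo_subset_Ioo_of_abs_sub_le (by
      rw [sub_zero]
      exact (him i hi).trans (by linarith [hRx i hi]))
  have volume_eq : ∀ i ∈ Q, volume (A i) = ENNReal.ofReal (R i / 2) := by
    intro i _
    simp only [A]
    rw [Real.volume_Ioo]
    congr 1
    ring
  have volume_le :=
    sum_volume_le_of_pairwiseDisjoint Q A (fun i _ => measurableSet_Ioo) disjoint subset
  rw [Finset.sum_congr rfl volume_eq,
    ← ENNReal.ofReal_sum_of_nonneg fun i hi => div_nonneg (hR i hi) zero_le_two,
    Real.volume_Ioo, ENNReal.ofReal_le_ofReal_iff (by linarith), ← Finset.sum_div] at volume_le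
  linarith

end Separated

section PackingMass

theorem IsPacking.subset {X : Type*} [MetricSpace X] {K : Set X} {δ : ℝ} {P Q : Finset (X × ℝ)}
    (hP : IsPacking K δ P) (hQP : Q ⊆ P) : IsPacking K δ Q :=
  ⟨fun p hp => hP.1 p (hQP hp), hP.2.subset (Finset.coe_subset.2 hQP)⟩

theorem IsPacking.radius_le_dist {X : Type*} [MetricSpace X] {K : Set X} {δ : ℝ}
    {P : Finset (X × ℝ)} (hP : IsPacking K δ P) {p q : X × ℝ} (hp : p ∈ P) (hq : q ∈ P)
    (hpq : p ≠ q) : p.2 ≤ dist p.1 q.1 := by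
  by_contra! hlt
  rw [dist_comm] at hlt
  exact Set.disjoint_left.1 (hP.2 hp hq hpq) (Metric.mem_closedBall.2 hlt.le)
    (Metric.mem_closedBall_self (hP.1 q hq).2.1.le)

theorem packingPremeasure_two_ne_top {K : Set ℂ} {M : ℝ} (hM : 0 ≤ M) (hK : ∀ z ∈ K, ‖z‖ ≤ M) :
    packingPremeasure 2 K ≠ ∞ := by
  refine ne_top_of_le_ne_top (b := ENNReal.ofReal (4 * (72 * ((M + 1) * (2 * M + 1)))))
    ENNReal.ofReal_ne_top ((iInf₂_le 1 one_pos).trans (iSup₂_le fun P hP => ?_))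
  have re_le : ∀ p ∈ P, ∀ q ∈ P, |(p.1 - q.1).re| ≤ 2 * M + 1 := fun p hp q hq =>
    calc |(p.1 - q.1).re| ≤ ‖p.1 - q.1‖ := Complex.abs_re_le_norm _
      _ ≤ ‖p.1‖ + ‖q.1‖ := norm_sub_le _ _
      _ ≤ 2 * M + 1 := by linarith [hK _ (hP.1 p hp).1, hK _ (hP.1 q hq).1]
  have im_le : ∀ p ∈ P, |p.1.im| ≤ 2 * (M + 1) := fun p hp =>
    ((Complex.abs_im_le_norm _).trans (hK _ (hP.1 p hp).1)).trans (by linarith)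
  have sum_le : ∑ p ∈ P, p.2 ^ 2 ≤ 72 * ((M + 1) * (2 * M + 1)) :=
    sum_sq_le_of_separated (w := Prod.fst) (by linarith) (by linarith)
      (fun p hp => (hP.1 p hp).2.1.le) (fun p hp => (hP.1 p hp).2.2.trans (by linarith))
      (fun p hp => (hP.1 p hp).2.2.trans (by linarith)) re_le im_le
      fun p hp q hq hpq => by simpa only [dist_eq_norm] using hP.radius_le_dist hp hq hpq
  have term_eq : ∀ p ∈ P, ENNReal.ofReal (2 * p.2) ^ (2 : ℝ) = ENNReal.ofReal (4 * p.2 ^ 2) := by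
    intro p hp
    rw [ENNReal.ofReal_rpow_of_nonneg (by linarith [(hP.1 p hp).2.1]) (by norm_num), Real.rpow_two]
    congr 1
    ring
  rw [Finset.sum_congr rfl term_eq, ← ENNReal.ofReal_sum_of_nonneg fun p _ => by positivity,
    ← Finset.mul_sum]
  exact ENNReal.ofReal_le_ofReal (by linarith)

/-- The outer measure with mass `(2 * r) ^ s` at the centre of every ball of radius `r` of a finite
family. It turns bounds on outer measures into bounds on packing sums. -/
noncomputable def packingMass (s : ℝ) (Q : Finset (ℂ × ℝ)) : OuterMeasure ℂ :=
  ∑ p ∈ Q, ENNReal.ofReal (2 * p.2) ^ s • OuterMeasure.dirac p.1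

open Classical in
theorem packingMass_apply (s : ℝ) (Q : Finset (ℂ × ℝ)) (X : Set ℂ) :
    packingMass s Q X = ∑ p ∈ Q with p.1 ∈ X, ENNReal.ofReal (2 * p.2) ^ s := by
  have apply_sum : packingMass s Q X =
      ∑ p ∈ Q, (ENNReal.ofReal (2 * p.2) ^ s • OuterMeasure.dirac p.1 : OuterMeasure ℂ) X := by
    rw [packingMass]
    induction Q using Finset.induction_on with
    | empty => simp
    | insert p Q hp ih => rw [Finset.sum_insert hp, Finset.sum_insert hp, ← ih]; rfl
  rw [apply_sum, Finset.sum_filter]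
  refine Finset.sum_congr rfl fun p _ => ?_
  simp [OuterMeasure.dirac_apply, Set.indicator]

theorem packingMass_eq_sum {K : Set ℂ} {δ s : ℝ} {Q : Finset (ℂ × ℝ)} (hQ : IsPacking K δ Q) :
    packingMass s Q K = ∑ p ∈ Q, ENNReal.ofReal (2 * p.2) ^ s := by
  classical
  rw [packingMass_apply, Finset.filter_true_of_mem fun p hp => (hQ.1 p hp).1]

/-- The radius of a ball seen through `iter lam n`, up to the distortion constant `2 ^ n`. -/
noncomputable def scaledRadius (lam : ℕ → ℂ) (n : ℕ) (p : ℂ × ℝ) : ℝ :=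
  derivNorm lam n p.1 * p.2 / 2 ^ n

variable {lam : ℕ → ℂ} {α β : ℕ → ℝ} {M η δ d x s t : ℝ} {n : ℕ} {K X : Set ℂ} {p q : ℂ × ℝ}
  {P Q : Finset (ℂ × ℝ)}

theorem scaledRadius_succ (n : ℕ) (p : ℂ × ℝ) :
    scaledRadius lam (n + 1) p = scaledRadius lam n p * (‖iter lam (n + 1) p.1‖ / 2) := by
  rw [scaledRadius, scaledRadius, derivNorm_succ]
  field_simp
  ring

theorem scaledRadius_nonneg (hp : 0 ≤ p.2) : 0 ≤ scaledRadius lam n p :=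
  div_nonneg (mul_nonneg (derivNorm_nonneg _ _) hp) (by positivity)

theorem scaledRadius_succ_le (hp : scaledRadius lam n p < 1)
    (hx : ‖iter lam (n + 1) p.1‖ ≤ 2 * x) : scaledRadius lam (n + 1) p ≤ x := by
  rw [scaledRadius_succ]
  calc scaledRadius lam n p * (‖iter lam (n + 1) p.1‖ / 2)
      ≤ 1 * (‖iter lam (n + 1) p.1‖ / 2) := by gcongr
    _ ≤ x := by linarith

theorem scaledRadius_le_norm_iter_sub (hP : IsPacking K δ P) (hp : p ∈ P) (hq : q ∈ P)
    (hpq : p ≠ q) (h : ∀ k < n, ‖iter lam k p.1 - iter lam k q.1‖ ≤ 1 / 2) :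
    scaledRadius lam n p ≤ ‖iter lam n p.1 - iter lam n q.1‖ := by
  have separated : p.2 ≤ ‖q.1 - p.1‖ := by
    rw [← dist_eq_norm, dist_comm]
    exact hP.radius_le_dist hp hq hpq
  rw [scaledRadius, div_le_iff₀ (by positivity), mul_comm _ ((2 : ℝ) ^ n), norm_sub_rev]
  calc derivNorm lam n p.1 * p.2 ≤ derivNorm lam n p.1 * ‖q.1 - p.1‖ :=
        mul_le_mul_of_nonneg_left separated (derivNorm_nonneg _ _)
    _ ≤ _ := derivNorm_mul_norm_sub_le fun k hk => by
        rw [norm_sub_rev]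
        exact h k hk

theorem ofReal_two_mul_rpow_le (hs : 0 ≤ s) (hd : 0 < d) (hp : 0 ≤ p.2)
    (hdp : d ≤ derivNorm lam n p.1) : ENNReal.ofReal (2 * p.2) ^ s ≤
      ENNReal.ofReal ((2 ^ (n + 1)) ^ s * d ^ (-s) * scaledRadius lam n p ^ s) := by
  have radius_le : 2 * p.2 ≤ 2 ^ (n + 1) * scaledRadius lam n p / d := by
    rw [le_div_iff₀ hd, scaledRadius]
    calc 2 * p.2 * d ≤ 2 * p.2 * derivNorm lam n p.1 := by gcongr
      _ = _ := by rw [pow_succ]; field_simp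
  rw [ENNReal.ofReal_rpow_of_nonneg (by positivity) hs]
  refine ENNReal.ofReal_le_ofReal ?_
  have := scaledRadius_nonneg (lam := lam) (n := n) hp
  calc (2 * p.2) ^ s ≤ (2 ^ (n + 1) * scaledRadius lam n p / d) ^ s := by gcongr
    _ = _ := by
      rw [Real.div_rpow (by positivity) hd.le, Real.mul_rpow (by positivity) this,
        Real.rpow_neg hd.le]
      field_simp

open Classical in
theorem packingMass_le_of_isCell (hs : 0 ≤ s) (hd : 0 < d) (hx : 0 < x) (hQ : ∀ p ∈ Q, 0 ≤ p.2)
    (hX : IsCell lam K n d x X) : packingMass s Q X ≤ ENNReal.ofReal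
      ((2 ^ (n + 2)) ^ s * (d * x) ^ (-s) *
        ∑ p ∈ Q with p.1 ∈ X, scaledRadius lam (n + 1) p ^ s) := by
  have radius_nonneg : ∀ p ∈ Q.filter (·.1 ∈ X), 0 ≤ scaledRadius lam (n + 1) p := fun p hp =>
    scaledRadius_nonneg (hQ p (Finset.mem_of_mem_filter p hp))
  rw [packingMass_apply, Finset.mul_sum, ENNReal.ofReal_sum_of_nonneg fun p hp =>
    mul_nonneg (by positivity) (Real.rpow_nonneg (radius_nonneg p hp) s)]
  refine Finset.sum_le_sum fun p hp => ?_
  obtain ⟨hpQ, hpX⟩ := Finset.mem_filter.1 hp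
  refine ofReal_two_mul_rpow_le hs (mul_pos hd hx) (hQ p hpQ) ?_
  rw [derivNorm_succ]
  exact mul_le_mul (hX.le_derivNorm _ hpX) (hX.le_norm _ hpX) hx.le (derivNorm_nonneg _ _)

theorem sum_scaledRadius_rpow_le_of_le_modulus (hlam : lam (n + 2) ≠ 0) (hα : 0 < α (n + 2))
    (hαβ : α (n + 2) ≤ β (n + 2)) (hx : 0 ≤ x) (ht : t ≤ 1)
    (hX : IsCell lam (boundedRateSet lam α β M) n d x X) (hP : IsPacking K δ P)
    (hPX : ∀ p ∈ P, p.1 ∈ X) (hPn : ∀ p ∈ P, scaledRadius lam n p < 1)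
    (hPn1 : ∀ p ∈ P, 1 ≤ scaledRadius lam (n + 1) p)
    (hPΛ : ∀ p ∈ P, scaledRadius lam (n + 1) p ≤ 2 * modulus α β (n + 2)) :
    ∑ p ∈ P, scaledRadius lam (n + 1) p ^ (1 + t) ≤ 72 * (x * modulus α β (n + 2)) :=
  calc ∑ p ∈ P, scaledRadius lam (n + 1) p ^ (1 + t)
      ≤ ∑ p ∈ P, scaledRadius lam (n + 1) p ^ 2 := by
        refine Finset.sum_le_sum fun p hp => ?_
        rw [← Real.rpow_two]
        exact Real.rpow_le_rpow_of_exponent_le (hPn1 p hp) (by linarith)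
    _ ≤ _ := sum_sq_le_of_separated (w := fun p => iter lam (n + 1) p.1) hx
        (modulus_nonneg hα hαβ) (fun p hp => zero_le_one.trans (hPn1 p hp))
        (fun p hp => scaledRadius_succ_le (hPn p hp) (hX.norm_le _ (hPX p hp))) hPΛ
        (fun p hp q hq => abs_re_iter_sub_le_modulus hlam hα (hX.subset (hPX p hp))
          (hX.subset (hPX q hq)))
        (fun p hp => (Complex.abs_im_le_norm _).trans (hX.norm_le _ (hPX p hp)))
        fun p hp q hq hpq => scaledRadius_le_norm_iter_sub hP hp hq hpq fun k hk =>
          hX.norm_sub_le _ (hPX p hp) _ (hPX q hq) k (Nat.le_of_lt_succ hk)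

theorem sum_scaledRadius_rpow_le_of_modulus_le (hlam : lam (n + 2) ≠ 0) (hα : 0 < α (n + 2))
    (hx : 0 ≤ x) (ht : 0 ≤ t) (hX : IsCell lam (boundedRateSet lam α β M) n d x X)
    (hP : IsPacking K δ P) (hPX : ∀ p ∈ P, p.1 ∈ X) (hPn : ∀ p ∈ P, scaledRadius lam n p < 1)
    (hPn1 : ∀ p ∈ P, 1 ≤ scaledRadius lam (n + 1) p)
    (hPΛ : ∀ p ∈ P, 2 * modulus α β (n + 2) ≤ scaledRadius lam (n + 1) p) :
    ∑ p ∈ P, scaledRadius lam (n + 1) p ^ (1 + t) ≤ x ^ t * (12 * x) := by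
  have radius_le : ∀ p ∈ P, scaledRadius lam (n + 1) p ≤ x := fun p hp =>
    scaledRadius_succ_le (hPn p hp) (hX.norm_le _ (hPX p hp))
  calc ∑ p ∈ P, scaledRadius lam (n + 1) p ^ (1 + t)
      ≤ ∑ p ∈ P, x ^ t * scaledRadius lam (n + 1) p := by
        refine Finset.sum_le_sum fun p hp => ?_
        have radius_pos := one_pos.trans_le (hPn1 p hp)
        rw [add_comm 1 t, Real.rpow_add_one radius_pos.ne']
        have := radius_le p hp
        gcongr
    _ = x ^ t * ∑ p ∈ P, scaledRadius lam (n + 1) p := (Finset.mul_sum _ _ _).symm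
    _ ≤ _ := by
        gcongr
        exact sum_le_of_separated (w := fun p => iter lam (n + 1) p.1) hx
          (fun p hp => zero_le_one.trans (hPn1 p hp)) radius_le hPΛ
          (fun p hp q hq => abs_re_iter_sub_le_modulus hlam hα (hX.subset (hPX p hp))
            (hX.subset (hPX q hq)))
          (fun p hp => (Complex.abs_im_le_norm _).trans (hX.norm_le _ (hPX p hp)))
          fun p hp q hq hpq => scaledRadius_le_norm_iter_sub hP hp hq hpq fun k hk =>
            hX.norm_sub_le _ (hPX p hp) _ (hPX q hq) k (Nat.le_of_lt_succ hk)

theorem cellBound_packingMass_of_le_modulus (hlam : lam (n + 2) ≠ 0) (hη : 0 < η)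
    (hα : 0 < α (n + 2)) (hαβ : α (n + 2) ≤ β (n + 2)) (ht : 0 ≤ t) (ht1 : t ≤ 1)
    (hP : IsPacking K δ P) (hPn : ∀ p ∈ P, scaledRadius lam n p < 1)
    (hPn1 : ∀ p ∈ P, 1 ≤ scaledRadius lam (n + 1) p)
    (hPΛ : ∀ p ∈ P, scaledRadius lam (n + 1) p ≤ 2 * modulus α β (n + 2)) :
    CellBound lam (boundedRateSet lam α β M) η (1 + t) (packingMass (1 + t) P) n t
      (72 * (2 ^ (n + 2)) ^ (1 + t) * modulus α β (n + 2)) := by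
  classical
  intro d x X hd hx hX
  have hx0 : 0 < x := hη.trans_le hx
  refine (packingMass_le_of_isCell (by linarith) hd hx0 (fun p hp => (hP.1 p hp).2.1.le) hX).trans
    (ENNReal.ofReal_le_ofReal ?_)
  have mem : ∀ p ∈ P.filter (·.1 ∈ X), p ∈ P := Finset.mem_of_mem_filter
  calc _ ≤ (2 ^ (n + 2)) ^ (1 + t) * (d * x) ^ (-(1 + t)) * (72 * (x * modulus α β (n + 2))) := by
        gcongr
        exact sum_scaledRadius_rpow_le_of_le_modulus hlam hα hαβ hx0.le ht1 hX
          (hP.subset (Finset.filter_subset _ _)) (fun p hp => (Finset.mem_filter.1 hp).2)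
          (fun p hp => hPn p (mem p hp)) (fun p hp => hPn1 p (mem p hp))
          fun p hp => hPΛ p (mem p hp)
    _ = _ := by
        rw [Real.mul_rpow hd.le hx0.le, rpow_neg_eq_mul_rpow_neg_one_add hx0 t]
        ring

theorem cellBound_packingMass_of_modulus_le (hlam : lam (n + 2) ≠ 0) (hη : 0 < η)
    (hα : 0 < α (n + 2)) (ht : 0 ≤ t) (hP : IsPacking K δ P)
    (hPn : ∀ p ∈ P, scaledRadius lam n p < 1) (hPn1 : ∀ p ∈ P, 1 ≤ scaledRadius lam (n + 1) p)
    (hPΛ : ∀ p ∈ P, 2 * modulus α β (n + 2) ≤ scaledRadius lam (n + 1) p) :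
    CellBound lam (boundedRateSet lam α β M) η (1 + t) (packingMass (1 + t) P) n 0
      (12 * (2 ^ (n + 2)) ^ (1 + t)) := by
  classical
  intro d x X hd hx hX
  have hx0 : 0 < x := hη.trans_le hx
  refine (packingMass_le_of_isCell (by linarith) hd hx0 (fun p hp => (hP.1 p hp).2.1.le) hX).trans
    (ENNReal.ofReal_le_ofReal ?_)
  have mem : ∀ p ∈ P.filter (·.1 ∈ X), p ∈ P := Finset.mem_of_mem_filter
  calc _ ≤ (2 ^ (n + 2)) ^ (1 + t) * (d * x) ^ (-(1 + t)) * (x ^ t * (12 * x)) := by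
        gcongr
        exact sum_scaledRadius_rpow_le_of_modulus_le hlam hα hx0.le ht hX
          (hP.subset (Finset.filter_subset _ _)) (fun p hp => (Finset.mem_filter.1 hp).2)
          (fun p hp => hPn p (mem p hp)) (fun p hp => hPn1 p (mem p hp))
          fun p hp => hPΛ p (mem p hp)
    _ = 12 * (2 ^ (n + 2)) ^ (1 + t) * d ^ (-(1 + t)) * (x ^ t * (x * x ^ (-(1 + t)))) := by
        rw [Real.mul_rpow hd.le hx0.le]
        ring
    _ = _ := by
        rw [← rpow_neg_eq_mul_rpow_neg_one_add hx0 t, ← Real.rpow_add hx0]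
        simp

end PackingMass

section PackingUpper

variable {lam : ℕ → ℂ} {α β : ℕ → ℝ} {M η δ t : ℝ} {n : ℕ} {p : ℂ × ℝ} {P : Finset (ℂ × ℝ)}

theorem exists_lt_le_succ {X : Type*} [LinearOrder X] {u : ℕ → X} {b : X} (h0 : u 0 < b)
    (h : ∃ n, b ≤ u n) : ∃ n, u n < b ∧ b ≤ u (n + 1) := by
  classical
  obtain ⟨n, hn⟩ := Nat.exists_eq_succ_of_ne_zero fun hfind : Nat.find h = 0 =>
    h0.not_ge (hfind ▸ Nat.find_spec h)
  exact ⟨n, not_le.1 (Nat.find_min h (by omega)), (Nat.find_spec h).trans_eq (congrArg u hn)⟩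

theorem scaledRadius_one_le_half (hp : p.1 ∈ boundedRateSet lam α β M) (hr : 0 ≤ p.2)
    (hr1 : p.2 * β 1 ≤ 1) : scaledRadius lam 1 p ≤ 1 / 2 := by
  have norm_mul_le : ‖iter lam 1 p.1‖ * p.2 ≤ 1 :=
    (mul_le_mul_of_nonneg_right (hp.2 0).2 hr).trans ((mul_comm _ _).trans_le hr1)
  rw [scaledRadius, derivNorm_succ, derivNorm_zero, one_mul, zero_add, pow_one]
  linarith

theorem exists_scaledRadius_lt_one_le (hα : ∀ n, 0 < α (n + 1))
    (hL : Tendsto (fun n : ℕ => logProd α n / n) atTop atTop)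
    (hp : p.1 ∈ boundedRateSet lam α β M) (hr : 0 < p.2) (hr0 : scaledRadius lam 0 p < 1)
    (hr1 : scaledRadius lam 1 p < 1) :
    ∃ n, scaledRadius lam (n + 1) p < 1 ∧ 1 ≤ scaledRadius lam (n + 2) p := by
  have exists_one_le : ∃ n, 1 ≤ scaledRadius lam n p := by
    obtain ⟨n, hn⟩ :=
      ((tendsto_pow_mul_exp hL one_pos (C := 2) zero_le_two).eventually_lt_const hr).exists
    rw [neg_one_mul, Real.exp_neg, exp_logProd hα, ← div_eq_mul_inv,
      div_lt_iff₀ (Finset.prod_pos fun k _ => hα k)] at hn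
    refine ⟨n, (one_le_div (by positivity)).2 ?_⟩
    calc (2 : ℝ) ^ n ≤ p.2 * ∏ k ∈ Finset.range n, α (k + 1) := hn.le
      _ ≤ p.2 * derivNorm lam n p.1 := by
          gcongr
          exact prod_le_derivNorm (fun k => (hα k).le) hp n
      _ = _ := mul_comm _ _
  obtain ⟨n, hn⟩ := exists_one_le
  cases n with
  | zero => exact absurd hn hr0.not_ge
  | succ n => exact exists_lt_le_succ (u := fun n => scaledRadius lam (n + 1) p) hr1 ⟨n, hn⟩

/-- The bound for the `1 + t`-dimensional packing mass of the balls which become large at level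
`n`: those of scaled radius at most the width of the next annulus give the term of index `n + 1`,
the others the term of index `n`. -/
noncomputable def levelTerm (η M t : ℝ) (α β : ℕ → ℝ) (n : ℕ) : ℝ :=
  (modulus α β (n + 1) + 1) * ((2 ^ (1 + t) * descentConst η M t) ^ n * Real.exp (-t * logProd α n))

theorem levelTerm_nonneg (hη : 0 < η) (hα : 0 < α (n + 1)) (hαβ : α (n + 1) ≤ β (n + 1))
    (hM : 0 ≤ M) (ht : 0 < t) : 0 ≤ levelTerm η M t α β n := by
  have := modulus_nonneg hα hαβ
  have := descentConst_nonneg hη hM ht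
  rw [levelTerm]
  positivity

theorem summable_levelTerm (hη : 0 < η) (hα : ∀ n, 0 < α (n + 1))
    (hαβ : ∀ n, α (n + 1) ≤ β (n + 1)) (hM : 0 ≤ M) (ht : 0 < t)
    (hL : Tendsto (fun n : ℕ => logProd α n / n) atTop atTop) {B τ : ℝ} (hτ : τ < t)
    (h : ∀ᶠ n in atTop, modulus α β (n + 1) + 1 ≤ B ^ n * Real.exp (τ * logProd α n)) :
    Summable (levelTerm η M t α β) := by
  set C := 2 ^ (1 + t) * descentConst η M t with hCdef
  have hC : 0 ≤ C := mul_nonneg (by positivity) (descentConst_nonneg hη hM ht)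
  refine summable_of_isBigO_nat (summable_geometric_of_lt_one (r := 1 / 2) (by norm_num)
    (by norm_num)) (Asymptotics.IsBigO.of_bound 1 ?_)
  filter_upwards [h, eventually_pow_mul_exp_le hL (sub_pos.2 hτ) (C * B)] with n hn hpow
  rw [Real.norm_of_nonneg (levelTerm_nonneg hη (hα n) (hαβ n) hM ht),
    Real.norm_of_nonneg (by positivity), one_mul]
  refine le_trans ?_ hpow
  calc levelTerm η M t α β n
      ≤ B ^ n * Real.exp (τ * logProd α n) * (C ^ n * Real.exp (-t * logProd α n)) := by
        rw [levelTerm, ← hCdef]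
        gcongr
    _ = (C * B) ^ n * (Real.exp (τ * logProd α n) * Real.exp (-t * logProd α n)) := by ring
    _ = _ := by
        rw [← Real.exp_add]
        congr 2
        ring

theorem sum_rpow_le_of_le_modulus (hlam : ∀ n, lam (n + 1) ≠ 0) (hη : 0 < η)
    (hα : ∀ n, η ≤ α (n + 1)) (hαβ : α (n + 3) ≤ β (n + 3)) (hM : 0 ≤ M) (ht : 0 < t) (ht1 : t ≤ 1)
    (hP : IsPacking (boundedRateSet lam α β M) δ P)
    (hPn : ∀ p ∈ P, scaledRadius lam (n + 1) p < 1)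
    (hPn1 : ∀ p ∈ P, 1 ≤ scaledRadius lam (n + 2) p)
    (hPΛ : ∀ p ∈ P, scaledRadius lam (n + 2) p ≤ 2 * modulus α β (n + 3)) :
    ∑ p ∈ P, ENNReal.ofReal (2 * p.2) ^ (1 + t) ≤
      ENNReal.ofReal (72 * 2 ^ (1 + t) * levelTerm η M t α β (n + 2)) := by
  have hα0 : ∀ n, 0 < α (n + 1) := fun n => hη.trans_le (hα n)
  have hΛ := modulus_nonneg (hα0 (n + 2)) hαβ
  have hcell := cellBound_packingMass_of_le_modulus (M := M) (hlam (n + 2)) hη (hα0 (n + 2)) hαβ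
    ht.le ht1 hP hPn hPn1 hPΛ
  rw [← packingMass_eq_sum hP]
  refine (outerMeasure_boundedRateSet_le hlam hη hα hM ht (by positivity) hcell).trans
    (ENNReal.ofReal_le_ofReal ?_)
  have hC := descentConst_nonneg hη hM ht
  rw [prod_rpow_neg hα0, pow_rpow_comm zero_le_two, levelTerm]
  calc 72 * (2 ^ (1 + t)) ^ (n + 1 + 2) * modulus α β (n + 3) * descentConst η M t ^ (n + 1 + 1) *
        Real.exp (-t * logProd α (n + 1 + 1))
      ≤ 72 * (2 ^ (1 + t)) ^ (n + 1 + 2) * (modulus α β (n + 3) + 1) *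
        descentConst η M t ^ (n + 1 + 1) * Real.exp (-t * logProd α (n + 1 + 1)) := by
        gcongr
        linarith
    _ = _ := by ring

theorem sum_rpow_le_of_modulus_le (hlam : ∀ n, lam (n + 1) ≠ 0) (hη : 0 < η)
    (hα : ∀ n, η ≤ α (n + 1)) (hαβ : α (n + 2) ≤ β (n + 2)) (hM : 0 ≤ M) (ht : 0 < t)
    (hP : IsPacking (boundedRateSet lam α β M) δ P)
    (hPn : ∀ p ∈ P, scaledRadius lam (n + 1) p < 1)
    (hPn1 : ∀ p ∈ P, 1 ≤ scaledRadius lam (n + 2) p)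
    (hPΛ : ∀ p ∈ P, 2 * modulus α β (n + 3) ≤ scaledRadius lam (n + 2) p) :
    ∑ p ∈ P, ENNReal.ofReal (2 * p.2) ^ (1 + t) ≤ ENNReal.ofReal
      (12 * (2 ^ (1 + t)) ^ 2 * (64 + 12 / η) * levelTerm η M t α β (n + 1)) := by
  have hα0 : ∀ n, 0 < α (n + 1) := fun n => hη.trans_le (hα n)
  have hΛ := modulus_nonneg (hα0 (n + 1)) hαβ
  have hcell := cellBound_of_succ_zero (hlam (n + 1)) hη (hα (n + 1)) hαβ (by positivity)
    (cellBound_packingMass_of_modulus_le (M := M) (hlam (n + 2)) hη (hα0 (n + 2)) ht.le hP hPn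
      hPn1 hPΛ)
  rw [← packingMass_eq_sum hP]
  refine (outerMeasure_boundedRateSet_le hlam hη hα hM ht (by positivity) hcell).trans_eq ?_
  rw [prod_rpow_neg hα0, pow_rpow_comm zero_le_two, levelTerm]
  ring_nf

/-- The bound for the packing sum over the balls which become large at level `n + 2`. -/
noncomputable def levelBound (η M t : ℝ) (α β : ℕ → ℝ) (n : ℕ) : ℝ :=
  72 * 2 ^ (1 + t) * levelTerm η M t α β (n + 2) +
    12 * (2 ^ (1 + t)) ^ 2 * (64 + 12 / η) * levelTerm η M t α β (n + 1)

theorem levelBound_nonneg (hη : 0 < η) (hα : ∀ n, 0 < α (n + 1))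
    (hαβ : ∀ n, α (n + 1) ≤ β (n + 1)) (hM : 0 ≤ M) (ht : 0 < t) (n : ℕ) :
    0 ≤ levelBound η M t α β n := by
  have := fun n => levelTerm_nonneg hη (hα n) (hαβ n) hM ht
  exact add_nonneg (mul_nonneg (by positivity) (this _)) (mul_nonneg (by positivity) (this _))

theorem sum_rpow_le_levelBound (hlam : ∀ n, lam (n + 1) ≠ 0) (hη : 0 < η)
    (hα : ∀ n, η ≤ α (n + 1)) (hαβ : ∀ n, α (n + 1) ≤ β (n + 1)) (hM : 0 ≤ M) (ht : 0 < t)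
    (ht1 : t ≤ 1) (hP : IsPacking (boundedRateSet lam α β M) δ P)
    (hPn : ∀ p ∈ P, scaledRadius lam (n + 1) p < 1)
    (hPn1 : ∀ p ∈ P, 1 ≤ scaledRadius lam (n + 2) p) :
    ∑ p ∈ P, ENNReal.ofReal (2 * p.2) ^ (1 + t) ≤ ENNReal.ofReal (levelBound η M t α β n) := by
  classical
  have term_nonneg := fun n => levelTerm_nonneg hη (hη.trans_le (hα n)) (hαβ n) hM ht
  rw [levelBound, ENNReal.ofReal_add (mul_nonneg (by positivity) (term_nonneg _))
    (mul_nonneg (by positivity) (term_nonneg _)),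
    ← Finset.sum_filter_add_sum_filter_not P fun p =>
      scaledRadius lam (n + 2) p ≤ 2 * modulus α β (n + 3)]
  gcongr
  · exact sum_rpow_le_of_le_modulus hlam hη hα (hαβ _) hM ht ht1
      (hP.subset (Finset.filter_subset _ _)) (fun p hp => hPn p (Finset.mem_of_mem_filter p hp))
      (fun p hp => hPn1 p (Finset.mem_of_mem_filter p hp)) fun p hp => (Finset.mem_filter.1 hp).2
  · exact sum_rpow_le_of_modulus_le hlam hη hα (hαβ _) hM ht
      (hP.subset (Finset.filter_subset _ _)) (fun p hp => hPn p (Finset.mem_of_mem_filter p hp))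
      (fun p hp => hPn1 p (Finset.mem_of_mem_filter p hp))
      fun p hp => (not_le.1 (Finset.mem_filter.1 hp).2).le

theorem packingPremeasure_boundedRateSet_ne_top (hlam : ∀ n, lam (n + 1) ≠ 0) (hη : 0 < η)
    (hα : ∀ n, η ≤ α (n + 1)) (hαβ : ∀ n, α (n + 1) ≤ β (n + 1)) (hM : 0 ≤ M) (ht : 0 < t)
    (ht1 : t ≤ 1) (hL : Tendsto (fun n : ℕ => logProd α n / n) atTop atTop) {B τ : ℝ}
    (hτ : τ < t)
    (h : ∀ᶠ n in atTop, modulus α β (n + 1) + 1 ≤ B ^ n * Real.exp (τ * logProd α n)) :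
    packingPremeasure (1 + t) (boundedRateSet lam α β M) ≠ ∞ := by
  classical
  have hα0 : ∀ n, 0 < α (n + 1) := fun n => hη.trans_le (hα n)
  have hβ1 : 0 < β 1 := (hα0 0).trans_le (hαβ 0)
  have bound_nonneg := levelBound_nonneg (t := t) hη hα0 hαβ hM ht
  have term_summable := summable_levelTerm hη hα0 hαβ hM ht hL hτ h
  have bound_summable : Summable (levelBound η M t α β) :=
    (((summable_nat_add_iff 2).2 term_summable).mul_left _).add
      (((summable_nat_add_iff 1).2 term_summable).mul_left _)
  suffices key : packingSup (1 + t) (min (1 / 2) (1 / β 1)) (boundedRateSet lam α β M) ≤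
      ENNReal.ofReal (∑' n, levelBound η M t α β n) from
    ne_top_of_le_ne_top ENNReal.ofReal_ne_top ((iInf₂_le _ (by positivity)).trans key)
  refine iSup₂_le fun P hP => ?_
  have level_exists : ∀ p ∈ P, ∃ n,
      scaledRadius lam (n + 1) p < 1 ∧ 1 ≤ scaledRadius lam (n + 2) p := by
    intro p hp
    obtain ⟨hpK, hp0, hpδ⟩ := hP.1 p hp
    have hr0 : scaledRadius lam 0 p ≤ 1 / 2 := by
      simpa [scaledRadius] using hpδ.trans (min_le_left _ _)
    have hr1 : scaledRadius lam 1 p ≤ 1 / 2 :=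
      scaledRadius_one_le_half hpK hp0.le ((le_div_iff₀ hβ1).1 (hpδ.trans (min_le_right _ _)))
    exact exists_scaledRadius_lt_one_le hα0 hL hpK hp0 (by linarith) (by linarith)
  choose! f hf using level_exists
  calc ∑ p ∈ P, ENNReal.ofReal (2 * p.2) ^ (1 + t)
      = ∑ n ∈ P.image f, ∑ p ∈ P with f p = n, ENNReal.ofReal (2 * p.2) ^ (1 + t) :=
        (Finset.sum_fiberwise_of_maps_to (fun p hp => Finset.mem_image_of_mem f hp) _).symm
    _ ≤ ∑ n ∈ P.image f, ENNReal.ofReal (levelBound η M t α β n) := by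
        refine Finset.sum_le_sum fun n _ => ?_
        have hPn : ∀ p ∈ P.filter (f · = n), p ∈ P ∧ f p = n := fun p hp => Finset.mem_filter.1 hp
        exact sum_rpow_le_levelBound hlam hη hα hαβ hM ht ht1
          (hP.subset (Finset.filter_subset _ _))
          (fun p hp => (hPn p hp).2 ▸ (hf p (hPn p hp).1).1)
          fun p hp => (hPn p hp).2 ▸ (hf p (hPn p hp).1).2
    _ = ENNReal.ofReal (∑ n ∈ P.image f, levelBound η M t α β n) :=
        (ENNReal.ofReal_sum_of_nonneg fun n _ => bound_nonneg n).symm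
    _ ≤ _ := ENNReal.ofReal_le_ofReal (bound_summable.sum_le_tsum _ fun n _ => bound_nonneg n)

end PackingUpper

section Boxes

open scoped Real

variable {δ x u : ℝ} {z : ℂ}

/-- The closed rectangle of width `δ` and height `2 * π` with lower left corner `p`, which the
exponential function maps onto a closed annulus. -/
def box (δ : ℝ) (p : ℂ) : Set ℂ :=
  Set.Icc p.re (p.re + δ) ×ℂ Set.Icc p.im (p.im + 2 * π)

theorem isCompact_box (δ : ℝ) (p : ℂ) : IsCompact (box δ p) :=
  isCompact_Icc.reProdIm isCompact_Icc

theorem left_mem_box (hδ : 0 ≤ δ) (p : ℂ) : p ∈ box δ p :=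
  ⟨Set.left_mem_Icc.2 (by linarith), Set.left_mem_Icc.2 (by linarith [Real.two_pi_pos])⟩

theorem exists_mem_box_of_norm_mem {c w p : ℂ} (hc : c ≠ 0) (hw : ‖c‖ * Real.exp p.re ≤ ‖w‖)
    (hw' : ‖w‖ ≤ ‖c‖ * Real.exp (p.re + δ)) : ∃ z ∈ box δ p, c * Complex.exp z = w := by
  have hc0 : 0 < ‖c‖ := norm_pos_iff.2 hc
  have hw0 : 0 < ‖w‖ := lt_of_lt_of_le (by positivity) hw
  set v := Complex.log (w / c)
  set k : ℤ := ⌊(v.im - p.im) / (2 * π)⌋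
  have floor_le : k * (2 * π) ≤ v.im - p.im := (le_div_iff₀ Real.two_pi_pos).1 (Int.floor_le _)
  have lt_floor : v.im - p.im < (k + 1) * (2 * π) :=
    (div_lt_iff₀ Real.two_pi_pos).1 (Int.lt_floor_add_one _)
  have hre : (v + ((-k : ℤ) : ℂ) * (2 * π * Complex.I)).re = Real.log (‖w‖ / ‖c‖) := by
    simp [v, Complex.log_re]
  have him : (v + ((-k : ℤ) : ℂ) * (2 * π * Complex.I)).im = v.im - k * (2 * π) := by
    simp
    ring
  refine ⟨v + ((-k : ℤ) : ℂ) * (2 * π * Complex.I), ⟨⟨?_, ?_⟩, ?_, ?_⟩, ?_⟩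
  · rwa [hre, Real.le_log_iff_exp_le (by positivity), le_div_iff₀ hc0, mul_comm]
  · rwa [hre, Real.log_le_iff_le_exp (by positivity), div_le_iff₀ hc0, mul_comm]
  · rw [him]
    linarith
  · rw [him]
    linarith
  · rw [Complex.exp_add, Complex.exp_log (div_ne_zero (norm_pos_iff.1 hw0) hc),
      Complex.exp_int_mul_two_pi_mul_I, mul_one, mul_div_cancel₀ _ hc]

/-- A height above which the points with real part in `[u, u + δ]` have norm at least `x`. -/
noncomputable def entryHeight (δ x u : ℝ) : ℝ :=
  √(x ^ 2 - max |u| |u + δ| ^ 2 + 2 * max |u| |u + δ| * δ)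

theorem sq_re_le_max_sq (hz : z.re ∈ Set.Icc u (u + δ)) : z.re ^ 2 ≤ max |u| |u + δ| ^ 2 := by
  rw [← sq_abs z.re]
  gcongr
  exact abs_le_max_abs_abs hz.1 hz.2

theorem max_sq_sub_le_sq_re (hz : z.re ∈ Set.Icc u (u + δ)) :
    max |u| |u + δ| ^ 2 - 2 * max |u| |u + δ| * δ ≤ z.re ^ 2 := by
  have max_le : max |u| |u + δ| ≤ |z.re| + δ := by
    refine max_le ?_ ?_
    · have : |u - z.re| ≤ δ := abs_le.2 ⟨by linarith [hz.2], by linarith [hz.1, hz.2]⟩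
      linarith [abs_sub_abs_le_abs_sub u z.re]
    · have : |u + δ - z.re| ≤ δ := abs_le.2 ⟨by linarith [hz.1, hz.2], by linarith [hz.1]⟩
      linarith [abs_sub_abs_le_abs_sub (u + δ) z.re]
  have max_nonneg : 0 ≤ max |u| |u + δ| := (abs_nonneg u).trans (le_max_left _ _)
  rw [← sq_abs z.re]
  rcases le_total δ (max |u| |u + δ|) with hδ | hδ
  · linarith [pow_le_pow_left₀ (sub_nonneg.2 hδ) (sub_le_iff_le_add.2 max_le) 2, sq_nonneg δ]
  · nlinarith [sq_nonneg |z.re|]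

theorem le_norm_of_entryHeight_le (hre : z.re ∈ Set.Icc u (u + δ))
    (him : entryHeight δ x u ≤ z.im) : x ≤ ‖z‖ := by
  have him_sq := (Real.sqrt_le_left ((Real.sqrt_nonneg _).trans him)).1 him
  have hre_sq := max_sq_sub_le_sq_re hre
  refine le_trans (Real.le_sqrt_of_sq_le ?_) (Complex.norm_eq_sqrt_sq_add_sq z).ge
  linarith

theorem norm_le_of_im_le_entryHeight_add (hδ : δ ≤ 1 / 4) (hx : 2 ≤ x) (hu : -x ≤ u)
    (hux : u + δ ≤ x) (hre : z.re ∈ Set.Icc u (u + δ)) (hz : 0 ≤ z.im)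
    (him : z.im ≤ entryHeight δ x u + δ * x / 4) : ‖z‖ ≤ x * Real.exp δ := by
  have hδ0 : 0 ≤ δ := by linarith [hre.1, hre.2]
  have hre_sq := sq_re_le_max_sq hre
  set U := max |u| |u + δ|
  have hUx : U ≤ x := max_le (abs_le.2 ⟨hu, by linarith⟩) (abs_le.2 ⟨by linarith, hux⟩)
  have hU0 : 0 ≤ U := (abs_nonneg u).trans (le_max_left _ _)
  set y := entryHeight δ x u
  have : 0 ≤ y := Real.sqrt_nonneg _
  have hy_sq : y ^ 2 = x ^ 2 - U ^ 2 + 2 * U * δ := Real.sq_sqrt (by nlinarith)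
  have hyx : y ≤ 11 / 10 * x := by
    refine (abs_le_of_sq_le_sq' ?_ (by linarith)).2
    nlinarith [sq_nonneg (U - δ)]
  have him_sq : z.im ^ 2 ≤ y ^ 2 + y * (δ * x) / 2 + (δ * x) ^ 2 / 16 := by
    calc z.im ^ 2 ≤ (y + δ * x / 4) ^ 2 := by gcongr
      _ = _ := by ring
  have hδx : 0 ≤ δ * x ^ 2 := by positivity
  have hyδx : y * (δ * x) ≤ 11 / 10 * (δ * x ^ 2) := by
    calc y * (δ * x) ≤ 11 / 10 * x * (δ * x) := by gcongr
      _ = _ := by ring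
  have hδx_sq : (δ * x) ^ 2 ≤ 1 / 4 * (δ * x ^ 2) := by nlinarith
  have hUδ : 2 * U * δ ≤ δ * x ^ 2 := by
    have : 2 * U ≤ x ^ 2 := by nlinarith
    nlinarith
  rw [Complex.norm_eq_sqrt_sq_add_sq]
  refine Real.sqrt_le_iff.2 ⟨by positivity, ?_⟩
  calc z.re ^ 2 + z.im ^ 2 ≤ x ^ 2 * (2 * δ + 1) := by nlinarith
    _ ≤ x ^ 2 * Real.exp (2 * δ) := by gcongr; exact Real.add_one_le_exp _
    _ = (x * Real.exp δ) ^ 2 := by rw [two_mul, Real.exp_add]; ring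

theorem norm_mem_of_mem_box {j : ℕ} (hδ : δ ≤ 1 / 4) (hx : 2 ≤ x) (hu : -x ≤ u)
    (hux : u + δ ≤ x) (hj : 64 * ((j : ℝ) + 1) ≤ δ * x)
    (hz : z ∈ box δ ⟨u, entryHeight δ x u + 16 * j⟩) :
    x ≤ ‖z‖ ∧ ‖z‖ ≤ x * Real.exp δ := by
  obtain ⟨hre, him, him'⟩ := hz
  simp only at hre him him'
  have := Nat.cast_nonneg (α := ℝ) j
  have hy0 : 0 ≤ entryHeight δ x u := Real.sqrt_nonneg _
  exact ⟨le_norm_of_entryHeight_le hre (by linarith),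
    norm_le_of_im_le_entryHeight_add hδ hx hu hux hre (by linarith)
      (by linarith [Real.pi_lt_four])⟩

end Boxes

section StripSystem

variable {lam : ℕ → ℂ} {c w : ℕ → ℝ} {δ t t' : ℝ} {n : ℕ} {p : ℂ}

/-- A sequence of vertical strips `c n ≤ re z ≤ c n + w n` such that the image of every strip under
the next exponential map consists of circles around `0` that cross the next strip. Inside these
strips we build a tree of boxes of width `δ`. -/
structure IsStripSystem (lam : ℕ → ℂ) (c w : ℕ → ℝ) (δ : ℝ) : Prop where
  pos : 0 < δ
  le_quarter : δ ≤ 1 / 4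
  lam_ne_zero : ∀ n, lam (n + 1) ≠ 0
  two_mul_le : ∀ n, 2 * δ ≤ w n
  le_norm : ∀ n, 64 / δ ≤ ‖lam (n + 1)‖ * Real.exp (c n)
  neg_le : ∀ n, -(‖lam (n + 1)‖ * Real.exp (c n)) ≤ c (n + 1)
  add_le : ∀ n, c (n + 1) + w (n + 1) ≤ ‖lam (n + 1)‖ * Real.exp (c n)

/-- The points whose iterates stay in the strips. -/
def stripSet (lam : ℕ → ℂ) (c w : ℕ → ℝ) : Set ℂ :=
  {z | ∀ n, c n ≤ (iter lam n z).re ∧ (iter lam n z).re ≤ c n + w n}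

/-- The inner radius of the image of the box of level `n` with corner `p`. -/
noncomputable def innerRadius (lam : ℕ → ℂ) (n : ℕ) (p : ℂ) : ℝ :=
  ‖lam (n + 1)‖ * Real.exp p.re

/-- The number of columns of boxes in the strip of level `n`. -/
noncomputable def columns (w : ℕ → ℝ) (δ : ℝ) (n : ℕ) : ℕ := ⌊w n / (2 * δ)⌋₊

/-- The number of boxes of level `n + 1` in a column that lie inside the image of the box with
corner `p`. -/
noncomputable def rows (lam : ℕ → ℂ) (δ : ℝ) (n : ℕ) (p : ℂ) : ℕ := ⌊δ * innerRadius lam n p / 64⌋₊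

/-- The number of boxes of level `n + 1` inside the image of the box with corner `p`. -/
noncomputable def children (lam : ℕ → ℂ) (w : ℕ → ℝ) (δ : ℝ) (n : ℕ) (p : ℂ) : ℕ :=
  columns w δ (n + 1) * rows lam δ n p

/-- The corner of the box of level `n + 1` in column `i` and row `j`. Consecutive columns and rows
have distances `2 * δ` and `16`, more than the width and the height of a box plus `δ`. -/
noncomputable def childCorner (lam : ℕ → ℂ) (c : ℕ → ℝ) (δ : ℝ) (n : ℕ) (p : ℂ) (i j : ℕ) : ℂ :=
  ⟨c (n + 1) + 2 * δ * i,
    entryHeight δ (innerRadius lam n p) (c (n + 1) + 2 * δ * i) + 16 * j⟩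

/-- The expansion of a number `t ∈ [0, 1)` along the tree of boxes, like a `b`-adic expansion whose
base is the number of children of the current box: the corner of the current box and the relative
position of `t` in the interval that corresponds to it. -/
noncomputable def expansion (lam : ℕ → ℂ) (c w : ℕ → ℝ) (δ : ℝ) : ℕ → ℝ → ℂ × ℝ
  | 0, t => (⟨c 0, 0⟩, t)
  | n + 1, t =>
    let s := expansion lam c w δ n t
    let d := ⌊children lam w δ n s.1 * s.2⌋₊
    (childCorner lam c δ n s.1 (d % columns w δ (n + 1)) (d / columns w δ (n + 1)),
      Int.fract (children lam w δ n s.1 * s.2))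

/-- The corner of the box of level `n` that is chosen by `t`. -/
noncomputable def corner (lam : ℕ → ℂ) (c w : ℕ → ℝ) (δ : ℝ) (n : ℕ) (t : ℝ) : ℂ :=
  (expansion lam c w δ n t).1

/-- The relative position of `t` in the interval of numbers that choose the same box of level `n`
as `t`. -/
noncomputable def position (lam : ℕ → ℂ) (c w : ℕ → ℝ) (δ : ℝ) (n : ℕ) (t : ℝ) : ℝ :=
  (expansion lam c w δ n t).2

/-- The number of children of the box of level `n` that is chosen by `t`. -/
noncomputable def base (lam : ℕ → ℂ) (c w : ℕ → ℝ) (δ : ℝ) (n : ℕ) (t : ℝ) : ℕ :=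
  children lam w δ n (corner lam c w δ n t)

/-- The number, among its siblings, of the box of level `n + 1` that is chosen by `t`. -/
noncomputable def digit (lam : ℕ → ℂ) (c w : ℕ → ℝ) (δ : ℝ) (n : ℕ) (t : ℝ) : ℕ :=
  ⌊base lam c w δ n t * position lam c w δ n t⌋₊

/-- The column of the box of level `n + 1` that is chosen by `t`. -/
noncomputable def column (lam : ℕ → ℂ) (c w : ℕ → ℝ) (δ : ℝ) (n : ℕ) (t : ℝ) : ℕ :=
  digit lam c w δ n t % columns w δ (n + 1)

/-- The row of the box of level `n + 1` that is chosen by `t`. -/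
noncomputable def row (lam : ℕ → ℂ) (c w : ℕ → ℝ) (δ : ℝ) (n : ℕ) (t : ℝ) : ℕ :=
  digit lam c w δ n t / columns w δ (n + 1)

/-- The denominator of the first `n` digits of `t`, so that the numbers with these digits form an
interval of length `1 / prodBase n t`. -/
noncomputable def prodBase (lam : ℕ → ℂ) (c w : ℕ → ℝ) (δ : ℝ) (n : ℕ) (t : ℝ) : ℝ :=
  ∏ k ∈ Finset.range n, (base lam c w δ k t : ℝ)

theorem corner_succ (n : ℕ) (t : ℝ) :
    corner lam c w δ (n + 1) t =
      childCorner lam c δ n (corner lam c w δ n t) (column lam c w δ n t) (row lam c w δ n t) :=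
  rfl

theorem corner_succ_re (n : ℕ) (t : ℝ) :
    (corner lam c w δ (n + 1) t).re = c (n + 1) + 2 * δ * column lam c w δ n t :=
  rfl

theorem prodBase_succ (n : ℕ) (t : ℝ) :
    prodBase lam c w δ (n + 1) t = prodBase lam c w δ n t * base lam c w δ n t :=
  Finset.prod_range_succ _ n

theorem digit_eq_of_column_eq_of_row_eq (hcol : column lam c w δ n t = column lam c w δ n t')
    (hrow : row lam c w δ n t = row lam c w δ n t') :
    digit lam c w δ n t = digit lam c w δ n t' := by
  rw [← Nat.mod_add_div (digit lam c w δ n t), ← Nat.mod_add_div (digit lam c w δ n t')]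
  exact congrArg₂ (fun i j => i + columns w δ (n + 1) * j) hcol hrow

theorem position_mem (n : ℕ) (ht : t ∈ Set.Ico (0 : ℝ) 1) :
    position lam c w δ n t ∈ Set.Ico (0 : ℝ) 1 := by
  cases n with
  | zero => exact ht
  | succ n => exact ⟨Int.fract_nonneg _, Int.fract_lt_one _⟩

theorem base_mul_position (n : ℕ) (ht : t ∈ Set.Ico (0 : ℝ) 1) :
    base lam c w δ n t * position lam c w δ n t =
      digit lam c w δ n t + position lam c w δ (n + 1) t := by
  rw [digit, natCast_floor_eq_intCast_floor
    (mul_nonneg (Nat.cast_nonneg _) (position_mem n ht).1)]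
  exact (Int.floor_add_fract _).symm

theorem corner_eq_of_digit_eq (hd : ∀ k < n, digit lam c w δ k t = digit lam c w δ k t') :
    corner lam c w δ n t = corner lam c w δ n t' := by
  induction n with
  | zero => rfl
  | succ n ih =>
    rw [corner_succ, corner_succ, ih fun k hk => hd k (by omega), column, row, hd n (by omega)]
    rfl

theorem base_eq_of_digit_eq (hd : ∀ k < n, digit lam c w δ k t = digit lam c w δ k t') :
    base lam c w δ n t = base lam c w δ n t' := by
  rw [base, base, corner_eq_of_digit_eq hd]

theorem prodBase_eq_of_digit_eq (hd : ∀ k < n, digit lam c w δ k t = digit lam c w δ k t') :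
    prodBase lam c w δ (n + 1) t = prodBase lam c w δ (n + 1) t' :=
  Finset.prod_congr rfl fun _ hk => congrArg _ <| base_eq_of_digit_eq fun _ hj =>
    hd _ (hj.trans_le (Nat.lt_succ_iff.1 (Finset.mem_range.1 hk)))

theorem sub_mul_prodBase_of_digit_eq (ht : t ∈ Set.Ico (0 : ℝ) 1) (ht' : t' ∈ Set.Ico (0 : ℝ) 1)
    (hd : ∀ k < n, digit lam c w δ k t = digit lam c w δ k t') :
    (t - t') * prodBase lam c w δ n t' = position lam c w δ n t - position lam c w δ n t' := by
  induction n with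
  | zero => simp [prodBase, position, expansion]
  | succ n ih =>
    have hdn : ∀ k < n, digit lam c w δ k t = digit lam c w δ k t' := fun k hk => hd k (by omega)
    have ht_digit := base_mul_position (lam := lam) (c := c) (w := w) (δ := δ) n ht
    have ht'_digit := base_mul_position (lam := lam) (c := c) (w := w) (δ := δ) n ht'
    rw [base_eq_of_digit_eq hdn, hd n (by omega)] at ht_digit
    rw [prodBase_succ, ← mul_assoc, ih hdn, sub_mul]
    linarith

theorem le_innerRadius_of_le_re (n : ℕ) (hp : c n ≤ p.re) :
    ‖lam (n + 1)‖ * Real.exp (c n) ≤ innerRadius lam n p := by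
  unfold innerRadius
  gcongr

namespace IsStripSystem

variable (h : IsStripSystem lam c w δ)
include h

theorem width_pos (n : ℕ) : 0 < w n := by
  linarith [h.pos, h.two_mul_le n]

theorem half_le_columns (n : ℕ) : w n / (4 * δ) ≤ columns w δ n := by
  have hδ := h.pos
  have one_le : 1 ≤ w n / (2 * δ) := (one_le_div (by linarith)).2 (h.two_mul_le n)
  have one_le_floor : (1 : ℝ) ≤ ⌊w n / (2 * δ)⌋₊ := by
    exact_mod_cast (Nat.one_le_floor_iff _).2 one_le
  have half_eq : w n / (4 * δ) = w n / (2 * δ) / 2 := by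
    rw [div_div]
    ring_nf
  rw [columns, half_eq]
  linarith [Nat.lt_floor_add_one (w n / (2 * δ))]

theorem columns_pos (n : ℕ) : 0 < columns w δ n := by
  have := h.pos
  have := h.width_pos n
  exact Nat.cast_pos.1 (lt_of_lt_of_le (by positivity) (h.half_le_columns n))

theorem two_mul_columns_le (n : ℕ) : 2 * δ * columns w δ n ≤ w n := by
  have hδ := h.pos
  rw [mul_comm, ← le_div_iff₀ (by linarith)]
  exact Nat.floor_le (div_nonneg (h.width_pos n).le (by linarith))

theorem le_corner_re (n : ℕ) (t : ℝ) : c n ≤ (corner lam c w δ n t).re := by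
  have hδ := h.pos
  cases n with
  | zero => exact le_rfl
  | succ n =>
    rw [corner_succ_re]
    exact le_add_of_nonneg_right (by positivity)

theorem corner_re_add_le (n : ℕ) (t : ℝ) : (corner lam c w δ n t).re + δ ≤ c n + w n := by
  have hδ := h.pos
  cases n with
  | zero =>
    simp only [corner, expansion]
    linarith [h.two_mul_le 0]
  | succ n =>
    have column_lt : column lam c w δ n t + 1 ≤ columns w δ (n + 1) :=
      Nat.mod_lt _ (h.columns_pos (n + 1))
    have : (column lam c w δ n t : ℝ) + 1 ≤ columns w δ (n + 1) := by exact_mod_cast column_lt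
    rw [corner_succ_re]
    nlinarith [h.two_mul_columns_le (n + 1)]

theorem le_innerRadius (n : ℕ) (hp : c n ≤ p.re) : 64 ≤ δ * innerRadius lam n p := by
  rw [mul_comm, ← div_le_iff₀ h.pos]
  exact (h.le_norm n).trans (le_innerRadius_of_le_re n hp)

theorem two_le_innerRadius (n : ℕ) (hp : c n ≤ p.re) : 2 ≤ innerRadius lam n p := by
  by_contra! hlt
  nlinarith [h.le_innerRadius n hp, h.le_quarter, h.pos]

theorem half_le_rows (n : ℕ) (hp : c n ≤ p.re) :
    δ * innerRadius lam n p / 128 ≤ rows lam δ n p := by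
  have one_le_floor : (1 : ℝ) ≤ ⌊δ * innerRadius lam n p / 64⌋₊ := by
    exact_mod_cast (Nat.one_le_floor_iff _).2 ((one_le_div (by norm_num)).2 (h.le_innerRadius n hp))
  rw [rows]
  linarith [Nat.lt_floor_add_one (δ * innerRadius lam n p / 64)]

theorem rows_pos (n : ℕ) (hp : c n ≤ p.re) : 0 < rows lam δ n p := by
  have : (0 : ℝ) < rows lam δ n p := by linarith [h.half_le_rows n hp, h.le_innerRadius n hp]
  exact_mod_cast this

theorem base_pos (n : ℕ) (t : ℝ) : 0 < base lam c w δ n t :=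
  Nat.mul_pos (h.columns_pos _) (h.rows_pos n (h.le_corner_re n t))

theorem prodBase_pos (n : ℕ) (t : ℝ) : 0 < prodBase lam c w δ n t :=
  Finset.prod_pos fun k _ => Nat.cast_pos.2 (h.base_pos k t)

theorem row_lt (n : ℕ) (ht : t ∈ Set.Ico (0 : ℝ) 1) :
    row lam c w δ n t < rows lam δ n (corner lam c w δ n t) := by
  refine Nat.div_lt_of_lt_mul ?_
  have hs := position_mem (lam := lam) (c := c) (w := w) (δ := δ) n ht
  rw [digit, Nat.floor_lt (mul_nonneg (Nat.cast_nonneg _) hs.1)]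
  exact mul_lt_of_lt_one_right (Nat.cast_pos.2 (h.base_pos n t)) hs.2

theorem row_mul_le (n : ℕ) (ht : t ∈ Set.Ico (0 : ℝ) 1) :
    64 * ((row lam c w δ n t : ℝ) + 1) ≤ δ * innerRadius lam n (corner lam c w δ n t) := by
  have row_le : (row lam c w δ n t : ℝ) + 1 ≤ rows lam δ n (corner lam c w δ n t) := by
    exact_mod_cast h.row_lt n ht
  have floor_le := Nat.floor_le (a := δ * innerRadius lam n (corner lam c w δ n t) / 64)
    (by linarith [h.le_innerRadius n (h.le_corner_re n t)])
  rw [rows] at row_le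
  linarith

theorem exists_mem_box_preimage (n : ℕ) (ht : t ∈ Set.Ico (0 : ℝ) 1) {z : ℂ}
    (hz : z ∈ box δ (corner lam c w δ (n + 1) t)) :
    ∃ z' ∈ box δ (corner lam c w δ n t), lam (n + 1) * Complex.exp z' = z := by
  have hp := h.le_corner_re n t
  have hx := le_innerRadius_of_le_re (lam := lam) n hp
  have le_re := h.le_corner_re (n + 1) t
  have re_le := h.corner_re_add_le (n + 1) t
  rw [corner_succ_re] at le_re re_le
  obtain ⟨le_norm, norm_le⟩ := norm_mem_of_mem_box h.le_quarter (h.two_le_innerRadius n hp)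
    (u := c (n + 1) + 2 * δ * column lam c w δ n t) (by linarith [h.neg_le n])
    (by linarith [h.add_le n]) (h.row_mul_le n ht) hz
  refine exists_mem_box_of_norm_mem (h.lam_ne_zero n) le_norm ?_
  rwa [Real.exp_add, ← mul_assoc]

theorem exists_iter_mem_box_of_mem (n : ℕ) (ht : t ∈ Set.Ico (0 : ℝ) 1) :
    ∀ z ∈ box δ (corner lam c w δ n t), ∃ z₀,
      (∀ k ≤ n, iter lam k z₀ ∈ box δ (corner lam c w δ k t)) ∧ iter lam n z₀ = z := by
  induction n with
  | zero =>
    intro z hz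
    refine ⟨z, fun k hk => ?_, rfl⟩
    rwa [Nat.le_zero.1 hk]
  | succ n ih =>
    intro z hz
    obtain ⟨z', hz', rfl⟩ := h.exists_mem_box_preimage n ht hz
    obtain ⟨z₀, hz₀, rfl⟩ := ih z' hz'
    refine ⟨z₀, fun k hk => ?_, rfl⟩
    rcases Nat.le_succ_iff.1 hk with hk | rfl
    · exact hz₀ k hk
    · exact hz

end IsStripSystem

theorem continuous_iter (lam : ℕ → ℂ) (n : ℕ) : Continuous (iter lam n) := by
  induction n with
  | zero => exact continuous_id
  | succ n ih => exact continuous_const.mul (Complex.continuous_exp.comp ih)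

/-- The point `z` passes through the boxes chosen by `t`. -/
def Follows (lam : ℕ → ℂ) (c w : ℕ → ℝ) (δ t : ℝ) (z : ℂ) : Prop :=
  ∀ k, iter lam k z ∈ box δ (corner lam c w δ k t)

theorem eq_of_mem_Icc_of_abs_sub_lt {a g l r x x' : ℝ} {i i' : ℕ} (hg : 0 ≤ g) (hr : l + r ≤ g)
    (hx : x ∈ Set.Icc (a + g * i) (a + g * i + l))
    (hx' : x' ∈ Set.Icc (a + g * i') (a + g * i' + l))
    (hxx : |x - x'| < r) : i = i' := by
  wlog hlt : i < i' generalizing i i' x x' with H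
  · rcases (not_lt.1 hlt).eq_or_lt with heq | hgt
    · exact heq.symm
    · exact (H hx' hx (by rwa [abs_sub_comm]) hgt).symm
  have : g * ((i : ℝ) + 1) ≤ g * i' := by
    gcongr
    exact_mod_cast hlt
  linarith [hx.2, hx'.1, (abs_lt.1 hxx).1]

namespace IsStripSystem

variable (h : IsStripSystem lam c w δ)
include h

theorem exists_follows (ht : t ∈ Set.Ico (0 : ℝ) 1) : ∃ z, Follows lam c w δ t z := by
  let K : ℕ → Set ℂ := fun n =>
    ⋂ k ∈ Finset.range (n + 1), iter lam k ⁻¹' box δ (corner lam c w δ k t)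
  have K_anti : ∀ n, K (n + 1) ⊆ K n := fun n =>
    Set.biInter_subset_biInter_left (Finset.range_subset_range.2 n.succ.le_succ)
  have K_closed : ∀ n, IsClosed (K n) := fun n =>
    isClosed_biInter fun k _ => (isCompact_box _ _).isClosed.preimage (continuous_iter lam k)
  have K_zero : IsCompact (K 0) :=
    (isCompact_box δ (corner lam c w δ 0 t)).of_isClosed_subset (K_closed 0) fun z hz =>
      Set.mem_iInter₂.1 hz 0 (by simp)
  have K_nonempty : ∀ n, (K n).Nonempty := fun n => by
    obtain ⟨z, hz, -⟩ := h.exists_iter_mem_box_of_mem n ht _ (left_mem_box h.pos.le _)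
    exact ⟨z, Set.mem_iInter₂.2 fun k hk => hz k (Nat.lt_succ_iff.1 (Finset.mem_range.1 hk))⟩
  obtain ⟨z, hz⟩ := IsCompact.nonempty_iInter_of_sequence_nonempty_isCompact_isClosed K K_anti
    K_nonempty K_zero K_closed
  exact ⟨z, fun k => Set.mem_iInter₂.1 (Set.mem_iInter.1 hz k) k (by simp)⟩

theorem digit_eq_of_norm_sub_lt (n : ℕ) {z z' : ℂ}
    (hcorner : corner lam c w δ n t = corner lam c w δ n t')
    (hz : z ∈ box δ (corner lam c w δ (n + 1) t))
    (hz' : z' ∈ box δ (corner lam c w δ (n + 1) t')) (hzz : ‖z - z'‖ < δ) :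
    digit lam c w δ n t = digit lam c w δ n t' := by
  have hδ := h.pos
  rw [corner_succ, hcorner] at hz
  rw [corner_succ] at hz'
  have hcol : column lam c w δ n t = column lam c w δ n t' :=
    eq_of_mem_Icc_of_abs_sub_lt (by positivity) (two_mul δ).ge hz.1 hz'.1
      ((Complex.abs_re_le_norm _).trans_lt hzz)
  rw [hcol] at hz
  have hrow : row lam c w δ n t = row lam c w δ n t' :=
    eq_of_mem_Icc_of_abs_sub_lt (by norm_num) (by linarith [Real.pi_lt_four, h.le_quarter])
      hz.2 hz'.2 ((Complex.abs_im_le_norm _).trans_lt hzz)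
  exact digit_eq_of_column_eq_of_row_eq hcol hrow

theorem abs_sub_le_of_digit_eq (ht : t ∈ Set.Ico (0 : ℝ) 1) (ht' : t' ∈ Set.Ico (0 : ℝ) 1)
    (hd : ∀ k < n, digit lam c w δ k t = digit lam c w δ k t') :
    |t - t'| ≤ 1 / prodBase lam c w δ n t' := by
  have hpos := h.prodBase_pos n t'
  rw [le_div_iff₀ hpos, ← abs_of_pos hpos, ← abs_mul, sub_mul_prodBase_of_digit_eq ht ht' hd]
  have ht_mem := position_mem (lam := lam) (c := c) (w := w) (δ := δ) n ht
  have ht'_mem := position_mem (lam := lam) (c := c) (w := w) (δ := δ) n ht'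
  exact abs_le.2 ⟨by linarith [ht_mem.1, ht'_mem.2], by linarith [ht_mem.2, ht'_mem.1]⟩

end IsStripSystem

end StripSystem

section MassBound

variable {lam : ℕ → ℂ} {c w : ℕ → ℝ} {δ r t t' R y : ℝ} {m : ℕ} {z z' : ℂ}

/-- The base of the exponential factor in the bound for the mass of small sets. -/
noncomputable def massConst (δ : ℝ) : ℝ := 2048 * 768 / δ ^ 2

theorem card_Icc_ceil_floor_le (a : ℝ) {l : ℝ} (hl : 0 ≤ l) :
    ((Finset.Icc ⌈a⌉ ⌊a + l⌋).card : ℝ) ≤ l + 1 := by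
  rw [Int.card_Icc, ← Int.cast_natCast, Int.toNat_eq_max, Int.cast_max]
  push_cast
  exact max_le (by linarith [Int.floor_le (a + l), Int.le_ceil a]) (by linarith)

theorem Follows.norm_iter_succ_le (hz : Follows lam c w δ t z) (n : ℕ) :
    ‖iter lam (n + 1) z‖ ≤ innerRadius lam n (corner lam c w δ n t) * Real.exp δ := by
  rw [norm_iter_succ, innerRadius, mul_assoc, ← Real.exp_add]
  exact mul_le_mul_of_nonneg_left (Real.exp_le_exp.2 (hz n).1.2) (norm_nonneg _)

theorem Follows.row_mem_Icc (hz : Follows lam c w δ t z)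
    (hy : |(iter lam (m + 1) z).im - y| ≤ R) :
    (row lam c w δ m t : ℝ) ∈ Set.Icc
      ((y - R - 7 - entryHeight δ (innerRadius lam m (corner lam c w δ m t))
        (c (m + 1) + 2 * δ * column lam c w δ m t)) / 16)
      ((y - R - 7 - entryHeight δ (innerRadius lam m (corner lam c w δ m t))
        (c (m + 1) + 2 * δ * column lam c w δ m t)) / 16 + (2 * R + 7) / 16) := by
  obtain ⟨-, him, him'⟩ := hz (m + 1)
  simp only [corner_succ, childCorner] at him him'
  have hy' := abs_le.1 hy
  have := Real.pi_lt_d2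
  exact ⟨by linarith [hy'.1, hy'.2], by linarith [hy'.1, hy'.2]⟩

namespace IsStripSystem

variable (h : IsStripSystem lam c w δ)
include h

theorem mem_stripSet (hz : Follows lam c w δ t z) : z ∈ stripSet lam c w := fun n =>
  ⟨(h.le_corner_re n t).trans (hz n).1.1, (hz n).1.2.trans (h.corner_re_add_le n t)⟩

theorem two_le_norm_iter_succ (hz : z ∈ stripSet lam c w) (n : ℕ) :
    2 ≤ ‖iter lam (n + 1) z‖ := by
  rw [norm_iter_succ]
  exact h.two_le_innerRadius n (hz n).1

theorem one_le_derivNorm (hz : z ∈ stripSet lam c w) (n : ℕ) : 1 ≤ derivNorm lam n z :=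
  Finset.one_le_prod fun k _ => by linarith [h.two_le_norm_iter_succ hz k]

theorem exists_pow_mul_derivNorm_mul_lt_le (hz : z ∈ stripSet lam c w) (hr : 0 < r)
    (hrδ : r < δ) :
    ∃ m, 2 ^ m * derivNorm lam m z * r < δ ∧ δ ≤ 2 ^ (m + 1) * derivNorm lam (m + 1) z * r := by
  refine exists_lt_le_succ (u := fun m => 2 ^ m * derivNorm lam m z * r) (by simpa using hrδ) ?_
  obtain ⟨n, hn⟩ := pow_unbounded_of_one_lt (δ / r) (one_lt_two (α := ℝ))
  refine ⟨n, ((div_le_iff₀ hr).1 hn.le).trans ?_⟩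
  gcongr
  exact le_mul_of_one_le_right (by positivity) (h.one_le_derivNorm hz n)

theorem monotone_pow_mul_derivNorm (hz : z ∈ stripSet lam c w) :
    Monotone fun n => 2 ^ n * derivNorm lam n z := by
  refine monotone_nat_of_le_succ fun n => ?_
  have nonneg : 0 ≤ 2 ^ n * derivNorm lam n z := mul_nonneg (by positivity) (derivNorm_nonneg _ _)
  rw [derivNorm_succ, pow_succ]
  nlinarith [h.two_le_norm_iter_succ hz n]

theorem norm_iter_sub_lt (hz' : z' ∈ stripSet lam c w) (hzz : ‖z - z'‖ ≤ r)
    (hm : 2 ^ m * derivNorm lam m z' * r < δ) : ∀ k ≤ m, ‖iter lam k z - iter lam k z'‖ < δ := by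
  intro k
  induction k using Nat.strong_induction_on with
  | _ k ih =>
    intro hk
    have norm_sub_le : ∀ j < k, ‖iter lam j z - iter lam j z'‖ ≤ 1 := fun j hj =>
      (ih j hj (by omega)).le.trans (by linarith [h.le_quarter])
    have nonneg : ∀ n, 0 ≤ 2 ^ n * derivNorm lam n z' := fun n =>
      mul_nonneg (by positivity) (derivNorm_nonneg _ _)
    calc ‖iter lam k z - iter lam k z'‖ ≤ 2 ^ k * derivNorm lam k z' * ‖z - z'‖ :=
          norm_iter_sub_le norm_sub_le
      _ ≤ 2 ^ m * derivNorm lam m z' * r :=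
          mul_le_mul (h.monotone_pow_mul_derivNorm hz' hk) hzz (norm_nonneg _) (nonneg m)
      _ < δ := hm

theorem half_norm_iter_succ_le (hz : Follows lam c w δ t z) (n : ℕ) :
    ‖iter lam (n + 1) z‖ / 2 ≤ innerRadius lam n (corner lam c w δ n t) := by
  have exp_le_two : Real.exp δ ≤ 2 :=
    (Real.exp_le_exp.2 h.le_quarter).trans exp_quarter_le_two
  nlinarith [hz.norm_iter_succ_le n, h.two_le_innerRadius n (h.le_corner_re n t)]

theorem mul_norm_le_rows (hz : Follows lam c w δ t z) (n : ℕ) :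
    δ * ‖iter lam (n + 1) z‖ / 256 ≤ rows lam δ n (corner lam c w δ n t) := by
  refine le_trans ?_ (h.half_le_rows n (h.le_corner_re n t))
  have hδ := h.pos
  calc δ * ‖iter lam (n + 1) z‖ / 256 = δ * (‖iter lam (n + 1) z‖ / 2) / 128 := by ring
    _ ≤ _ := by
        gcongr
        exact h.half_norm_iter_succ_le hz n

theorem mul_norm_le_base (hz : Follows lam c w δ t z) (n : ℕ) :
    w (n + 1) * ‖iter lam (n + 1) z‖ / 1024 ≤ base lam c w δ n t := by
  have hδ := h.pos
  rw [base, children, Nat.cast_mul]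
  calc w (n + 1) * ‖iter lam (n + 1) z‖ / 1024
      = w (n + 1) / (4 * δ) * (δ * ‖iter lam (n + 1) z‖ / 256) := by field_simp; ring
    _ ≤ _ := mul_le_mul (h.half_le_columns (n + 1)) (h.mul_norm_le_rows hz n) (by positivity)
        (Nat.cast_nonneg _)

theorem prod_width_pos (n : ℕ) : 0 < ∏ k ∈ Finset.range n, w (k + 1) :=
  Finset.prod_pos fun k _ => h.width_pos (k + 1)

theorem prod_le_prodBase (hz : Follows lam c w δ t z) (n : ℕ) :
    (∏ k ∈ Finset.range n, w (k + 1)) * derivNorm lam n z / 1024 ^ n ≤ prodBase lam c w δ n t := by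
  calc (∏ k ∈ Finset.range n, w (k + 1)) * derivNorm lam n z / 1024 ^ n
      = ∏ k ∈ Finset.range n, w (k + 1) * ‖iter lam (k + 1) z‖ / 1024 := by
        rw [Finset.prod_div_distrib, Finset.prod_mul_distrib, Finset.prod_const, Finset.card_range,
          derivNorm]
    _ ≤ prodBase lam c w δ n t :=
        Finset.prod_le_prod (fun k _ => by have := h.width_pos (k + 1); positivity)
          fun k _ => h.mul_norm_le_base hz k

theorem columns_mul_div_prodBase_succ (m : ℕ) (t x : ℝ) :
    columns w δ (m + 1) * (x / prodBase lam c w δ (m + 1) t) =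
      x / (prodBase lam c w δ m t * rows lam δ m (corner lam c w δ m t)) := by
  have : (0 : ℝ) < columns w δ (m + 1) := Nat.cast_pos.2 (h.columns_pos (m + 1))
  rw [prodBase_succ, base, children, Nat.cast_mul]
  field_simp

theorem div_prodBase_mul_rows_le (hz : Follows lam c w δ t z) (hr : 0 ≤ r)
    (hm : δ ≤ 2 ^ (m + 1) * derivNorm lam (m + 1) z * r) :
    ((2 * (2 ^ (m + 1) * derivNorm lam (m + 1) z * r) + 7) / 16 + 1) /
        (prodBase lam c w δ m t * rows lam δ m (corner lam c w δ m t)) ≤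
      massConst δ ^ (m + 1) * r / ∏ k ∈ Finset.range m, w (k + 1) := by
  have hδ := h.pos
  have hδ' := h.le_quarter
  have hW := h.prod_width_pos m
  have one_le := h.one_le_derivNorm (h.mem_stripSet hz) (m + 1)
  have denom_le : (∏ k ∈ Finset.range m, w (k + 1)) * derivNorm lam (m + 1) z * δ /
      (1024 ^ m * 256) ≤ prodBase lam c w δ m t * rows lam δ m (corner lam c w δ m t) := by
    refine le_trans (le_of_eq ?_) (mul_le_mul (h.prod_le_prodBase hz m) (h.mul_norm_le_rows hz m)
      (by positivity) (h.prodBase_pos m t).le)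
    rw [derivNorm_succ]
    ring
  have num_le : (2 * (2 ^ (m + 1) * derivNorm lam (m + 1) z * r) + 7) / 16 + 1 ≤
      3 * (2 ^ (m + 1) * derivNorm lam (m + 1) z * r) / δ := by
    rw [le_div_iff₀ hδ]
    nlinarith
  have le_massConst : 2048 ≤ massConst δ := by
    rw [massConst, le_div_iff₀ (by positivity)]
    nlinarith
  calc _ ≤ 3 * (2 ^ (m + 1) * derivNorm lam (m + 1) z * r) / δ /
        ((∏ k ∈ Finset.range m, w (k + 1)) * derivNorm lam (m + 1) z * δ / (1024 ^ m * 256)) := by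
        gcongr
    _ = 2048 ^ m * (2 * 768 / δ ^ 2) * r / ∏ k ∈ Finset.range m, w (k + 1) := by
        rw [show (2048 : ℝ) = 2 * 1024 by norm_num, mul_pow]
        field_simp
        ring
    _ ≤ massConst δ ^ m * (2048 * 768 / δ ^ 2) * r / ∏ k ∈ Finset.range m, w (k + 1) := by
        gcongr
        norm_num
    _ = _ := by rw [pow_succ (massConst δ) m, ← massConst]

theorem digit_eq_of_norm_iter_sub_lt (hz : Follows lam c w δ t z) (hz' : Follows lam c w δ t' z')
    (hzz : ∀ k ≤ m, ‖iter lam k z - iter lam k z'‖ < δ) :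
    ∀ k < m, digit lam c w δ k t = digit lam c w δ k t' := by
  induction m with
  | zero => exact fun k hk => absurd hk k.not_lt_zero
  | succ m ih =>
    have ih' := ih fun k hk => hzz k (hk.trans m.le_succ)
    intro k hk
    rcases Nat.lt_succ_iff_lt_or_eq.1 hk with hk | rfl
    · exact ih' k hk
    · exact h.digit_eq_of_norm_sub_lt k (corner_eq_of_digit_eq ih') (hz (k + 1)) (hz' (k + 1))
        (hzz (k + 1) le_rfl)

theorem volume_le_of_digit_eq {A : Set ℝ} (hA : A ⊆ Set.Ico 0 1) (t₀ : ℝ)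
    (hd : ∀ t ∈ A, ∀ k < m, digit lam c w δ k t = digit lam c w δ k t₀)
    (hdm : ∀ t ∈ A, ∀ t' ∈ A, digit lam c w δ m t = digit lam c w δ m t') :
    volume A ≤ ENNReal.ofReal (1 / prodBase lam c w δ (m + 1) t₀) := by
  refine (Real.volume_le_diam _).trans (Metric.ediam_le_of_forall_dist_le fun t ht t' ht' => ?_)
  rw [Real.dist_eq, ← prodBase_eq_of_digit_eq (hd t' ht')]
  refine h.abs_sub_le_of_digit_eq (hA ht) (hA ht') fun k hk => ?_
  rcases Nat.lt_succ_iff_lt_or_eq.1 hk with hk | rfl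
  · rw [hd t ht k hk, hd t' ht' k hk]
  · exact hdm t ht t' ht'

theorem volume_le_of_row_mem_Icc {S : Set ℝ} {a : ℕ → ℝ} {l : ℝ} (hl : 0 ≤ l)
    (hS : S ⊆ Set.Ico 0 1) (t₀ : ℝ)
    (hd : ∀ t ∈ S, ∀ k < m, digit lam c w δ k t = digit lam c w δ k t₀)
    (hrow : ∀ t ∈ S, (row lam c w δ m t : ℝ) ∈
      Set.Icc (a (column lam c w δ m t)) (a (column lam c w δ m t) + l)) :
    volume S ≤ ENNReal.ofReal
      (columns w δ (m + 1) * ((l + 1) / prodBase lam c w δ (m + 1) t₀)) := by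
  let A : ℕ → ℤ → Set ℝ := fun i j =>
    {t ∈ S | column lam c w δ m t = i ∧ (row lam c w δ m t : ℤ) = j}
  have S_subset : S ⊆ ⋃ i ∈ Finset.range (columns w δ (m + 1)),
      ⋃ j ∈ Finset.Icc ⌈a i⌉ ⌊a i + l⌋, A i j := by
    intro t ht
    simp only [Set.mem_iUnion]
    exact ⟨column lam c w δ m t, Finset.mem_range.2 (Nat.mod_lt _ (h.columns_pos _)),
      row lam c w δ m t, Finset.mem_Icc.2 ⟨Int.ceil_le.2 (hrow t ht).1,
        Int.le_floor.2 (hrow t ht).2⟩, ht, rfl, rfl⟩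
  have volume_A_le : ∀ i j, volume (A i j) ≤ ENNReal.ofReal (1 / prodBase lam c w δ (m + 1) t₀) :=
    fun i j => h.volume_le_of_digit_eq (fun t ht => hS ht.1) t₀ (fun t ht => hd t ht.1)
      fun t ht t' ht' => digit_eq_of_column_eq_of_row_eq (ht.2.1.trans ht'.2.1.symm)
        (Nat.cast_injective (ht.2.2.trans ht'.2.2.symm))
  have hP := h.prodBase_pos (m + 1) t₀
  calc volume S ≤ ∑ i ∈ Finset.range (columns w δ (m + 1)),
          ∑ j ∈ Finset.Icc ⌈a i⌉ ⌊a i + l⌋, volume (A i j) :=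
        (measure_mono S_subset).trans <| (measure_biUnion_finset_le _ _).trans <|
          Finset.sum_le_sum fun i _ => measure_biUnion_finset_le _ _
    _ ≤ ∑ i ∈ Finset.range (columns w δ (m + 1)),
          ENNReal.ofReal ((l + 1) * (1 / prodBase lam c w δ (m + 1) t₀)) := by
        refine Finset.sum_le_sum fun i _ => (Finset.sum_le_card_nsmul _ _ _
          fun j _ => volume_A_le i j).trans ?_
        rw [nsmul_eq_mul, ← ENNReal.ofReal_natCast, ← ENNReal.ofReal_mul (Nat.cast_nonneg _)]
        gcongr
        exact card_Icc_ceil_floor_le _ hl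
    _ = _ := by
        rw [Finset.sum_const, nsmul_eq_mul, Finset.card_range, ← ENNReal.ofReal_natCast,
          ← ENNReal.ofReal_mul (Nat.cast_nonneg _), mul_one_div]

theorem volume_le {φ : ℝ → ℂ} {S : Set ℝ} {t₀ : ℝ} (hS : S ⊆ Set.Ico 0 1)
    (hφ : ∀ t ∈ S, Follows lam c w δ t (φ t)) (hr : 0 ≤ r) (ht₀ : t₀ ∈ S)
    (hSr : ∀ t ∈ S, ‖φ t - φ t₀‖ ≤ r) (hm : 2 ^ m * derivNorm lam m (φ t₀) * r < δ)
    (hm' : δ ≤ 2 ^ (m + 1) * derivNorm lam (m + 1) (φ t₀) * r) :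
    volume S ≤ ENNReal.ofReal
      (massConst δ ^ (m + 1) * r / ∏ k ∈ Finset.range m, w (k + 1)) := by
  set z₀ := φ t₀
  set R := 2 ^ (m + 1) * derivNorm lam (m + 1) z₀ * r
  have hR : 0 < R := h.pos.trans_le hm'
  have iter_sub_lt : ∀ t ∈ S, ∀ k ≤ m, ‖iter lam k (φ t) - iter lam k z₀‖ < δ := fun t ht =>
    h.norm_iter_sub_lt (h.mem_stripSet (hφ t₀ ht₀)) (hSr t ht) hm
  have digit_eq : ∀ t ∈ S, ∀ k < m, digit lam c w δ k t = digit lam c w δ k t₀ := fun t ht =>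
    h.digit_eq_of_norm_iter_sub_lt (hφ t ht) (hφ t₀ ht₀) (iter_sub_lt t ht)
  have iter_succ_sub_le : ∀ t ∈ S, ‖iter lam (m + 1) (φ t) - iter lam (m + 1) z₀‖ ≤ R := by
    intro t ht
    have := derivNorm_nonneg (lam := lam) (m + 1) z₀
    refine (norm_iter_sub_le fun k hk =>
      (iter_sub_lt t ht k (by omega)).le.trans (by linarith [h.le_quarter])).trans ?_
    exact mul_le_mul_of_nonneg_left (hSr t ht) (by positivity)
  refine (h.volume_le_of_row_mem_Icc (l := (2 * R + 7) / 16) (by positivity) hS t₀ digit_eq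
    (a := fun i => ((iter lam (m + 1) z₀).im - R - 7 - entryHeight δ
      (innerRadius lam m (corner lam c w δ m t₀)) (c (m + 1) + 2 * δ * i)) / 16)
    fun t ht => ?_).trans ?_
  · rw [← corner_eq_of_digit_eq (digit_eq t ht)]
    refine (hφ t ht).row_mem_Icc ?_
    rw [← Complex.sub_im]
    exact (Complex.abs_im_le_norm _).trans (iter_succ_sub_le t ht)
  · rw [h.columns_mul_div_prodBase_succ]
    exact ENNReal.ofReal_le_ofReal (h.div_prodBase_mul_rows_le (hφ t₀ ht₀) hr hm')

theorem exists_outerMeasure :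
    ∃ ν : OuterMeasure ℂ, ν (stripSet lam c w) = 1 ∧ ∀ (B : Set ℂ) (r : ℝ), 0 < r → r < δ →
      (∀ z ∈ B, ∀ z' ∈ B, ‖z - z'‖ ≤ r) → ν B = 0 ∨ ∃ z ∈ stripSet lam c w, ∃ m,
        2 ^ m * derivNorm lam m z * r < δ ∧ δ ≤ 2 ^ (m + 1) * derivNorm lam (m + 1) z * r ∧
        ν B ≤ ENNReal.ofReal
          (massConst δ ^ (m + 1) * r / ∏ k ∈ Finset.range m, w (k + 1)) := by
  choose! φ hφ using fun t (ht : t ∈ Set.Ico (0 : ℝ) 1) => h.exists_follows ht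
  have φ_mem : ∀ t ∈ Set.Ico (0 : ℝ) 1, φ t ∈ stripSet lam c w := fun t ht =>
    h.mem_stripSet (hφ t ht)
  let ν : OuterMeasure ℂ := OuterMeasure.map φ
    (OuterMeasure.restrict (Set.Ico 0 1) (volume : Measure ℝ).toOuterMeasure)
  have ν_apply : ∀ B, ν B = volume (φ ⁻¹' B ∩ Set.Ico 0 1) := fun B => by
    simp only [ν, OuterMeasure.map_apply, OuterMeasure.restrict_apply, Measure.toOuterMeasure_apply]
  refine ⟨ν, ?_, fun B r hr hrδ hB => ?_⟩
  · rw [ν_apply,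
      Set.inter_eq_right.2 (show Set.Ico 0 1 ⊆ φ ⁻¹' stripSet lam c w from φ_mem),
      Real.volume_Ico, sub_zero, ENNReal.ofReal_one]
  · rw [ν_apply]
    rcases Set.eq_empty_or_nonempty (φ ⁻¹' B ∩ Set.Ico 0 1) with hempty | ⟨t₀, ht₀⟩
    · left
      rw [hempty, measure_empty]
    · right
      obtain ⟨m, hm, hm'⟩ := h.exists_pow_mul_derivNorm_mul_lt_le (φ_mem t₀ ht₀.2) hr hrδ
      exact ⟨φ t₀, φ_mem t₀ ht₀.2, m, hm, hm', h.volume_le Set.inter_subset_right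
        (fun t ht => hφ t ht.2) hr.le ht₀ (fun t ht => hB _ ht.1 _ ht₀.1) hm hm'⟩

end IsStripSystem

end MassBound

section Products

variable {L f α a : ℕ → ℝ} {x z D : ℝ} {N n : ℕ}

theorem log_prod_Ico_one (hf : ∀ n, 0 < f (n + 1)) (n : ℕ) :
    Real.log (∏ i ∈ Finset.Ico 1 (n + 1), f i) = logProd f n := by
  rw [Finset.prod_Ico_eq_prod_range, Nat.add_sub_cancel]
  simp only [add_comm 1]
  rw [Real.log_prod fun k _ => (hf k).ne', logProd]

theorem log_prod_Icc_one (hf : ∀ n, 0 < f (n + 1)) (n : ℕ) :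
    Real.log (∏ i ∈ Finset.Icc 1 n, f i) = logProd f n := by
  rw [← Finset.Ico_add_one_right_eq_Icc, log_prod_Ico_one hf]

theorem logProd_mono (ha : ∀ n, 0 < a (n + 1)) (h : ∀ n, a (n + 1) ≤ α (n + 1)) (n : ℕ) :
    logProd a n ≤ logProd α n :=
  Finset.sum_le_sum fun k _ => Real.log_le_log (ha k) (h k)

theorem logProd_sub_logProd_le (ha : ∀ n, 0 < a (n + 1)) (h : ∀ n ≥ N, a (n + 1) ≤ α (n + 1))
    (hn : N ≤ n) : logProd a n - logProd a N ≤ logProd α n - logProd α N := by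
  induction n, hn using Nat.le_induction with
  | base => simp
  | succ n hn ih =>
    rw [logProd_succ, logProd_succ]
    linarith [Real.log_le_log (ha n) (h n hn)]

theorem tendsto_logProd_div_of_le (ha : ∀ n, 0 < a (n + 1)) (h : ∀ n ≥ N, a (n + 1) ≤ α (n + 1))
    (hL : Tendsto (fun n : ℕ => logProd a n / n) atTop atTop) :
    Tendsto (fun n : ℕ => logProd α n / n) atTop atTop := by
  refine tendsto_atTop_mono' _ ?_
    (hL.atTop_add (tendsto_const_div_atTop_nhds_zero_nat (logProd α N - logProd a N)))
  filter_upwards [eventually_ge_atTop N] with n hn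
  rw [← add_div]
  gcongr
  linarith [logProd_sub_logProd_le ha h hn]

theorem tendsto_logProd_div_of_geom_mean (hf : ∀ n, 0 < f (n + 1))
    (h : Tendsto (fun n : ℕ => (∏ i ∈ Finset.Icc 1 n, f i) ^ (1 / (n : ℝ))) atTop atTop) :
    Tendsto (fun n : ℕ => logProd f n / n) atTop atTop := by
  refine (Real.tendsto_log_atTop.comp h).congr fun n => ?_
  have prod_pos : 0 < ∏ i ∈ Finset.Icc 1 n, f i := Finset.prod_pos fun i hi => by
    simpa only [Nat.sub_add_cancel (Finset.mem_Icc.1 hi).1] using hf (i - 1)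
  rw [Function.comp_apply, Real.log_rpow prod_pos, log_prod_Icc_one hf, one_div_mul_eq_div]

theorem eventually_mul_le (hL : Tendsto (fun n : ℕ => L n / n) atTop atTop) (C : ℝ) :
    ∀ᶠ n : ℕ in atTop, C * n ≤ L n := by
  filter_upwards [hL.eventually_ge_atTop C, eventually_gt_atTop 0] with n hn hn0
  rwa [le_div_iff₀ (Nat.cast_pos.2 hn0)] at hn

theorem neg_abs_log_mul_le_logProd (hD : 0 < D) (hf : ∀ n, D ≤ f (n + 1)) (n : ℕ) :
    -(|Real.log D| * n) ≤ logProd f n := by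
  have := Finset.card_nsmul_le_sum (Finset.range n) (fun k => Real.log (f (k + 1)))
    (-|Real.log D|) fun k _ => (neg_abs_le _).trans (Real.log_le_log hD (hf k))
  rw [Finset.card_range, nsmul_eq_mul] at this
  rw [logProd]
  linarith

theorem eventually_mul_le_logProd_succ (hD : 0 < D) (hf : ∀ n, D ≤ f (n + 1))
    (hL : Tendsto (fun n : ℕ => L n / n) atTop atTop) (hz : z < 0) :
    ∀ᶠ n in atTop, z * L n ≤ logProd f (n + 1) := by
  filter_upwards [eventually_mul_le hL (2 * |Real.log D| / -z), eventually_ge_atTop 1] with n hn hn1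
  have le_logProd := neg_abs_log_mul_le_logProd hD hf (n + 1)
  have : (1 : ℝ) ≤ n := Nat.one_le_cast.2 hn1
  rw [div_mul_eq_mul_div, div_le_iff₀ (by linarith)] at hn
  push_cast at le_logProd
  nlinarith [abs_nonneg (Real.log D)]

theorem add_one_le_pow_mul_exp (hD : 0 < D) (hf : ∀ n, D ≤ f (n + 1)) (hn : 1 ≤ n) (hx : 0 ≤ x)
    (h : logProd f (n + 1) ≤ x) : f (n + 1) + 1 ≤ (2 * Real.exp |Real.log D|) ^ n * Real.exp x := by
  have le_exp : f (n + 1) ≤ Real.exp (|Real.log D| * n + x) := by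
    rw [← Real.log_le_iff_le_exp (hD.trans_le (hf n))]
    rw [logProd_succ] at h
    linarith [neg_abs_log_mul_le_logProd hD hf n]
  have one_le_exp : 1 ≤ Real.exp (|Real.log D| * n + x) := Real.one_le_exp (by positivity)
  calc f (n + 1) + 1 ≤ 2 * Real.exp (|Real.log D| * n + x) := by linarith
    _ ≤ 2 ^ n * Real.exp (|Real.log D| * n + x) := by
        gcongr
        exact le_self_pow₀ one_le_two (by omega)
    _ = (2 * Real.exp |Real.log D|) ^ n * Real.exp x := by
        rw [Real.exp_add, mul_pow, ← Real.exp_nat_mul, mul_comm (n : ℝ), mul_assoc]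

end Products

section Truncation

variable {lam : ℕ → ℂ} {a b : ℕ → ℝ} {x y t τ η D : ℝ} {N n : ℕ}

/-- The sequence `a` with the terms before index `N` replaced by `x`. -/
def truncate (N : ℕ) (x : ℝ) (a : ℕ → ℝ) (n : ℕ) : ℝ := if n < N then x else a n

theorem truncate_of_lt (hn : n < N) (x : ℝ) (a : ℕ → ℝ) : truncate N x a n = x := if_pos hn

theorem truncate_of_le (hn : N ≤ n) (x : ℝ) (a : ℕ → ℝ) : truncate N x a n = a n :=
  if_neg hn.not_gt

theorem le_truncate (hx : η ≤ x) (ha : ∀ n ≥ N, η ≤ a n) (n : ℕ) : η ≤ truncate N x a n := by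
  rcases lt_or_ge n N with hn | hn
  · rwa [truncate_of_lt hn]
  · rw [truncate_of_le hn]
    exact ha n hn

theorem truncate_lt_truncate (hxy : x < y) (hab : a n < b n) :
    truncate N x a n < truncate N y b n := by
  rcases lt_or_ge n N with hn | hn
  · rwa [truncate_of_lt hn, truncate_of_lt hn]
  · rwa [truncate_of_le hn, truncate_of_le hn]

theorem modulus_truncate (hn : N ≤ n) :
    modulus (truncate N x a) (truncate N y b) n = modulus a b n := by
  rw [modulus, modulus, truncate_of_le hn, truncate_of_le hn]

theorem tendsto_logProd_truncate_div (ha : ∀ n, 0 < a (n + 1))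
    (hL : Tendsto (fun n : ℕ => logProd a n / n) atTop atTop) (N : ℕ) (x : ℝ) :
    Tendsto (fun n : ℕ => logProd (truncate N x a) n / n) atTop atTop :=
  tendsto_logProd_div_of_le (N := N) ha
    (fun _ hn => (truncate_of_le (Nat.le_succ_of_le hn) x a).ge) hL

theorem exists_modulus_truncate_add_one_le (ha : ∀ n, 0 < a (n + 1)) (hD : 0 < D)
    (hmod : ∀ n, D ≤ modulus a b (n + 1))
    (hL : Tendsto (fun n : ℕ => logProd a n / n) atTop atTop) (hτ : 0 ≤ τ) (N : ℕ) (x y : ℝ) :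
    ∃ B : ℝ, 0 ≤ B ∧ ∀ᶠ n in atTop, logProd (modulus a b) (n + 1) ≤ τ * logProd a n →
      modulus (truncate N x a) (truncate N y b) (n + 1) + 1 ≤
        B ^ n * Real.exp (τ * logProd (truncate N x a) n) := by
  set C := |logProd a N - logProd (truncate N x a) N|
  refine ⟨2 * Real.exp |Real.log D| * Real.exp (τ * C), by positivity, ?_⟩
  filter_upwards [eventually_ge_atTop N, eventually_ge_atTop 1, eventually_mul_le hL 0]
    with n hn hn1 hn0 hle
  rw [zero_mul] at hn0
  have logProd_le : logProd a n ≤ C + logProd (truncate N x a) n := by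
    linarith [logProd_sub_logProd_le ha (α := truncate N x a)
      (fun k hk => (truncate_of_le (Nat.le_succ_of_le hk) x a).ge) hn,
      le_abs_self (logProd a N - logProd (truncate N x a) N)]
  rw [modulus_truncate (Nat.le_succ_of_le hn)]
  calc modulus a b (n + 1) + 1
      ≤ (2 * Real.exp |Real.log D|) ^ n * Real.exp (τ * logProd a n) :=
        add_one_le_pow_mul_exp hD hmod hn1 (by positivity) hle
    _ ≤ (2 * Real.exp |Real.log D|) ^ n *
          (Real.exp (τ * C) * Real.exp (τ * logProd (truncate N x a) n)) := by
        rw [← Real.exp_add, ← mul_add]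
        gcongr
    _ ≤ (2 * Real.exp |Real.log D|) ^ n *
          (Real.exp (τ * C) ^ n * Real.exp (τ * logProd (truncate N x a) n)) := by
        gcongr
        exact le_self_pow₀ (Real.one_le_exp (by positivity)) (by omega)
    _ = _ := by rw [mul_pow _ (Real.exp (τ * C)), mul_assoc]

/-- The points of norm at most `M` whose orbit obeys the bounds `a`, `b` from index `N` on and
the bounds `1 / (M + 1)`, `M + 2` before. -/
def truncatedRateSet (lam : ℕ → ℂ) (a b : ℕ → ℝ) (N M : ℕ) : Set ℂ :=
  boundedRateSet lam (truncate N (1 / ((M : ℝ) + 1)) a) (truncate N ((M : ℝ) + 2) b) M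

theorem rateSet_subset (hlam : ∀ n, lam (n + 1) ≠ 0) (N₀ : ℕ) :
    rateSet lam a b ⊆ ⋃ i : ℕ × ℕ, truncatedRateSet lam a b (N₀ + i.1) i.2 := by
  intro z hz
  obtain ⟨N, hN⟩ := eventually_atTop.1 hz
  have eventually_bounds : ∀ᶠ M : ℕ in atTop, ‖z‖ ≤ M ∧ ∀ n ∈ Finset.range (N₀ + N),
      1 / ((M : ℝ) + 1) ≤ ‖iter lam (n + 1) z‖ ∧ ‖iter lam (n + 1) z‖ ≤ (M : ℝ) + 2 := by
    have tendsto_cast := tendsto_natCast_atTop_atTop (R := ℝ)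
    refine (tendsto_cast.eventually_ge_atTop ‖z‖).and ((Finset.eventually_all _).2 fun n _ => ?_)
    filter_upwards [tendsto_cast.eventually_ge_atTop ‖iter lam (n + 1) z‖⁻¹,
      tendsto_cast.eventually_ge_atTop ‖iter lam (n + 1) z‖] with M hinv hle
    refine ⟨?_, by linarith⟩
    rw [one_div]
    exact inv_le_of_inv_le₀ (norm_iter_succ_pos (hlam n) z) (by linarith)
  obtain ⟨M, hzM, hM⟩ := eventually_bounds.exists
  refine Set.mem_iUnion.2 ⟨(N, M), hzM, fun n => ?_⟩
  rcases lt_or_ge (n + 1) (N₀ + N) with hn | hn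
  · simp only [truncate_of_lt hn]
    exact hM n (Finset.mem_range.2 (by omega))
  · simp only [truncate_of_le hn]
    exact hN (n + 1) (by omega)

theorem one_div_cast_add_one_le (M : ℕ) : 1 / ((M : ℝ) + 1) ≤ 1 :=
  (div_le_one (by positivity)).2 (by linarith [Nat.cast_nonneg (α := ℝ) M])

theorem one_div_cast_add_one_lt (M : ℕ) : 1 / ((M : ℝ) + 1) < (M : ℝ) + 2 :=
  (one_div_cast_add_one_le M).trans_lt (by linarith [Nat.cast_nonneg (α := ℝ) M])

theorem dimH_truncatedRateSet_le (hlam : ∀ n, lam (n + 1) ≠ 0) (ha : ∀ n, 0 < a (n + 1))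
    (hab : ∀ n, a (n + 1) < b (n + 1)) (hN : ∀ n ≥ N, 1 ≤ a n) (hD : 0 < D)
    (hmod : ∀ n, D ≤ modulus a b (n + 1))
    (hL : Tendsto (fun n : ℕ => logProd a n / n) atTop atTop) (hτ : 0 ≤ τ) (hτt : τ < t)
    {E : ℝ} (hE : 1 ≤ E)
    (hfreq : ∃ᶠ n in atTop, modulus a b (n + 2) ≤ E * a (n + 1) ∨
      logProd (modulus a b) (n + 1) ≤ τ * logProd a n) (M : ℕ) :
    dimH (truncatedRateSet lam a b N M) ≤ ENNReal.ofReal (1 + t) := by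
  obtain ⟨B, hB, modulus_le⟩ := exists_modulus_truncate_add_one_le ha hD hmod hL hτ N
    (1 / ((M : ℝ) + 1)) ((M : ℝ) + 2)
  refine dimH_boundedRateSet_le hlam (by positivity)
    (fun n => le_truncate le_rfl (fun k hk => (one_div_cast_add_one_le M).trans (hN k hk)) (n + 1))
    (fun n => truncate_lt_truncate (one_div_cast_add_one_lt M) (hab n)) (Nat.cast_nonneg _)
    (hτ.trans_lt hτt) (tendsto_logProd_truncate_div ha hL N _) hE hB hτt ?_
  refine (hfreq.and_eventually (modulus_le.and (eventually_ge_atTop N))).mono ?_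
  rintro n ⟨hn | hn, himp, hNn⟩
  · left
    rwa [modulus_truncate (by omega), truncate_of_le (by omega)]
  · exact Or.inr (himp hn)

theorem packingPremeasure_truncatedRateSet_ne_top (hlam : ∀ n, lam (n + 1) ≠ 0)
    (ha : ∀ n, 0 < a (n + 1)) (hab : ∀ n, a (n + 1) < b (n + 1)) (hN : ∀ n ≥ N, 1 ≤ a n)
    (hD : 0 < D) (hmod : ∀ n, D ≤ modulus a b (n + 1))
    (hL : Tendsto (fun n : ℕ => logProd a n / n) atTop atTop) (ht1 : t ≤ 1) (hτ : 0 ≤ τ)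
    (hτt : τ < t)
    (hev : ∀ᶠ n in atTop, logProd (modulus a b) (n + 1) ≤ τ * logProd a n) (M : ℕ) :
    packingPremeasure (1 + t) (truncatedRateSet lam a b N M) ≠ ∞ := by
  obtain ⟨B, -, modulus_le⟩ := exists_modulus_truncate_add_one_le ha hD hmod hL hτ N
    (1 / ((M : ℝ) + 1)) ((M : ℝ) + 2)
  refine packingPremeasure_boundedRateSet_ne_top (B := B) hlam (by positivity)
    (fun n => le_truncate le_rfl (fun k hk => (one_div_cast_add_one_le M).trans (hN k hk)) (n + 1))
    (fun n => (truncate_lt_truncate (one_div_cast_add_one_lt M) (hab n)).le) (Nat.cast_nonneg _)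
    (hτ.trans_lt hτt) ht1 (tendsto_logProd_truncate_div ha hL N _) hτt ?_
  filter_upwards [hev, modulus_le] with n hn himp using himp hn

end Truncation

namespace Assumptions

variable {q Δ A t τ E : ℝ} {lam : ℕ → ℂ} {a b : ℕ → ℝ} (h : Assumptions q Δ A lam a b)
include h

theorem a_succ_pos (n : ℕ) : 0 < a (n + 1) := h.a_pos _ (by omega)

theorem lam_succ_ne_zero (n : ℕ) : lam (n + 1) ≠ 0 := h.lam_ne_zero _ (by omega)

theorem a_lt_b_succ (n : ℕ) : a (n + 1) < b (n + 1) := h.a_lt_b _ (by omega)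

theorem b_succ_pos (n : ℕ) : 0 < b (n + 1) := (h.a_succ_pos n).trans (h.a_lt_b_succ n)

theorem le_modulus_succ (n : ℕ) : Δ ≤ modulus a b (n + 1) := (h.modulus_gt _ (by omega)).le

theorem modulus_succ_pos (n : ℕ) : 0 < modulus a b (n + 1) :=
  modulus_pos (h.a_succ_pos n) (h.a_lt_b_succ n)

theorem tendsto_logProd_div : Tendsto (fun n : ℕ => logProd a n / n) atTop atTop :=
  tendsto_logProd_div_of_geom_mean h.a_succ_pos h.geom_mean

theorem eventually_lt_a : ∀ᶠ n in atTop, A < a n :=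
  (eventually_lt_of_lt_liminf h.liminf_gt).mono fun _ hn => EReal.coe_lt_coe_iff.1 hn

theorem dimH_rateSet_le (hA : 1 ≤ A) (hΔ : 0 < Δ) (hτ : 0 ≤ τ) (hτt : τ < t)
    (hE : 1 ≤ E) (hfreq : ∃ᶠ n in atTop, modulus a b (n + 2) ≤ E * a (n + 1) ∨
      logProd (modulus a b) (n + 1) ≤ τ * logProd a n) :
    dimH (rateSet lam a b) ≤ ENNReal.ofReal (1 + t) := by
  obtain ⟨N₀, hN₀⟩ := eventually_atTop.1 h.eventually_lt_a
  refine (dimH_mono (rateSet_subset h.lam_succ_ne_zero N₀)).trans ?_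
  rw [dimH_iUnion]
  exact iSup_le fun i => dimH_truncatedRateSet_le h.lam_succ_ne_zero h.a_succ_pos h.a_lt_b_succ
    (fun n hn => hA.trans (hN₀ n (by omega)).le) hΔ h.le_modulus_succ h.tendsto_logProd_div hτ
    hτt hE hfreq i.2

theorem dimP_rateSet_le (hA : 1 ≤ A) (hΔ : 0 < Δ) (hτ : 0 ≤ τ) (hτt : τ < t)
    (hev : ∀ᶠ n in atTop, logProd (modulus a b) (n + 1) ≤ τ * logProd a n) :
    dimP (rateSet lam a b) ≤ ENNReal.ofReal (1 + t) := by
  obtain ⟨N₀, hN₀⟩ := eventually_atTop.1 h.eventually_lt_a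
  have cover := rateSet_subset (a := a) (b := b) h.lam_succ_ne_zero N₀
  rcases le_or_gt t 1 with ht1 | ht1
  · exact dimP_le_of_packingPremeasure_ne_top cover fun i =>
      packingPremeasure_truncatedRateSet_ne_top h.lam_succ_ne_zero h.a_succ_pos h.a_lt_b_succ
        (fun n hn => hA.trans (hN₀ n (by omega)).le) hΔ h.le_modulus_succ h.tendsto_logProd_div
        ht1 hτ hτt hev i.2
  · exact (dimP_le_of_packingPremeasure_ne_top (s := 2) cover fun i =>
      packingPremeasure_two_ne_top (Nat.cast_nonneg _) fun z hz => hz.1).trans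
        (ENNReal.ofReal_le_ofReal (by linarith))

end Assumptions

section MassDistribution

variable {X : Type*} [MetricSpace X] {ν : OuterMeasure X} {K δ s : ℝ}

theorem le_mul_ediam_rpow {B : Set X}
    (hν : ∀ r, 0 < r → r < δ → (∀ x ∈ B, ∀ y ∈ B, dist x y ≤ r) →
      ν B ≤ ENNReal.ofReal K * ENNReal.ofReal r ^ s)
    (hδ : 0 < δ) (hB : Metric.ediam B ≤ ENNReal.ofReal (δ / 2)) :
    ν B ≤ ENNReal.ofReal K * Metric.ediam B ^ s := by
  have ediam_ne_top : Metric.ediam B ≠ ∞ := ne_top_of_le_ne_top ENNReal.ofReal_ne_top hB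
  set d := (Metric.ediam B).toReal
  have ediam_eq : Metric.ediam B = ENNReal.ofReal d := (ENNReal.ofReal_toReal ediam_ne_top).symm
  have hd : 0 ≤ d := ENNReal.toReal_nonneg
  have hdδ : d < δ := by
    rw [ediam_eq, ENNReal.ofReal_le_ofReal_iff (by linarith)] at hB
    linarith
  have continuous_bound :
      Continuous fun r : ℝ => ENNReal.ofReal K * ENNReal.ofReal r ^ s :=
    (ENNReal.continuous_const_mul ENNReal.ofReal_ne_top).comp
      (ENNReal.continuous_rpow_const.comp ENNReal.continuous_ofReal)
  rw [ediam_eq]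
  refine ge_of_tendsto
    ((continuous_bound.tendsto d).mono_left (nhdsWithin_le_nhds (s := Set.Ioi d))) ?_
  filter_upwards [Ioo_mem_nhdsGT hdδ] with r hr
  have ediam_le : Metric.ediam B ≤ ENNReal.ofReal r :=
    ediam_eq.trans_le (ENNReal.ofReal_le_ofReal hr.1.le)
  refine hν r (hd.trans_lt hr.1) hr.2 fun x hx y hy => ?_
  rw [← ENNReal.ofReal_le_ofReal_iff (hd.trans hr.1.le), ← edist_dist]
  exact (Metric.edist_le_ediam_of_mem hx hy).trans ediam_le

theorem le_dimH_of_outerMeasure_le {s : ℝ≥0} {E : Set X} (hK : 0 < K) (hδ : 0 < δ)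
    (hν : ∀ (B : Set X) (r : ℝ), 0 < r → r < δ → (∀ x ∈ B, ∀ y ∈ B, dist x y ≤ r) →
      ν B ≤ ENNReal.ofReal K * ENNReal.ofReal r ^ (s : ℝ))
    (hE : ν E ≠ 0) : s ≤ dimH E := by
  borelize X
  have le_mkMetric : ν ≤ OuterMeasure.mkMetric (ENNReal.ofReal K • fun x => x ^ (s : ℝ)) :=
    OuterMeasure.le_mkMetric _ ν (ENNReal.ofReal (δ / 2)) (by simpa using hδ) fun B hB =>
      le_mul_ediam_rpow (hν B) hδ hB
  refine le_dimH_of_hausdorffMeasure_ne_zero fun hausdorff_eq_zero => hE ?_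
  rw [Measure.hausdorffMeasure, ← OuterMeasure.coe_mkMetric] at hausdorff_eq_zero
  rw [OuterMeasure.mkMetric_smul _ ENNReal.ofReal_ne_top (by simpa using hK)] at le_mkMetric
  refine le_antisymm ((le_mkMetric E).trans_eq ?_) zero_le
  rw [_root_.smul_apply, hausdorff_eq_zero, smul_zero]

end MassDistribution

section StripDimension

variable {lam : ℕ → ℂ} {c w : ℕ → ℝ} {δ r C ε σ : ℝ} {n m : ℕ} {z : ℂ}

/-- The inner radius of the annulus of level `n ≥ 1` of a system of strips, that is, of the image of
the strip of index `n - 1`. -/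
noncomputable def stripLower (lam : ℕ → ℂ) (c : ℕ → ℝ) (n : ℕ) : ℝ :=
  ‖lam n‖ * Real.exp (c (n - 1))

/-- The outer radius of the annulus of level `n ≥ 1` of a system of strips. -/
noncomputable def stripUpper (lam : ℕ → ℂ) (c w : ℕ → ℝ) (n : ℕ) : ℝ :=
  ‖lam n‖ * Real.exp (c (n - 1) + w (n - 1))

theorem massConst_pos (hδ : 0 < δ) : 0 < massConst δ := by
  rw [massConst]
  positivity

theorem derivNorm_le_prod_stripUpper (hz : z ∈ stripSet lam c w) (n : ℕ) :
    derivNorm lam n z ≤ ∏ k ∈ Finset.range n, stripUpper lam c w (k + 1) := by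
  refine Finset.prod_le_prod (fun k _ => norm_nonneg _) fun k _ => ?_
  rw [norm_iter_succ, stripUpper, add_tsub_cancel_right]
  gcongr
  exact (hz k).2

namespace IsStripSystem

variable (h : IsStripSystem lam c w δ)
include h

theorem stripLower_pos (n : ℕ) : 0 < stripLower lam c (n + 1) :=
  mul_pos (norm_pos_iff.2 (h.lam_ne_zero n)) (Real.exp_pos _)

theorem two_le_stripUpper (n : ℕ) : 2 ≤ stripUpper lam c w (n + 1) := by
  have hδ := h.pos
  calc 2 ≤ 64 / δ := by
        rw [le_div_iff₀ hδ]
        linarith [h.le_quarter]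
    _ ≤ ‖lam (n + 1)‖ * Real.exp (c n) := h.le_norm n
    _ ≤ stripUpper lam c w (n + 1) := by
        rw [stripUpper, add_tsub_cancel_right]
        gcongr
        linarith [h.width_pos n]

theorem one_le_prod_stripUpper (n : ℕ) :
    1 ≤ ∏ k ∈ Finset.range n, stripUpper lam c w (k + 1) :=
  Finset.one_le_prod fun k _ => by linarith [h.two_le_stripUpper k]

theorem exp_logProd_le_derivNorm (hz : z ∈ stripSet lam c w) (n : ℕ) :
    Real.exp (logProd (stripLower lam c) n) ≤ derivNorm lam n z := by
  rw [exp_logProd h.stripLower_pos]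
  refine Finset.prod_le_prod (fun k _ => (h.stripLower_pos k).le) fun k _ => ?_
  rw [norm_iter_succ, stripLower, add_tsub_cancel_right]
  gcongr
  exact (hz k).1

theorem one_le_one_div_two_mul : 1 ≤ 1 / (2 * δ) := by
  have hδ := h.pos
  rw [one_le_div (by positivity)]
  linarith [h.le_quarter]

theorem inv_prod_width_le (hnm : n ≤ m) :
    (∏ k ∈ Finset.range m, w (k + 1))⁻¹ ≤
      (1 / (2 * δ)) ^ m * (∏ k ∈ Finset.range n, w (k + 1))⁻¹ := by
  have hδ := h.pos
  have prod_pos := h.prod_width_pos n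
  induction m, hnm using Nat.le_induction with
  | base => exact le_mul_of_one_le_left (by positivity) (one_le_pow₀ h.one_le_one_div_two_mul)
  | succ m _ ih =>
    have width_pos := h.width_pos (m + 1)
    have inv_width_le : (w (m + 1))⁻¹ ≤ 1 / (2 * δ) := by
      rw [one_div]
      gcongr
      exact h.two_mul_le (m + 1)
    rw [Finset.prod_range_succ, mul_inv]
    calc _ ≤ ((1 / (2 * δ)) ^ m * (∏ k ∈ Finset.range n, w (k + 1))⁻¹) * (1 / (2 * δ)) := by
          gcongr
      _ = _ := by rw [pow_succ]; ring

theorem massConst_pow_mul_div_le (hr : 0 ≤ r) (hnm : n ≤ m) :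
    massConst δ ^ (m + 1) * r / ∏ k ∈ Finset.range m, w (k + 1) ≤
      massConst δ * r * (massConst δ * (1 / (2 * δ))) ^ m *
        (∏ k ∈ Finset.range n, w (k + 1))⁻¹ := by
  have massConst_pos := massConst_pos h.pos
  calc massConst δ ^ (m + 1) * r / ∏ k ∈ Finset.range m, w (k + 1)
      = massConst δ ^ (m + 1) * r * (∏ k ∈ Finset.range m, w (k + 1))⁻¹ := div_eq_mul_inv _ _
    _ ≤ massConst δ ^ (m + 1) * r *
          ((1 / (2 * δ)) ^ m * (∏ k ∈ Finset.range n, w (k + 1))⁻¹) := by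
        gcongr
        exact h.inv_prod_width_le hnm
    _ = _ := by ring

theorem le_exp_neg_logProd (hz : z ∈ stripSet lam c w) (hr : 0 ≤ r)
    (hm : 2 ^ m * derivNorm lam m z * r < δ) : r ≤ Real.exp (-logProd (stripLower lam c) m) := by
  have exp_mul_le_one : Real.exp (logProd (stripLower lam c) m) * r ≤ 1 := by
    calc _ ≤ derivNorm lam m z * r := by
          gcongr
          exact h.exp_logProd_le_derivNorm hz m
      _ ≤ 2 ^ m * derivNorm lam m z * r := by
          gcongr
          exact le_mul_of_one_le_left (derivNorm_nonneg _ _) (one_le_pow₀ one_le_two)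
      _ ≤ 1 := by linarith [h.le_quarter]
  rwa [Real.exp_neg, ← one_div, le_div_iff₀ (Real.exp_pos _), mul_comm]

theorem exists_pow_le_mul_rpow
    (hL : Tendsto (fun n : ℕ => logProd (stripLower lam c) n / n) atTop atTop) (hε : 0 < ε)
    (hC : 0 ≤ C) : ∃ K, 0 < K ∧ ∀ z ∈ stripSet lam c w, ∀ (m : ℕ) (r : ℝ), 0 < r →
      2 ^ m * derivNorm lam m z * r < δ → C ^ m ≤ K * r ^ (-ε) := by
  obtain ⟨K, hK⟩ := (tendsto_pow_mul_exp hL hε hC).bddAbove_range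
  have pow_mul_exp_le : ∀ n, C ^ n * Real.exp (-ε * logProd (stripLower lam c) n) ≤ max K 1 :=
    fun n => (hK ⟨n, rfl⟩).trans (le_max_left _ _)
  refine ⟨max K 1, by positivity, fun z hz m r hr hm => ?_⟩
  have exp_le_rpow : Real.exp (ε * logProd (stripLower lam c) m) ≤ r ^ (-ε) := by
    calc Real.exp (ε * logProd (stripLower lam c) m)
        = Real.exp (-logProd (stripLower lam c) m) ^ (-ε) := by
          rw [← Real.exp_mul]
          congr 1
          ring
      _ ≤ r ^ (-ε) := Real.rpow_le_rpow_of_nonpos hr (h.le_exp_neg_logProd hz hr.le hm)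
          (by linarith)
  have pow_le := pow_mul_exp_le m
  rw [neg_mul, Real.exp_neg, ← div_eq_mul_inv, div_le_iff₀ (Real.exp_pos _)] at pow_le
  exact pow_le.trans (by gcongr)

theorem one_le_dimH (hL : Tendsto (fun n : ℕ => logProd (stripLower lam c) n / n) atTop atTop) :
    1 ≤ dimH (stripSet lam c w) := by
  obtain ⟨ν, ν_stripSet, hν⟩ := h.exists_outerMeasure
  have hδ := h.pos
  have massConst_pos := massConst_pos hδ
  refine le_of_forall_lt fun s' hs' => ?_
  obtain ⟨s, hs's, hs⟩ := exists_between hs'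
  lift s to ℝ≥0 using hs.ne_top
  have hs1 : (s : ℝ) < 1 := by exact_mod_cast hs
  obtain ⟨K, hK, pow_le⟩ := h.exists_pow_le_mul_rpow hL (sub_pos.2 hs1)
    (C := massConst δ * (1 / (2 * δ))) (by positivity)
  refine hs's.trans_le (le_dimH_of_outerMeasure_le (mul_pos massConst_pos hK) hδ
    (fun B r hr hrδ hB => ?_) (ν_stripSet.trans_ne one_ne_zero))
  rcases hν B r hr hrδ fun z hz z' hz' => (dist_eq_norm z z').ge.trans (hB z hz z' hz')
    with hzero | ⟨z, hz, m, hm, -, hle⟩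
  · exact hzero.trans_le zero_le
  · refine hle.trans ?_
    rw [ENNReal.ofReal_rpow_of_pos hr, ← ENNReal.ofReal_mul (by positivity)]
    refine ENNReal.ofReal_le_ofReal ?_
    calc massConst δ ^ (m + 1) * r / ∏ k ∈ Finset.range m, w (k + 1)
        ≤ massConst δ * r * (massConst δ * (1 / (2 * δ))) ^ m := by
          simpa using h.massConst_pow_mul_div_le hr.le (Nat.zero_le m)
      _ ≤ massConst δ * r * (K * r ^ (-(1 - (s : ℝ)))) := by
          gcongr
          exact pow_le z hz m r hr hm
      _ = massConst δ * K * (r ^ (1 : ℝ) * r ^ (-(1 - (s : ℝ)))) := by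
          rw [Real.rpow_one]
          ring
      _ = massConst δ * K * r ^ (s : ℝ) := by
          rw [← Real.rpow_add hr]
          congr 2
          ring

theorem le_of_prod_stripUpper_mul_lt (hz : z ∈ stripSet lam c w) (hr : 0 ≤ r)
    (hn : 2 ^ n * (∏ k ∈ Finset.range n, stripUpper lam c w (k + 1)) * r < δ)
    (hm : δ ≤ 2 ^ (m + 1) * derivNorm lam (m + 1) z * r) : n ≤ m := by
  by_contra! hmn
  refine (hn.trans_le hm).not_ge ?_
  gcongr ?_ * r
  calc 2 ^ (m + 1) * derivNorm lam (m + 1) z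
      ≤ 2 ^ n * derivNorm lam n z := h.monotone_pow_mul_derivNorm hz hmn
    _ ≤ _ := by
        gcongr
        exact derivNorm_le_prod_stripUpper hz n

theorem exists_massConst_pow_mul_div_le
    (hL : Tendsto (fun n : ℕ => logProd (stripLower lam c) n / n) atTop atTop) (hε : 0 < ε)
    {K₀ E : ℝ} (hK₀ : 0 < K₀) (hE : 1 ≤ E) :
    ∃ K, 0 < K ∧ ∀ (n m : ℕ) (r : ℝ), ∀ z ∈ stripSet lam c w, 0 < r →
      2 ^ n * (∏ k ∈ Finset.range n, stripUpper lam c w (k + 1)) * r = δ / 2 →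
      (2 ^ n * ∏ k ∈ Finset.range n, stripUpper lam c w (k + 1)) ^ σ ≤
        K₀ * E ^ n * ∏ k ∈ Finset.range n, w (k + 1) →
      2 ^ m * derivNorm lam m z * r < δ → δ ≤ 2 ^ (m + 1) * derivNorm lam (m + 1) z * r →
      massConst δ ^ (m + 1) * r / ∏ k ∈ Finset.range m, w (k + 1) ≤ K * r ^ (1 + σ - ε) := by
  have hδ := h.pos
  have massConst_pos := massConst_pos hδ
  obtain ⟨K, hK, pow_le⟩ := h.exists_pow_le_mul_rpow hL hε
    (C := massConst δ * (1 / (2 * δ)) * E) (by positivity)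
  refine ⟨massConst δ * K₀ * (2 / δ) ^ σ * K, by positivity,
    fun n m r z hz hr scale_eq hn hm hm' => ?_⟩
  have hnm : n ≤ m := h.le_of_prod_stripUpper_mul_lt hz hr.le (by linarith) hm'
  have inv_prod_le :
      (∏ k ∈ Finset.range n, w (k + 1))⁻¹ ≤ K₀ * E ^ m * ((2 / δ) ^ σ * r ^ σ) := by
    have prod_eq : 2 ^ n * ∏ k ∈ Finset.range n, stripUpper lam c w (k + 1) = (2 / δ * r)⁻¹ := by
      rw [eq_div_of_mul_eq hr.ne' scale_eq]
      field_simp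
    rw [prod_eq, Real.inv_rpow (by positivity), Real.mul_rpow (by positivity) hr.le,
      inv_le_iff_one_le_mul₀ (by positivity)] at hn
    rw [inv_le_iff_one_le_mul₀ (h.prod_width_pos n)]
    have prod_nonneg := (h.prod_width_pos n).le
    calc 1 ≤ K₀ * E ^ n * ((2 / δ) ^ σ * r ^ σ) * ∏ k ∈ Finset.range n, w (k + 1) := by linarith
      _ ≤ _ := by gcongr
  calc massConst δ ^ (m + 1) * r / ∏ k ∈ Finset.range m, w (k + 1)
      ≤ massConst δ * r * (massConst δ * (1 / (2 * δ))) ^ m *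
          (∏ k ∈ Finset.range n, w (k + 1))⁻¹ := h.massConst_pow_mul_div_le hr.le hnm
    _ ≤ massConst δ * r * (massConst δ * (1 / (2 * δ))) ^ m *
          (K₀ * E ^ m * ((2 / δ) ^ σ * r ^ σ)) := by gcongr
    _ = massConst δ * K₀ * (2 / δ) ^ σ * (r * r ^ σ) *
          (massConst δ * (1 / (2 * δ)) * E) ^ m := by ring
    _ ≤ massConst δ * K₀ * (2 / δ) ^ σ * (r * r ^ σ) * (K * r ^ (-ε)) := by
        gcongr
        exact pow_le z hz m r hr hm
    _ = massConst δ * K₀ * (2 / δ) ^ σ * K * (r ^ (1 : ℝ) * r ^ σ * r ^ (-ε)) := by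
        rw [Real.rpow_one]
        ring
    _ = _ := by rw [← Real.rpow_add hr, ← Real.rpow_add hr, ← sub_eq_add_neg]

theorem exists_scale (n : ℕ) : ∃ r, 0 < r ∧ r ≤ (1 / 2) ^ n ∧
    2 ^ n * (∏ k ∈ Finset.range n, stripUpper lam c w (k + 1)) * r = δ / 2 := by
  have hδ := h.pos
  have one_le_prod := h.one_le_prod_stripUpper n
  set P := ∏ k ∈ Finset.range n, stripUpper lam c w (k + 1)
  refine ⟨δ / 2 / (2 ^ n * P), by positivity, ?_, mul_div_cancel₀ _ (by positivity)⟩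
  rw [one_div_pow]
  gcongr
  · linarith [h.le_quarter]
  · exact le_mul_of_one_le_right (by positivity) one_le_prod

theorem le_dimP (hL : Tendsto (fun n : ℕ => logProd (stripLower lam c) n / n) atTop atTop)
    {K₀ E : ℝ} (hK₀ : 0 < K₀) (hE : 1 ≤ E)
    (hfreq : ∃ᶠ n in atTop, (2 ^ n * ∏ k ∈ Finset.range n, stripUpper lam c w (k + 1)) ^ σ ≤
      K₀ * E ^ n * ∏ k ∈ Finset.range n, w (k + 1)) :
    ENNReal.ofReal (1 + σ) ≤ dimP (stripSet lam c w) := by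
  obtain ⟨ν, ν_stripSet, hν⟩ := h.exists_outerMeasure
  refine le_of_forall_lt fun x hx => ?_
  obtain ⟨s, hxs, hs⟩ := exists_between ((ENNReal.lt_ofReal_iff_toReal_lt hx.ne_top).1 hx)
  refine ((ENNReal.lt_ofReal_iff_toReal_lt hx.ne_top).2 hxs).trans_le
    (le_dimP_of_packingMeasure_ne_zero fun packing_eq_zero => ?_)
  obtain ⟨K, hK, mass_le⟩ :=
    h.exists_massConst_pow_mul_div_le (σ := σ) hL (sub_pos.2 hs) hK₀ hE
  have ν_le := outerMeasure_le_mul_packingMeasure (s := s) (K := K * 2 ^ s) (by positivity) ν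
    ?_ (stripSet lam c w)
  · rw [ν_stripSet, packing_eq_zero, mul_zero] at ν_le
    exact absurd ν_le (by simp)
  intro δ' hδ'
  have eventually_small : ∀ᶠ n : ℕ in atTop, (1 / 2 : ℝ) ^ n ≤ δ' :=
    (tendsto_pow_atTop_nhds_zero_of_lt_one (by norm_num) (by norm_num)).eventually_le_const hδ'
  obtain ⟨n, hn, hnδ'⟩ := (hfreq.and_eventually eventually_small).exists
  obtain ⟨r, hr, hr_le, scale_eq⟩ := h.exists_scale n
  have hrδ : r < δ := by
    have : 1 ≤ 2 ^ n * ∏ k ∈ Finset.range n, stripUpper lam c w (k + 1) :=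
      one_le_mul_of_one_le_of_one_le (one_le_pow₀ one_le_two) (h.one_le_prod_stripUpper n)
    nlinarith [h.pos]
  refine ⟨r / 4, by positivity, by linarith, fun B hB => ?_⟩
  rcases hν B r hr hrδ fun z hz z' hz' => by rw [← dist_eq_norm]; linarith [hB z hz z' hz']
    with hzero | ⟨z, hz, m, hm, hm', hle⟩
  · exact hzero.trans_le zero_le
  · refine hle.trans ?_
    rw [ENNReal.ofReal_rpow_of_pos (by positivity), ← ENNReal.ofReal_mul (by positivity)]
    refine ENNReal.ofReal_le_ofReal ((mass_le n m r z hz hr scale_eq hn hm hm').trans_eq ?_)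
    rw [sub_sub_cancel, mul_assoc, ← Real.mul_rpow zero_le_two (by positivity)]
    congr 2
    ring

theorem one_le_dimP (hL : Tendsto (fun n : ℕ => logProd (stripLower lam c) n / n) atTop atTop) :
    1 ≤ dimP (stripSet lam c w) := by
  have one_le_mul_prod : ∀ n, 1 ≤ (1 / (2 * δ)) ^ n * ∏ k ∈ Finset.range n, w (k + 1) := fun n => by
    simpa [inv_le_iff_one_le_mul₀ (h.prod_width_pos n)] using h.inv_prod_width_le (Nat.zero_le n)
  simpa using h.le_dimP hL (σ := 0) one_pos h.one_le_one_div_two_mul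
    (Eventually.of_forall fun n => by simpa using one_le_mul_prod n).frequently

end IsStripSystem

end StripDimension

section Construction

variable {lam : ℕ → ℂ} {a b c w : ℕ → ℝ} {q δ x M : ℝ} {N n : ℕ}

theorem norm_mul_exp_log_div {l : ℂ} (hl : l ≠ 0) (hx : 0 < x) :
    ‖l‖ * Real.exp (Real.log (x / ‖l‖)) = x := by
  have norm_pos := norm_pos_iff.2 hl
  rw [Real.exp_log (by positivity), mul_div_cancel₀ _ norm_pos.ne']

/-- The conditions of a system of strips which concern the step from level `n` to `n + 1`. -/
structure IsStripStep (lam : ℕ → ℂ) (c w : ℕ → ℝ) (δ : ℝ) (n : ℕ) : Prop where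
  two_mul_le : 2 * δ ≤ w n
  le_norm : 64 / δ ≤ ‖lam (n + 1)‖ * Real.exp (c n)
  neg_le : -(‖lam (n + 1)‖ * Real.exp (c n)) ≤ c (n + 1)
  add_le : c (n + 1) + w (n + 1) ≤ ‖lam (n + 1)‖ * Real.exp (c n)

theorem IsStripStep.congr {c' w' : ℕ → ℝ} (h : IsStripStep lam c w δ n) (hc : c' n = c n)
    (hc' : c' (n + 1) = c (n + 1)) (hw : w' n = w n) (hw' : w' (n + 1) = w (n + 1)) :
    IsStripStep lam c' w' δ n :=
  ⟨by rw [hw]; exact h.two_mul_le, by rw [hc]; exact h.le_norm,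
    by rw [hc, hc']; exact h.neg_le, by rw [hc, hc', hw']; exact h.add_le⟩

/-- A step is possible into any strip: the preceding strip can be moved so far to the right that
the exponential image of its left edge is a circle enclosing the relevant part of the target. -/
theorem exists_isStripStep_update (hδ : 0 < δ) (hlam : lam (N + 1) ≠ 0) (c w : ℕ → ℝ) :
    ∃ x, IsStripStep lam (Function.update c N x) (Function.update w N (2 * δ)) δ N := by
  set R : ℝ := max (64 / δ) (|c (N + 1)| + |w (N + 1)|)
  have le_R : |c (N + 1)| + |w (N + 1)| ≤ R := le_max_right _ _
  have norm_mul_exp_eq := norm_mul_exp_log_div hlam (x := R) (lt_max_of_lt_left (by positivity))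
  refine ⟨Real.log (R / ‖lam (N + 1)‖), ?_, ?_, ?_, ?_⟩ <;>
    simp only [Function.update_self, Function.update_of_ne N.succ_ne_self, norm_mul_exp_eq]
  · exact le_rfl
  · exact le_max_left _ _
  · linarith [neg_abs_le (c (N + 1)), abs_nonneg (w (N + 1))]
  · linarith [le_abs_self (c (N + 1)), le_abs_self (w (N + 1))]

theorem exists_isStripSystem_of_isStripStep (hδ : 0 < δ) (hδ' : δ ≤ 1 / 4)
    (hlam : ∀ n, lam (n + 1) ≠ 0) (N : ℕ) (c w : ℕ → ℝ)
    (h : ∀ n ≥ N, IsStripStep lam c w δ n) :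
    ∃ c' w', IsStripSystem lam c' w' δ ∧ ∀ n ≥ N, c' n = c n ∧ w' n = w n := by
  induction N generalizing c w with
  | zero =>
    exact ⟨c, w, ⟨hδ, hδ', hlam, fun n => (h n n.zero_le).two_mul_le,
      fun n => (h n n.zero_le).le_norm, fun n => (h n n.zero_le).neg_le,
      fun n => (h n n.zero_le).add_le⟩, fun n _ => ⟨rfl, rfl⟩⟩
  | succ N ih =>
    obtain ⟨x, step_N⟩ := exists_isStripStep_update hδ (hlam N) c w
    have update_eq : ∀ (f : ℕ → ℝ) (y : ℝ), ∀ n ≥ N + 1, Function.update f N y n = f n :=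
      fun f y n hn => Function.update_of_ne (by omega) _ _
    obtain ⟨c', w', hsys, heq⟩ := ih (Function.update c N x) (Function.update w N (2 * δ)) <| by
      intro n hn
      rcases hn.lt_or_eq with hn | rfl
      · exact (h n hn).congr (update_eq c x n hn) (update_eq c x (n + 1) (by omega))
          (update_eq w (2 * δ) n hn) (update_eq w (2 * δ) (n + 1) (by omega))
      · exact step_N
    exact ⟨c', w', hsys, fun n hn => ⟨(heq n (by omega)).1.trans (update_eq c x n hn),
      (heq n (by omega)).2.trans (update_eq w (2 * δ) n hn)⟩⟩

/-- The left edge of a strip which `E_{lam (n + 1)}` maps into the complement of the disc of radius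
`a (n + 1)`, placed no further to the left than the previous annulus reaches. -/
noncomputable def rateLeft (lam : ℕ → ℂ) (a : ℕ → ℝ) (n : ℕ) : ℝ :=
  max (Real.log (a (n + 1) / ‖lam (n + 1)‖)) (-a n)

/-- The width of the strip with left edge `rateLeft lam a n`, chosen so that the strip meets
`a n ≤ ‖z‖ ≤ b n` and is mapped into the disc of radius `b (n + 1)`. -/
noncomputable def rateWidth (q : ℝ) (a b : ℕ → ℝ) (n : ℕ) : ℝ :=
  min (modulus a b (n + 1)) ((1 - q) * a n)

theorem le_norm_mul_exp_rateLeft (hlam : lam (n + 1) ≠ 0) (ha : 0 < a (n + 1)) :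
    a (n + 1) ≤ ‖lam (n + 1)‖ * Real.exp (rateLeft lam a n) := by
  calc a (n + 1) = ‖lam (n + 1)‖ * Real.exp (Real.log (a (n + 1) / ‖lam (n + 1)‖)) :=
        (norm_mul_exp_log_div hlam ha).symm
    _ ≤ ‖lam (n + 1)‖ * Real.exp (rateLeft lam a n) := by
        gcongr
        exact le_max_left _ _

theorem rateLeft_add_rateWidth_le (hlam : lam (n + 1) ≠ 0) (ha : 0 < a (n + 1)) (hq : 0 ≤ q)
    (han : 0 ≤ a n) (hadm : a (n + 1) ≤ ‖lam (n + 1)‖ * Real.exp (q * a n)) :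
    rateLeft lam a n + rateWidth q a b n ≤ a n := by
  have norm_pos := norm_pos_iff.2 hlam
  have rateLeft_le : rateLeft lam a n ≤ q * a n := by
    refine max_le ?_ (by linarith [mul_nonneg hq han])
    rwa [Real.log_le_iff_le_exp (div_pos ha norm_pos), div_le_iff₀ norm_pos, mul_comm]
  have rateWidth_le : rateWidth q a b n ≤ (1 - q) * a n := min_le_right _ _
  linarith

theorem norm_mul_exp_rateLeft_add_rateWidth_le (hlam : lam (n + 1) ≠ 0) (ha : 0 < a (n + 1))
    (hb : 0 < b (n + 1)) (hadm : ‖lam (n + 1)‖ * Real.exp (-(q * a n)) ≤ b (n + 1)) :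
    ‖lam (n + 1)‖ * Real.exp (rateLeft lam a n + rateWidth q a b n) ≤ b (n + 1) := by
  rcases max_choice (Real.log (a (n + 1) / ‖lam (n + 1)‖)) (-a n) with hmax | hmax
  · calc ‖lam (n + 1)‖ * Real.exp (rateLeft lam a n + rateWidth q a b n)
        ≤ ‖lam (n + 1)‖ * Real.exp
            (Real.log (a (n + 1) / ‖lam (n + 1)‖) + modulus a b (n + 1)) := by
          rw [rateLeft, hmax]
          gcongr
          exact min_le_left _ _
      _ = a (n + 1) * (b (n + 1) / a (n + 1)) := by
          rw [Real.exp_add, ← mul_assoc, norm_mul_exp_log_div hlam ha, modulus,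
            Real.exp_log (div_pos hb ha)]
      _ = b (n + 1) := mul_div_cancel₀ _ ha.ne'
  · refine le_trans ?_ hadm
    have rateWidth_le : rateWidth q a b n ≤ (1 - q) * a n := min_le_right _ _
    rw [rateLeft, hmax]
    gcongr
    linarith

theorem mul_modulus_le_rateWidth (hq : 0 ≤ q) (hq1 : q ≤ 1) (hM : 1 ≤ M)
    (hmod : 0 ≤ modulus a b (n + 1)) (hle : modulus a b (n + 1) ≤ M * a n) :
    (1 - q) / M * modulus a b (n + 1) ≤ rateWidth q a b n := by
  have hM0 : 0 < M := one_pos.trans_le hM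
  refine le_min (mul_le_of_le_one_left hmod ((div_le_one hM0).2 (by linarith))) ?_
  rw [div_mul_eq_mul_div, div_le_iff₀ hM0, mul_assoc, mul_comm (a n)]
  exact mul_le_mul_of_nonneg_left hle (by linarith)

theorem stripSet_subset_rateSet (hlow : ∀ n ≥ N, a (n + 1) ≤ stripLower lam c (n + 1))
    (hupp : ∀ n ≥ N, stripUpper lam c w (n + 1) ≤ b (n + 1)) :
    stripSet lam c w ⊆ rateSet lam a b := by
  refine fun z hz => eventually_atTop.2 ⟨N + 1, fun n hn => ?_⟩
  obtain ⟨k, rfl⟩ := Nat.exists_eq_add_of_le' (show 1 ≤ n by omega)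
  rw [norm_iter_succ]
  constructor
  · refine (hlow k (by omega)).trans ?_
    rw [stripLower, add_tsub_cancel_right]
    gcongr
    exact (hz k).1
  · refine le_trans ?_ (hupp k (by omega))
    rw [stripUpper, add_tsub_cancel_right]
    gcongr
    exact (hz k).2

theorem logProd_const_mul_succ {f : ℕ → ℝ} {κ : ℝ} (hκ : κ ≠ 0) (hf : ∀ n, f (n + 1) ≠ 0) (n : ℕ) :
    logProd (fun k => κ * f (k + 1)) n = n * Real.log κ + logProd f (n + 1) - Real.log (f 1) := by
  rw [logProd, logProd, Finset.sum_range_succ',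
    Finset.sum_congr rfl fun k _ => Real.log_mul hκ (hf (k + 1)), Finset.sum_add_distrib,
    Finset.sum_const, Finset.card_range, nsmul_eq_mul]
  ring

theorem IsStripSystem.le_dimP_of_logProd_le (h : IsStripSystem lam c w δ)
    (hL : Tendsto (fun n : ℕ => logProd (stripLower lam c) n / n) atTop atTop) {σ K E : ℝ}
    (hσ : 0 ≤ σ) (hE : 0 ≤ E)
    (hfreq : ∃ᶠ n in atTop, σ * logProd (stripUpper lam c w) n ≤ K + E * n + logProd w n) :
    ENNReal.ofReal (1 + σ) ≤ dimP (stripSet lam c w) := by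
  refine h.le_dimP hL (K₀ := Real.exp K) (E := Real.exp (σ * Real.log 2 + E)) (Real.exp_pos _)
    (Real.one_le_exp (by positivity)) (hfreq.mono fun n hn => ?_)
  rw [← exp_logProd fun n => two_pos.trans_le (h.two_le_stripUpper n),
    ← exp_logProd fun n => h.width_pos (n + 1), ← Real.exp_nat_mul,
    ← Real.exp_log (show (0 : ℝ) < 2 ^ n by positivity), Real.log_pow, ← Real.exp_add,
    ← Real.exp_add, ← Real.exp_add, ← Real.exp_mul]
  refine Real.exp_le_exp.2 ?_
  linarith

end Construction

namespace Assumptions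

variable {q Δ A δ : ℝ} {lam : ℕ → ℂ} {a b : ℕ → ℝ} (h : Assumptions q Δ A lam a b)
  (hq0 : 0 < q) (hq1 : q < 1) (hδ : 0 < δ) (hδ' : δ ≤ 1 / 4) (hδΔ : 2 * δ ≤ Δ)
  (hA : 64 / δ ≤ A) (hA' : 2 * δ / (1 - q) ≤ A)
include h hq0 hq1 hδΔ hA hA'

theorem eventually_isStripStep : ∀ᶠ n in atTop,
    IsStripStep lam (rateLeft lam a) (rateWidth q a b) δ n := by
  obtain ⟨N, hN⟩ := eventually_atTop.1 (h.eventually_lt_a.and h.admissible)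
  filter_upwards [eventually_ge_atTop N, h.eventually_lt_a] with n hn hAn
  have le_norm := le_norm_mul_exp_rateLeft (h.lam_succ_ne_zero n) (h.a_succ_pos n)
  obtain ⟨hA_succ, hadm, -⟩ := hN (n + 1) (by omega)
  refine ⟨le_min (hδΔ.trans (h.le_modulus_succ n)) ?_, ?_, ?_, ?_⟩
  · rw [← div_le_iff₀' (by linarith)]
    exact hA'.trans hAn.le
  · exact (hA.trans hA_succ.le).trans le_norm
  · exact (neg_le_neg le_norm).trans (le_max_right _ _)
  · exact (rateLeft_add_rateWidth_le (h.lam_succ_ne_zero (n + 1)) (h.a_succ_pos (n + 1)) hq0.le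
      (h.a_succ_pos n).le hadm).trans le_norm

include hδ hδ'

theorem exists_isStripSystem :
    ∃ (c w : ℕ → ℝ) (N : ℕ), IsStripSystem lam c w δ ∧
      (∀ n ≥ N, a (n + 1) ≤ stripLower lam c (n + 1)) ∧
      (∀ n ≥ N, stripUpper lam c w (n + 1) ≤ b (n + 1)) ∧
      ∀ n ≥ N, w n = rateWidth q a b n := by
  obtain ⟨N, hN⟩ := eventually_atTop.1
    ((h.eventually_isStripStep hq0 hq1 hδΔ hA hA').and h.admissible)
  obtain ⟨c, w, hsys, heq⟩ := exists_isStripSystem_of_isStripStep hδ hδ' h.lam_succ_ne_zero N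
    (rateLeft lam a) (rateWidth q a b) fun n hn => (hN n hn).1
  refine ⟨c, w, N, hsys, fun n hn => ?_, fun n hn => ?_, fun n hn => (heq n hn).2⟩
  · rw [stripLower, add_tsub_cancel_right, (heq n hn).1]
    exact le_norm_mul_exp_rateLeft (h.lam_succ_ne_zero n) (h.a_succ_pos n)
  · rw [stripUpper, add_tsub_cancel_right, (heq n hn).1, (heq n hn).2]
    exact norm_mul_exp_rateLeft_add_rateWidth_le (h.lam_succ_ne_zero n) (h.a_succ_pos n)
      (h.b_succ_pos n) (hN n hn).2.2

theorem one_le_dimH_rateSet : 1 ≤ dimH (rateSet lam a b) := by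
  obtain ⟨c, w, N, hsys, hlow, hupp, -⟩ := h.exists_isStripSystem hq0 hq1 hδ hδ' hδΔ hA hA'
  exact (hsys.one_le_dimH (tendsto_logProd_div_of_le h.a_succ_pos hlow h.tendsto_logProd_div)).trans
    (dimH_mono (stripSet_subset_rateSet hlow hupp))

theorem one_le_dimP_rateSet : 1 ≤ dimP (rateSet lam a b) := by
  obtain ⟨c, w, N, hsys, hlow, hupp, -⟩ := h.exists_isStripSystem hq0 hq1 hδ hδ' hδΔ hA hA'
  exact (hsys.one_le_dimP (tendsto_logProd_div_of_le h.a_succ_pos hlow h.tendsto_logProd_div)).trans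
    (dimP_mono (stripSet_subset_rateSet hlow hupp))

theorem le_dimP_rateSet {M σ : ℝ} (hM : ∀ n, 1 ≤ n → modulus a b (n + 1) / a n ≤ M) (hσ : 0 ≤ σ)
    (hfreq : ∃ᶠ n in atTop, σ * logProd b n ≤ logProd (modulus a b) (n + 1)) :
    ENNReal.ofReal (1 + σ) ≤ dimP (rateSet lam a b) := by
  obtain ⟨c, w, N, hsys, hlow, hupp, hw⟩ := h.exists_isStripSystem hq0 hq1 hδ hδ' hδΔ hA hA'
  have hM1 : 1 ≤ max M 1 := le_max_right _ _
  set κ : ℝ := (1 - q) / max M 1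
  have hκ : 0 < κ := div_pos (by linarith) (by positivity)
  have log_κ_nonpos : Real.log κ ≤ 0 :=
    Real.log_nonpos hκ.le ((div_le_one (by positivity)).2 (by linarith))
  have κ_mul_modulus_le : ∀ n ≥ N, κ * modulus a b (n + 1 + 1) ≤ w (n + 1) := fun n hn => by
    rw [hw (n + 1) (by omega)]
    refine mul_modulus_le_rateWidth hq0.le hq1.le hM1 (h.modulus_succ_pos (n + 1)).le ?_
    rw [← div_le_iff₀ (h.a_succ_pos n)]
    exact (hM (n + 1) (by omega)).trans (le_max_left _ _)
  set f : ℕ → ℝ := fun n => κ * modulus a b (n + 1)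
  set C₁ := logProd (stripUpper lam c w) N - logProd b N
  set C₂ := logProd f N - logProd w N
  refine (hsys.le_dimP_of_logProd_le
    (tendsto_logProd_div_of_le h.a_succ_pos hlow h.tendsto_logProd_div)
    (K := σ * C₁ + C₂ + Real.log (modulus a b 1)) (E := -Real.log κ) hσ (by linarith) ?_).trans
    (dimP_mono (stripSet_subset_rateSet hlow hupp))
  refine (hfreq.and_eventually (eventually_ge_atTop N)).mono ?_
  rintro n ⟨hn, hNn⟩
  have logProd_upper_le : logProd (stripUpper lam c w) n ≤ logProd b n + C₁ := by
    linarith [logProd_sub_logProd_le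
      (fun k => two_pos.trans_le (hsys.two_le_stripUpper k)) hupp hNn]
  have logProd_f_le : logProd f n ≤ logProd w n + C₂ := by
    linarith [logProd_sub_logProd_le (a := f) (α := w)
      (fun k => mul_pos hκ (h.modulus_succ_pos (k + 1))) κ_mul_modulus_le hNn]
  have logProd_f_eq := logProd_const_mul_succ hκ.ne' (fun k => (h.modulus_succ_pos k).ne') n
  linarith [mul_le_mul_of_nonneg_left logProd_upper_le hσ]

end Assumptions

section ExtendedReal

variable {d : ℝ≥0∞} {l : EReal} {u : ℕ → ℝ} {t : ℝ}

theorem coe_le_one_add_of_forall (hl : 0 ≤ l)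
    (h : ∀ τ t : ℝ, 0 ≤ τ → τ < t → l < τ → d ≤ ENNReal.ofReal (1 + t)) :
    (d : EReal) ≤ 1 + l := by
  rw [add_comm, ← EReal.coe_one,
    ← EReal.sub_le_iff_le_add (.inl (EReal.coe_ne_bot 1)) (.inl (EReal.coe_ne_top 1))]
  refine EReal.le_of_forall_lt_iff_le.1 fun t hlt => ?_
  obtain ⟨τ, hlτ, hτt⟩ := EReal.lt_iff_exists_real_btwn.1 hlt
  have hτ : 0 ≤ τ := EReal.coe_nonneg.1 (hl.trans hlτ.le)
  have hτt : τ < t := EReal.coe_lt_coe_iff.1 hτt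
  rw [EReal.sub_le_iff_le_add (.inl (EReal.coe_ne_bot 1)) (.inl (EReal.coe_ne_top 1)), add_comm]
  refine (EReal.coe_ennreal_le_coe_ennreal_iff.2 (h τ t hτ hτt hlτ)).trans_eq ?_
  rw [EReal.coe_ennreal_ofReal, max_eq_left (by linarith), EReal.coe_add]

theorem one_add_le_coe_of_forall (hd : 1 ≤ d)
    (h : ∀ s : ℝ, 0 ≤ s → s < l → ENNReal.ofReal (1 + s) ≤ d) : 1 + l ≤ (d : EReal) := by
  rw [add_comm, ← EReal.coe_one,
    ← EReal.le_sub_iff_add_le (.inl (EReal.coe_ne_bot 1)) (.inl (EReal.coe_ne_top 1))]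
  refine EReal.ge_of_forall_gt_iff_ge.1 fun s hs => ?_
  rw [EReal.le_sub_iff_add_le (.inl (EReal.coe_ne_bot 1)) (.inl (EReal.coe_ne_top 1)), add_comm]
  have one_add_le_ofReal : (1 + s : EReal) ≤ (ENNReal.ofReal (1 + s) : EReal) := by
    rw [EReal.coe_ennreal_ofReal]
    exact_mod_cast le_max_left _ _
  refine one_add_le_ofReal.trans (EReal.coe_ennreal_le_coe_ennreal_iff.2 ?_)
  rcases le_or_gt 0 s with hs0 | hs0
  · exact h s hs0 hs
  · exact (ENNReal.ofReal_le_one.2 (by linarith)).trans hd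

theorem zero_le_liminf_coe (h : ∀ z < 0, ∀ᶠ n in atTop, z ≤ u n) :
    0 ≤ liminf (fun n => (u n : EReal)) atTop := by
  refine EReal.ge_of_forall_gt_iff_ge.1 fun z hz => le_liminf_of_le (by isBoundedDefault) ?_
  exact (h z (EReal.coe_neg'.1 hz)).mono fun n hn => EReal.coe_le_coe_iff.2 hn

theorem frequently_lt_of_liminf_coe_lt (h : liminf (fun n => (u n : EReal)) atTop < t) :
    ∃ᶠ n in atTop, u n < t :=
  (frequently_lt_of_liminf_lt (by isBoundedDefault) h).mono fun _ => EReal.coe_lt_coe_iff.1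

theorem eventually_lt_of_limsup_coe_lt (h : limsup (fun n => (u n : EReal)) atTop < t) :
    ∀ᶠ n in atTop, u n < t :=
  (eventually_lt_of_limsup_lt h).mono fun _ => EReal.coe_lt_coe_iff.1

theorem frequently_lt_of_lt_limsup_coe (h : t < limsup (fun n => (u n : EReal)) atTop) :
    ∃ᶠ n in atTop, t < u n :=
  (frequently_lt_of_lt_limsup (by isBoundedDefault) h).mono fun _ => EReal.coe_lt_coe_iff.1

end ExtendedReal

namespace Assumptions

variable {q Δ A δ M : ℝ} {lam : ℕ → ℂ} {a b : ℕ → ℝ}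

theorem eventually_logProd_pos (h : Assumptions q Δ A lam a b) :
    ∀ᶠ n in atTop, 0 < logProd a n := by
  filter_upwards [eventually_mul_le h.tendsto_logProd_div 1, eventually_gt_atTop 0] with n hn hn0
  rw [one_mul] at hn
  exact (Nat.cast_pos.2 hn0).trans_le hn

theorem eventually_mul_logProd_le (h : Assumptions q Δ A lam a b) (hΔ : 0 < Δ) {z : ℝ}
    (hz : z < 0) : ∀ᶠ n in atTop, z * logProd a n ≤ logProd (modulus a b) (n + 1) :=
  eventually_mul_le_logProd_succ hΔ h.le_modulus_succ h.tendsto_logProd_div hz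

theorem coe_dimH_rateSet_le (h : Assumptions q Δ A lam a b) (hA : 1 ≤ A) (hΔ : 0 < Δ) :
    (dimH (rateSet lam a b) : EReal) ≤ 1 + liminf (fun n : ℕ =>
      ((Real.log (∏ i ∈ Finset.Icc 1 n, modulus a b i) /
        (Real.log (∏ i ∈ Finset.Ico 1 n, a i) +
          Real.posLog (a n / modulus a b (n + 1))) : ℝ) : EReal)) atTop := by
  rw [← Filter.liminf_nat_add _ 1]
  simp only [log_prod_Icc_one h.modulus_succ_pos, log_prod_Ico_one h.a_succ_pos]
  refine coe_le_one_add_of_forall (zero_le_liminf_coe fun z hz => ?_) fun τ t hτ hτt hlt => ?_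
  · filter_upwards [h.eventually_mul_logProd_le hΔ hz, h.eventually_logProd_pos] with n hn hpos
    have posLog_nonneg : 0 ≤ Real.posLog (a (n + 1) / modulus a b (n + 1 + 1)) :=
      Real.posLog_nonneg
    rw [le_div_iff₀ (by linarith)]
    nlinarith
  · refine h.dimH_rateSet_le hA hΔ hτ hτt le_rfl
      (((frequently_lt_of_liminf_coe_lt hlt).and_eventually h.eventually_logProd_pos).mono ?_)
    rintro n ⟨hn, hpos⟩
    rw [one_mul]
    refine or_iff_not_imp_left.2 fun modulus_gt => ?_
    have posLog_eq_zero : Real.posLog (a (n + 1) / modulus a b (n + 1 + 1)) = 0 := by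
      rw [Real.posLog_eq_zero_iff,
        abs_of_pos (div_pos (h.a_succ_pos n) (h.modulus_succ_pos (n + 1)))]
      exact (div_le_one (h.modulus_succ_pos (n + 1))).2 (not_le.1 modulus_gt).le
    rw [posLog_eq_zero, add_zero, div_lt_iff₀ hpos] at hn
    exact hn.le

theorem coe_dimP_rateSet_le (h : Assumptions q Δ A lam a b) (hA : 1 ≤ A) (hΔ : 0 < Δ) :
    (dimP (rateSet lam a b) : EReal) ≤ 1 + limsup (fun n : ℕ =>
      ((Real.log (∏ i ∈ Finset.Icc 1 (n + 1), modulus a b i) /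
        Real.log (∏ i ∈ Finset.Icc 1 n, a i) : ℝ) : EReal)) atTop := by
  simp only [log_prod_Icc_one h.modulus_succ_pos, log_prod_Icc_one h.a_succ_pos]
  refine coe_le_one_add_of_forall
    ((zero_le_liminf_coe fun z hz => ?_).trans liminf_le_limsup) fun τ t hτ hτt hlt => ?_
  · filter_upwards [h.eventually_mul_logProd_le hΔ hz, h.eventually_logProd_pos] with n hn hpos
    rwa [le_div_iff₀ hpos]
  · refine h.dimP_rateSet_le hA hΔ hτ hτt ?_
    filter_upwards [eventually_lt_of_limsup_coe_lt hlt, h.eventually_logProd_pos] with n hn hpos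
    exact ((div_lt_iff₀ hpos).1 hn).le

theorem dimH_rateSet_le_one (h : Assumptions q Δ A lam a b) (hA : 1 ≤ A) (hΔ : 0 < Δ)
    (hM : ∀ n, 1 ≤ n → modulus a b (n + 1) / a n ≤ M) : dimH (rateSet lam a b) ≤ 1 := by
  rw [← EReal.coe_ennreal_le_coe_ennreal_iff, ← add_zero ((1 : ℝ≥0∞) : EReal)]
  refine coe_le_one_add_of_forall le_rfl fun τ t hτ hτt _ =>
    h.dimH_rateSet_le hA hΔ hτ hτt (le_max_right M 1) (Frequently.of_forall fun n => Or.inl ?_)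
  rw [← div_le_iff₀ (h.a_succ_pos n)]
  exact (hM (n + 1) (by omega)).trans (le_max_left _ _)

theorem one_add_limsup_le_dimP (h : Assumptions q Δ A lam a b) (hq0 : 0 < q) (hq1 : q < 1)
    (hδ : 0 < δ) (hδ' : δ ≤ 1 / 4) (hδΔ : 2 * δ ≤ Δ) (hA : 64 / δ ≤ A)
    (hA' : 2 * δ / (1 - q) ≤ A) (hM : ∀ n, 1 ≤ n → modulus a b (n + 1) / a n ≤ M) :
    1 + limsup (fun n : ℕ => ((Real.log (∏ i ∈ Finset.Icc 1 (n + 1), modulus a b i) /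
      Real.log (∏ i ∈ Finset.Icc 1 n, b i) : ℝ) : EReal)) atTop ≤
        (dimP (rateSet lam a b) : EReal) := by
  simp only [log_prod_Icc_one h.modulus_succ_pos, log_prod_Icc_one h.b_succ_pos]
  refine one_add_le_coe_of_forall (h.one_le_dimP_rateSet hq0 hq1 hδ hδ' hδΔ hA hA')
    fun σ hσ hlt => h.le_dimP_rateSet hq0 hq1 hδ hδ' hδΔ hA hA' hM hσ
      (((frequently_lt_of_lt_limsup_coe hlt).and_eventually h.eventually_logProd_pos).mono ?_)
  rintro n ⟨hn, hpos⟩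
  have logProd_b_pos : 0 < logProd b n :=
    hpos.trans_le (logProd_mono h.a_succ_pos (fun k => (h.a_lt_b_succ k).le) n)
  exact ((lt_div_iff₀ logProd_b_pos).1 hn).le

end Assumptions

end ExpIter

theorem corollary2p3 (q Δ : ℝ) (hq0 : 0 < q) (hq1 : q < 1) (hΔ : 0 < Δ) :
    ∃ A : ℝ, ∀ (lam : ℕ → ℂ) (a b : ℕ → ℝ), ExpIter.Assumptions q Δ A lam a b →
      (1 ≤ dimH (ExpIter.rateSet lam a b) ∧
        (dimH (ExpIter.rateSet lam a b) : EReal) ≤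
          1 + liminf (fun n : ℕ =>
            ((Real.log (∏ i ∈ Finset.Icc 1 n, ExpIter.modulus a b i) /
              (Real.log (∏ i ∈ Finset.Ico 1 n, a i) +
                Real.posLog (a n / ExpIter.modulus a b (n + 1))) : ℝ) : EReal)) atTop) ∧
      (1 ≤ ExpIter.dimP (ExpIter.rateSet lam a b) ∧
        (ExpIter.dimP (ExpIter.rateSet lam a b) : EReal) ≤
          1 + limsup (fun n : ℕ =>
            ((Real.log (∏ i ∈ Finset.Icc 1 (n + 1), ExpIter.modulus a b i) /
              Real.log (∏ i ∈ Finset.Icc 1 n, a i) : ℝ) : EReal)) atTop) ∧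
      ((∃ M : ℝ, ∀ n, 1 ≤ n → ExpIter.modulus a b (n + 1) / a n ≤ M) →
        dimH (ExpIter.rateSet lam a b) = 1 ∧
        1 + limsup (fun n : ℕ =>
            ((Real.log (∏ i ∈ Finset.Icc 1 (n + 1), ExpIter.modulus a b i) /
              Real.log (∏ i ∈ Finset.Icc 1 n, b i) : ℝ) : EReal)) atTop ≤
          (ExpIter.dimP (ExpIter.rateSet lam a b) : EReal)) := by
  set δ : ℝ := min (Δ / 2) (1 / 4)
  have hδ : 0 < δ := by positivity
  have hδ' : δ ≤ 1 / 4 := min_le_right _ _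
  have hδΔ : 2 * δ ≤ Δ := by linarith [min_le_left (Δ / 2) (1 / 4)]
  set A : ℝ := max 1 (max (64 / δ) (2 * δ / (1 - q)))
  have one_le_A : 1 ≤ A := le_max_left _ _
  have hA : 64 / δ ≤ A := (le_max_left _ _).trans (le_max_right _ _)
  have hA' : 2 * δ / (1 - q) ≤ A := (le_max_right _ _).trans (le_max_right _ _)
  refine ⟨A, fun lam a b h => ?_⟩
  have one_le_dimH := h.one_le_dimH_rateSet hq0 hq1 hδ hδ' hδΔ hA hA'
  refine ⟨⟨one_le_dimH, h.coe_dimH_rateSet_le one_le_A hΔ⟩,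
    ⟨h.one_le_dimP_rateSet hq0 hq1 hδ hδ' hδΔ hA hA', h.coe_dimP_rateSet_le one_le_A hΔ⟩, ?_⟩
  rintro ⟨M, hM⟩
  exact ⟨(h.dimH_rateSet_le_one one_le_A hΔ hM).antisymm one_le_dimH,
    h.one_add_limsup_le_dimP hq0 hq1 hδ hδ' hδΔ hA hA' hM⟩
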